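/- Let $$G=\{w=(w_1,w_2,w_3,w_4)\in\mathbb C^4:\ |w_1|^2+|w_2|^2+|w_3|^2+|w_4|^2<1,\ w_1w_4=w_2w_3\},$$ and let $M=\operatorname{Reg}G$ be the $3$-dimensional complex manifold of regular points of $G$. Let $A^2_{(3,0)}(M)$ be the Bergman space of holomorphic $(3,0)$-forms $\varphi$ on $M$ that are square integrable for the inner product $(\varphi,\psi)=i^{9}\int_M\varphi\wedge\overline\psi$, and define the Bergman kernel form of $G$ by $$K_G(x,\bar x)=i^{9}\sum_{k}\varphi_k(x)\wedge\overline{\varphi_k(x)},\qquad x\in M,$$ where $\{\varphi_k\}$ is any orthonormal basis of $A^2_{(3,0)}(M)$. Then $A^2_{(3,0)}(M)\neq\{0\}$, the form $K_G$ is well defined (an orthonormal basis exists, and for every orthonormal basis the series converges pointwise to one and the same form), and $K_G$ is algebraic: for every $z_0\in M$ there are a domain $U\subset\mathbb C^4\cong\mathbb R^8$ containing $z_0$ and a real-algebraic differential form $\psi$ on $U$ whose restriction to $U\cap M$ equals $K_G$. Here a form on $U$ is real-algebraic if the real and imaginary parts of all its coefficients in the real coordinates of $\mathbb R^8$ are real-algebraic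 functions, and a function $f:U\to\mathbb R$ is real-algebraic if it is real analytic and $P(x,f(x))=0$ for all $x\in U$ for some nonzero real polynomial $P(x,y)$. -/

import Mathlib

open Set MeasureTheory

noncomputable section

namespace Bergman

/-! ### Algebra of forms -/

section Forms

variable {E : Type*} [AddCommGroup E] [Module ℂ E]

/-- A complex-multilinear alternating form, regarded as a complex-valued real-multilinear one. -/
def restrictReal {n : ℕ} (φ : E [⋀^Fin n]→ₗ[ℂ] ℂ) : E [⋀^Fin n]→ₗ[ℝ] ℂ :=
  { φ.toMultilinearMap.restrictScalars ℝ with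
    map_eq_zero_of_eq' := φ.map_eq_zero_of_eq' }

/-- The conjugate `φ̄` of a complex-valued real-multilinear form. -/
def conjForm {n : ℕ} (φ : E [⋀^Fin n]→ₗ[ℝ] ℂ) : E [⋀^Fin n]→ₗ[ℝ] ℂ :=
  Complex.conjLIE.toLinearEquiv.toLinearMap.compAlternatingMap φ

/-- The wedge product of complex-valued forms: the sum over all `(m, n)`-shuffles `σ` of
`sign σ * α (v_{σ 1}, …, v_{σ m}) * β (v_{σ (m+1)}, …, v_{σ (m+n)})`. -/
def wedge {m n : ℕ} (α : E [⋀^Fin m]→ₗ[ℝ] ℂ) (β : E [⋀^Fin n]→ₗ[ℝ] ℂ) :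
    E [⋀^Fin (m + n)]→ₗ[ℝ] ℂ :=
  ((LinearMap.mul' ℝ ℂ).compAlternatingMap (α.domCoprod β)).domDomCongr finSumFinEquiv

/-- `i^{n²} φ ∧ ψ̄` for two `(n,0)`-covectors `φ`, `ψ`. -/
def hermWedge {n : ℕ} (φ ψ : E [⋀^Fin n]→ₗ[ℂ] ℂ) : E [⋀^Fin (n + n)]→ₗ[ℝ] ℂ :=
  Complex.I ^ (n ^ 2) • wedge (restrictReal φ) (conjForm (restrictReal ψ))

end Forms

/-! ### The regular part of a subset of `ℂ^N` as a complex manifold -/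

/-- A holomorphic parametrization of an open piece of `X ⊆ ℂ^N` by an open subset of `ℂ^n`: an
injective holomorphic immersion that is a homeomorphism onto a relatively open subset of `X`. -/
structure LocalParam (n : ℕ) {N : ℕ} (X : Set (Fin N → ℂ)) where
  /-- the domain of the parametrization -/
  source : Set (Fin n → ℂ)
  /-- the parametrization, relevant on `source` only -/
  toFun : (Fin n → ℂ) → (Fin N → ℂ)
  isOpen_source : IsOpen source
  differentiableOn : DifferentiableOn ℂ toFun source
  injOn : InjOn toFun source
  immersion : ∀ x ∈ source, Function.Injective (fderiv ℂ toFun x)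
  isOpen_image : ∀ W ⊆ source, IsOpen W → ∃ U, IsOpen U ∧ toFun '' W = U ∩ X

variable {n N : ℕ}

/-- The `n`-dimensional regular points of `X`: those near which `X` is an `n`-dimensional complex
submanifold of `ℂ^N`. -/
def regularPart (n : ℕ) (X : Set (Fin N → ℂ)) : Set (Fin N → ℂ) :=
  {p | ∃ γ : LocalParam n X, p ∈ γ.toFun '' γ.source}

/-- The complex tangent space at `p`, spanned by the velocities of the parametrizations of `X`
through `p`. -/
def tangentSpace (n : ℕ) (X : Set (Fin N → ℂ)) (p : Fin N → ℂ) : Submodule ℂ (Fin N → ℂ) :=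
  Submodule.span ℂ
    {v | ∃ γ : LocalParam n X, ∃ x ∈ γ.source, γ.toFun x = p ∧ ∃ u, fderiv ℂ γ.toFun x u = v}

/-- `(n,0)`-forms on the `n`-dimensional complex manifold `regularPart n X`. -/
abbrev HolForm (n : ℕ) (X : Set (Fin N → ℂ)) : Type :=
  (p : regularPart n X) → (tangentSpace n X p) [⋀^Fin n]→ₗ[ℂ] ℂ

/-- Complex-valued real differential forms of degree `k` on `regularPart n X`. -/
abbrev RealForm (n k : ℕ) (X : Set (Fin N → ℂ)) : Type :=
  (p : regularPart n X) → (tangentSpace n X p) [⋀^Fin k]→ₗ[ℝ] ℂ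

namespace LocalParam

variable {X : Set (Fin N → ℂ)} (γ : LocalParam n X)

/-- The point of the regular part with parameter `x`. -/
def pt (x : γ.source) : regularPart n X :=
  ⟨γ.toFun x, γ, x, x.2, rfl⟩

/-- The differential of the parametrization at `x`, applied to `u`, as a tangent vector. -/
def push (x : γ.source) (u : Fin n → ℂ) : tangentSpace n X (γ.pt x) :=
  ⟨fderiv ℂ γ.toFun x u, Submodule.subset_span ⟨γ, x, x.2, rfl, u, rfl⟩⟩

open Classical in
/-- The coefficient `f` in `γ^* φ = f dz_1 ∧ ⋯ ∧ dz_n` (zero outside the source). -/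
def coeff (φ : HolForm n X) (x : Fin n → ℂ) : ℂ :=
  if h : x ∈ γ.source then
    φ (γ.pt ⟨x, h⟩) (fun j => γ.push ⟨x, h⟩ (Pi.single j 1))
  else 0

/-- The positively oriented real basis `e_1, i e_1, e_2, i e_2, …, e_n, i e_n` of `ℂ^n`. -/
def orientedBasis (n : ℕ) (k : Fin (n + n)) : Fin n → ℂ :=
  Pi.single ⟨k / 2, by omega⟩ (if (k : ℕ) % 2 = 0 then 1 else Complex.I)

open Classical in
/-- The coefficient `g` in `γ^* ω = g dx_1 ∧ dy_1 ∧ ⋯ ∧ dx_n ∧ dy_n` of a form of top degree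
(zero outside the source). -/
def topCoeff (ω : RealForm n (n + n) X) (x : Fin n → ℂ) : ℂ :=
  if h : x ∈ γ.source then
    ω (γ.pt ⟨x, h⟩) (fun k => γ.push ⟨x, h⟩ (orientedBasis n k))
  else 0

end LocalParam

/-! ### Integration of forms of top degree -/

/-- A partition of the regular part into countably many measurable pieces, each of them
in the image of one parametrization. -/
structure Dissection (n : ℕ) {N : ℕ} (X : Set (Fin N → ℂ)) where
  /-- the parametrizations -/
  chart : ℕ → LocalParam n X
  /-- the pieces, in the parameter domains -/
  piece : ℕ → Set (Fin n → ℂ)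
  measurableSet_piece : ∀ j, MeasurableSet (piece j)
  piece_subset : ∀ j, piece j ⊆ (chart j).source
  disjoint : Pairwise fun j k =>
    Disjoint ((chart j).toFun '' piece j) ((chart k).toFun '' piece k)
  cover : ⋃ j, (chart j).toFun '' piece j = regularPart n X

namespace Dissection

variable {X : Set (Fin N → ℂ)} (D : Dissection n X)

/-- Absolute integrability of a form of top degree, tested on the pieces of `D`. -/
def Integrable (ω : RealForm n (n + n) X) : Prop :=
  (∀ j, IntegrableOn ((D.chart j).topCoeff ω) (D.piece j)) ∧
    Summable fun j => ∫ x in D.piece j, ‖(D.chart j).topCoeff ω x‖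

/-- The integral of a form of top degree, computed on the pieces of `D`. -/
def integral (ω : RealForm n (n + n) X) : ℂ :=
  ∑' j, ∫ x in D.piece j, (D.chart j).topCoeff ω x

end Dissection

/-- Absolute integrability of a form of top degree over the manifold `regularPart n X`. -/
def FormIntegrable {X : Set (Fin N → ℂ)} (ω : RealForm n (n + n) X) : Prop :=
  ∃ D : Dissection n X, D.Integrable ω

open Classical in
/-- The integral of a form of top degree over `regularPart n X` with its complex orientation. By
the change of variables formula the dissection is immaterial. Zero if `ω` is not integrable. -/
def formIntegral {X : Set (Fin N → ℂ)} (ω : RealForm n (n + n) X) : ℂ :=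
  if h : ∃ D : Dissection n X, D.Integrable ω then h.choose.integral ω else 0

/-! ### The Bergman space and the Bergman kernel form -/

/-- The inner product `(φ, ψ) = i^{n²} ∫ φ ∧ ψ̄`. -/
def innerForm {X : Set (Fin N → ℂ)} (φ ψ : HolForm n X) : ℂ :=
  formIntegral (X := X) fun p => hermWedge (φ p) (ψ p)

/-- Holomorphy of an `(n,0)`-form. -/
def IsHolomorphic {X : Set (Fin N → ℂ)} (φ : HolForm n X) : Prop :=
  ∀ γ : LocalParam n X, DifferentiableOn ℂ (γ.coeff φ) γ.source

/-- The Bergman space of square integrable holomorphic `(n,0)`-forms on `regularPart n X`. -/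
def bergmanSpace (n : ℕ) (X : Set (Fin N → ℂ)) : Set (HolForm n X) :=
  {φ | IsHolomorphic φ ∧ FormIntegrable (X := X) fun p => hermWedge (φ p) (φ p)}

/-- Orthonormal bases of the Bergman space: orthonormal systems to which no nonzero element of the
Bergman space is orthogonal. -/
structure IsOrthonormalBasis {X : Set (Fin N → ℂ)} (S : Set (HolForm n X)) : Prop where
  subset : S ⊆ bergmanSpace n X
  norm_one : ∀ φ ∈ S, innerForm φ φ = 1
  orthogonal : ∀ φ ∈ S, ∀ ψ ∈ S, φ ≠ ψ → innerForm φ ψ = 0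
  total : ∀ φ ∈ bergmanSpace n X, (∀ ψ ∈ S, innerForm φ ψ = 0) → φ = 0

/-- `K` is the Bergman kernel form `K(x, x̄) = i^{n²} ∑ φ_k(x) ∧ φ̄_k(x)` of `X`, that is, of the
complex manifold of regular points of `X`: the Bergman space is nonzero and has an orthonormal
basis, and for every orthonormal basis the series converges to `K`. -/
structure IsBergmanKernelForm {X : Set (Fin N → ℂ)} (K : RealForm n (n + n) X) : Prop where
  nontrivial : ∃ φ ∈ bergmanSpace n X, φ ≠ 0
  exists_basis : ∃ S : Set (HolForm n X), IsOrthonormalBasis S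
  hasSum : ∀ S : Set (HolForm n X), IsOrthonormalBasis S →
    ∀ (p : regularPart n X) (v : Fin (n + n) → tangentSpace n X p),
      HasSum (fun φ : S => hermWedge (φ.1 p) (φ.1 p) v) (K p v)

/-! ### Real-algebraic functions and forms -/

/-- The real coordinates `(Re z, Im z)` of `z ∈ ℂ^N ≅ ℝ^{2N}`. -/
def realCoord (z : Fin N → ℂ) : Fin N ⊕ Fin N → ℝ :=
  Sum.elim (fun j => (z j).re) (fun j => (z j).im)

/-- The real basis of `ℂ^N` that belongs to `realCoord`. -/
def realBasis : Fin N ⊕ Fin N → Fin N → ℂ :=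
  Sum.elim (fun j => Pi.single j 1) (fun j => Pi.single j Complex.I)

/-- `f` is real-algebraic on `U ⊆ ℂ^N ≅ ℝ^{2N}`: it is real analytic there and `P(x, f(x)) = 0` on
`U` for a nonzero real polynomial `P(x, y)`; the variable `y` has index `none`. -/
def IsRealAlgebraicOn (U : Set (Fin N → ℂ)) (f : (Fin N → ℂ) → ℝ) : Prop :=
  AnalyticOnNhd ℝ f U ∧
    ∃ P : MvPolynomial (Option (Fin N ⊕ Fin N)) ℝ, P ≠ 0 ∧
      ∀ z ∈ U, MvPolynomial.eval (fun o => o.elim (f z) (realCoord z)) P = 0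

/-- A form on `U ⊆ ℂ^N ≅ ℝ^{2N}` is real-algebraic if the real and imaginary parts of all its
coefficients with respect to the real coordinates are. -/
def IsRealAlgebraicFormOn {k : ℕ} (U : Set (Fin N → ℂ))
    (ψ : (Fin N → ℂ) → (Fin N → ℂ) [⋀^Fin k]→ₗ[ℝ] ℂ) : Prop :=
  ∀ c : Fin k → Fin N ⊕ Fin N,
    IsRealAlgebraicOn U (fun z => (ψ z fun j => realBasis (c j)).re) ∧
      IsRealAlgebraicOn U (fun z => (ψ z fun j => realBasis (c j)).im)

/-- A form on the regular part of `X` is real-algebraic if near every point it is the restriction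
of a real-algebraic form on a domain of `ℂ^N`. -/
def IsRealAlgebraicForm {k : ℕ} {X : Set (Fin N → ℂ)} (ω : RealForm n k X) : Prop :=
  ∀ p : regularPart n X, ∃ U : Set (Fin N → ℂ), p.1 ∈ U ∧ IsOpen U ∧ IsConnected U ∧
    ∃ ψ : (Fin N → ℂ) → (Fin N → ℂ) [⋀^Fin k]→ₗ[ℝ] ℂ, IsRealAlgebraicFormOn U ψ ∧
      ∀ q : regularPart n X, q.1 ∈ U → ∀ v : Fin k → tangentSpace n X q,
        ψ q (fun j => (v j : Fin N → ℂ)) = ω q v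

/-- The domain `G = {w ∈ ℂ⁴ : |w| < 1, w₁ w₄ = w₂ w₃}` (indices start at `0` here). -/
def domainG : Set (Fin 4 → ℂ) :=
  {w | ∑ j, ‖w j‖ ^ 2 < 1 ∧ w 0 * w 3 = w 1 * w 2}

end Bergman

end

open Set MeasureTheory Filter Topology

/-! The regular part of `domainG` is the cone without its vertex. The chart (x, y, z) ↦ (x, xy, xz,
xyz) covers it up to a null set, with parameter domain |x|²(1+|y|²)(1+|z|²) < 1. The residue `omega`
of dw₀∧dw₁∧dw₂∧dw₃/(w₀w₃ − w₁w₂) is holomorphic and vanishes nowhere, so every (3,0)-form is f·omega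
(`exists_eq_ofFun`). Since omega = −x dx∧dy∧dz in this chart, the norm of f·omega is that of √8·x·f
in L² of the parameter domain (`innerForm_ofFun`). The integral over an arbitrary dissection reduces
to this one by change of variables (`formIntegral_eq`).

A three-dimensional torus acts by rotating x, y, z. The Fourier coefficients of a holomorphic f
along the orbits are multiples of Laurent monomials x^k y^a z^b, and holomorphy in the charts `chart
0`, `chart 1`, `chart 2` forces 0 ≤ a, b ≤ k (`ConeHol.exponent_bounds`). Monomials of different
weight are orthogonal, and an f orthogonal to all of them has no Fourier coefficients, so it
vanishes (`ConeHol.eq_zero`). The monomials are therefore a complete orthogonal system.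

The squared norm of a monomial form is 8π³ / ((k+2)(k+1)² C(k,a) C(k,b)) (`lintegral_monomial`).
Every point of the cone is a product (αγ, αδ, βγ, βδ), so the binomial theorem in each factor
evaluates the sum in degree k as (k+2)(k+1)²/(8π³)·|w|^(2k) (`sum_norm_basisFun`). Summation over k
gives (2+4t)/(8π³(1−t)⁴) at t = |w|² (`kernelFun_eq`).

For independence of the basis, the Bergman space is identified with ℓ² by `synth`, and Parseval's
identity is applied to the vector representing evaluation at w (`hasSum_hermWedge`). Finally `omega`
is the contraction of the determinant by the conjugate gradient divided by |w|². The kernel form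
thus extends to a form on the punctured ball whose coefficients are rational in the real
coordinates, hence real-algebraic. -/

namespace Bergman

/-! ### Holomorphic functions of several variables: parameter integrals, derivatives, series. -/

section SeveralVariables

open Metric Filter Topology

/-- Difference quotients show that the derivative of a measurable family is measurable. -/
theorem aestronglyMeasurable_fderiv {α : Type*} [MeasurableSpace α] {μ : Measure α} {n : ℕ}
    {F : α → (Fin n → ℂ) → ℂ} {U : Set (Fin n → ℂ)} (hU : IsOpen U) {p : Fin n → ℂ} (hp : p ∈ U)
    (hd : ∀ a, DifferentiableAt ℂ (F a) p)
    (hm : ∀ q ∈ U, AEStronglyMeasurable (fun a => F a q) μ) :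
    AEStronglyMeasurable (fun a => fderiv ℂ (F a) p) μ := by
  obtain ⟨ε, hε, hball⟩ := Metric.isOpen_iff.1 hU p hp
  have key : ∀ j : Fin n, AEStronglyMeasurable (fun a => fderiv ℂ (F a) p (Pi.single j 1)) μ := by
    intro j
    -- The increments (c k)⁻¹ have modulus ε/(2(k+1)), so the difference quotients use only points
    -- of the ball of radius ε.
    set c : ℕ → ℂ := fun k => ((2 * (k + 1) / ε : ℝ) : ℂ) with hc
    have hcn : ∀ k, ‖c k‖ = 2 * (k + 1) / ε := fun k => by
      rw [hc]; simp only [Complex.norm_real, Real.norm_eq_abs]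
      exact abs_of_nonneg (by positivity)
    have hct : Tendsto (fun k => ‖c k‖) atTop atTop := by
      simp_rw [hcn]
      refine Tendsto.atTop_div_const hε (Tendsto.const_mul_atTop two_pos ?_)
      exact tendsto_atTop_add_const_right _ _ tendsto_natCast_atTop_atTop
    refine aestronglyMeasurable_of_tendsto_ae atTop
      (f := fun k a => c k • (F a (p + (c k)⁻¹ • Pi.single j 1) - F a p)) ?_ ?_
    · intro k
      refine (AEStronglyMeasurable.sub (hm _ (hball ?_)) (hm _ hp)).const_smul (c k)
      rw [mem_ball, dist_eq_norm, add_sub_cancel_left, norm_smul, norm_inv, hcn]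
      have h1 : ‖(Pi.single j 1 : Fin n → ℂ)‖ = 1 := by simp [Pi.norm_single]
      rw [h1, mul_one, inv_div, div_lt_iff₀ (by positivity)]
      nlinarith [(Nat.cast_nonneg k : (0 : ℝ) ≤ k)]
    · exact Eventually.of_forall fun a => (hd a).hasFDerivAt.lim _ hct
  have : (fun a => fderiv ℂ (F a) p) = fun a => ∑ j : Fin n,
      (fderiv ℂ (F a) p (Pi.single j 1)) •
        (ContinuousLinearMap.proj j : (Fin n → ℂ) →L[ℂ] ℂ) := by
    funext a
    ext v
    conv_lhs => rw [pi_eq_sum_univ' v, map_sum]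
    simp [mul_comm]
  rw [this]
  exact Finset.aestronglyMeasurable_fun_sum _ fun j _ => (key j).smul_const _

/-- A locally bounded integral of holomorphic functions is holomorphic. -/
theorem differentiableOn_integral {α : Type*} [MeasurableSpace α] {μ : Measure α}
    [IsFiniteMeasure μ] {n : ℕ} {F : α → (Fin n → ℂ) → ℂ} {U : Set (Fin n → ℂ)} (hU : IsOpen U)
    (hd : ∀ a, DifferentiableOn ℂ (F a) U)
    (hm : ∀ q ∈ U, AEStronglyMeasurable (fun a => F a q) μ)
    (hb : ∀ p ∈ U, ∃ ε > 0, ∃ M : ℝ, ∀ a, ∀ q ∈ ball p ε, q ∈ U → ‖F a q‖ ≤ M) :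
    DifferentiableOn ℂ (fun p => ∫ a, F a p ∂μ) U := by
  intro p hp
  obtain ⟨ε₁, hε₁, M, hM⟩ := hb p hp
  obtain ⟨ε₂, hε₂, hball⟩ := Metric.isOpen_iff.1 hU p hp
  set ε := min ε₁ ε₂
  have hε : 0 < ε := lt_min hε₁ hε₂
  have hsub : ball p ε ⊆ U := (ball_subset_ball (min_le_right _ _)).trans hball
  have hM' : ∀ a, ∀ q ∈ ball p ε, ‖F a q‖ ≤ M := fun a q hq =>
    hM a q (ball_subset_ball (min_le_left _ _) hq) (hsub hq)
  refine (hasFDerivAt_integral_of_dominated_loc_of_lip' (𝕜 := ℂ) (F := fun q a => F a q)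
    (F' := fun a => fderiv ℂ (F a) p) (bound := fun _ => (M + M) / ε)
    (ball_mem_nhds p hε) (fun q hq => hm q (hsub hq)) ?_ ?_ ?_ (integrable_const _)
    ?_).2.differentiableAt.differentiableWithinAt
  · exact Integrable.of_bound (hm p hp) M (Eventually.of_forall fun a => hM' a p (mem_ball_self hε))
  · exact aestronglyMeasurable_fderiv hU hp
      (fun a => (hd a).differentiableAt (hU.mem_nhds hp)) hm
  · refine Eventually.of_forall fun a q hq => ?_
    -- Schwarz's lemma: F a maps the ball into a closed ball of radius 2M around F a p, which gives
    -- a Lipschitz bound at p independent of a.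
    have := Complex.dist_le_div_mul_dist_of_mapsTo_ball (R₂ := M + M) ((hd a).mono hsub) ?_ hq
    · simpa [dist_eq_norm] using this
    · intro r hr
      rw [mem_closedBall, dist_eq_norm]
      exact (norm_sub_le _ _).trans (add_le_add (hM' a r hr) (hM' a p (mem_ball_self hε)))
  · exact Eventually.of_forall fun a => ((hd a).differentiableAt (hU.mem_nhds hp)).hasFDerivAt

/-- The directional derivative of a holomorphic function as a Cauchy integral. -/
theorem fderiv_apply_eq_integral {n : ℕ} {f : (Fin n → ℂ) → ℂ} {U : Set (Fin n → ℂ)}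
    (hU : IsOpen U) (hf : DifferentiableOn ℂ f U) (p u : Fin n → ℂ) {R : ℝ} (hR : 0 < R)
    (hsub : ∀ ζ ∈ closedBall (0 : ℂ) R, p + ζ • u ∈ U) :
    fderiv ℂ f p u = (2 * Real.pi * Complex.I : ℂ)⁻¹ * ∫ θ in Ioc 0 (2 * Real.pi),
      deriv (circleMap 0 R) θ * ((circleMap 0 R θ ^ 2)⁻¹ * f (p + circleMap 0 R θ • u)) := by
  have hp : p ∈ U := by simpa using hsub 0 (by simp [hR.le])
  have hfp : HasFDerivAt f (fderiv ℂ f p) (p + (0 : ℂ) • u) := by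
    simpa using (hf.differentiableAt (hU.mem_nhds hp)).hasFDerivAt
  have hline : ∀ ζ : ℂ, HasDerivAt (fun ζ : ℂ => p + ζ • u) u ζ := fun ζ => by
    simpa using ((hasDerivAt_id ζ).smul_const u).const_add p
  have hder : deriv (fun ζ : ℂ => f (p + ζ • u)) 0 = fderiv ℂ f p u :=
    (hfp.comp_hasDerivAt (0 : ℂ) (hline 0)).deriv
  have hopen : IsOpen {ζ : ℂ | p + ζ • u ∈ U} := hU.preimage (by fun_prop)
  have hg : DifferentiableOn ℂ (fun ζ : ℂ => f (p + ζ • u)) {ζ : ℂ | p + ζ • u ∈ U} :=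
    hf.comp (fun ζ _ => (hline ζ).differentiableAt.differentiableWithinAt) fun _ h => h
  rw [← hder, ← Complex.two_pi_I_inv_smul_circleIntegral_sub_sq_inv_smul_of_differentiable hopen
    hsub hg (mem_ball_self hR)]
  simp only [circleIntegral, sub_zero, smul_eq_mul]
  rw [intervalIntegral.integral_of_le (by positivity)]

/-- Directional derivatives of holomorphic functions are holomorphic. -/
theorem differentiableOn_fderiv_apply {n : ℕ} {f : (Fin n → ℂ) → ℂ} {U : Set (Fin n → ℂ)}
    (hU : IsOpen U) (hf : DifferentiableOn ℂ f U) (u : Fin n → ℂ) :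
    DifferentiableOn ℂ (fun p => fderiv ℂ f p u) U := by
  intro p₀ hp₀
  obtain ⟨ε, hε, hball⟩ := Metric.isOpen_iff.1 hU p₀ hp₀
  -- With R‖u‖ ≤ ε/2, the discs p + ζu with p in the ball of radius ε/4 stay in the closed ball of
  -- radius 3ε/4, a compact subset of U on which f is bounded.
  set R := ε / (2 * (‖u‖ + 1)) with hRdef
  have hu : 0 < ‖u‖ + 1 := by positivity
  have hR : 0 < R := by positivity
  have hRu : R * ‖u‖ ≤ ε / 2 := by
    rw [hRdef, div_mul_eq_mul_div, div_le_iff₀ (by positivity)]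
    nlinarith
  have hmem : ∀ p ∈ ball p₀ (ε / 4), ∀ ζ ∈ closedBall (0 : ℂ) R,
      p + ζ • u ∈ closedBall p₀ (3 * ε / 4) := by
    intro p hp ζ hζ
    rw [mem_ball, dist_eq_norm] at hp
    rw [mem_closedBall, dist_zero_right] at hζ
    rw [mem_closedBall, dist_eq_norm, add_sub_right_comm]
    refine (norm_add_le _ _).trans ?_
    rw [norm_smul]
    nlinarith [mul_le_mul_of_nonneg_right hζ (norm_nonneg u)]
  have hcl : closedBall p₀ (3 * ε / 4) ⊆ U :=
    (closedBall_subset_ball (by linarith)).trans hball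
  obtain ⟨M, hM⟩ := (isCompact_closedBall p₀ (3 * ε / 4)).exists_bound_of_continuousOn
    (hf.continuousOn.mono hcl)
  have hM0 : 0 ≤ M := (norm_nonneg _).trans (hM p₀ (mem_closedBall_self (by positivity)))
  have hcirc : ∀ θ, circleMap 0 R θ ∈ closedBall (0 : ℂ) R := fun θ =>
    circleMap_mem_closedBall 0 hR.le θ
  have hnorm : ∀ θ, ‖circleMap 0 R θ‖ = R := fun θ => by simp [abs_of_pos hR]
  have hmaps : ∀ θ, MapsTo (fun p => p + circleMap 0 R θ • u) (ball p₀ (ε / 4)) U :=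
    fun θ p hp => hcl (hmem p hp _ (hcirc θ))
  have key : DifferentiableOn ℂ (fun p => ∫ θ in Ioc 0 (2 * Real.pi),
      deriv (circleMap 0 R) θ * ((circleMap 0 R θ ^ 2)⁻¹ * f (p + circleMap 0 R θ • u)))
      (ball p₀ (ε / 4)) := by
    refine differentiableOn_integral isOpen_ball (fun θ => ?_) (fun q hq => ?_) (fun p _ => ?_)
    · refine DifferentiableOn.const_mul (DifferentiableOn.const_mul ?_ _) _
      exact hf.comp (by fun_prop) (hmaps θ)
    · refine Continuous.aestronglyMeasurable ?_
      have h1 : Continuous fun θ => f (q + circleMap 0 R θ • u) :=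
        hf.continuousOn.comp_continuous (by fun_prop) fun θ => hmaps θ hq
      have h2 : Continuous fun θ => (circleMap 0 R θ ^ 2)⁻¹ :=
        Continuous.inv₀ (by fun_prop) fun θ => pow_ne_zero 2 (circleMap_ne_center hR.ne')
      simp only [deriv_circleMap]
      exact ((continuous_circleMap 0 R).mul continuous_const).mul (h2.mul h1)
    · refine ⟨1, one_pos, R * ((R ^ 2)⁻¹ * M), fun θ q _ hq => ?_⟩
      rw [norm_mul, norm_mul, norm_inv, norm_pow, hnorm, deriv_circleMap, norm_mul, hnorm,
        Complex.norm_I, mul_one]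
      gcongr
      exact hM _ (hmem q hq _ (hcirc θ))
  have hev : ∀ p ∈ ball p₀ (ε / 4), fderiv ℂ f p u = (2 * Real.pi * Complex.I : ℂ)⁻¹ *
      ∫ θ in Ioc 0 (2 * Real.pi), deriv (circleMap 0 R) θ *
        ((circleMap 0 R θ ^ 2)⁻¹ * f (p + circleMap 0 R θ • u)) := fun p hp =>
    fderiv_apply_eq_integral hU hf p u hR fun ζ hζ => hcl (hmem p hp ζ hζ)
  have hnhds : ball p₀ (ε / 4) ∈ 𝓝 p₀ := ball_mem_nhds _ (by positivity)
  refine (((key.differentiableAt hnhds).const_mul (2 * Real.pi * Complex.I : ℂ)⁻¹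
    ).congr_of_eventuallyEq ?_).differentiableWithinAt
  filter_upwards [hnhds] with p hp using hev p hp

/-- A series of holomorphic functions with summable sup norms has a holomorphic sum. -/
theorem differentiableOn_tsum_of_bound {ι E : Type*} [NormedAddCommGroup E] [NormedSpace ℂ E]
    {U : Set E} (hU : IsOpen U) {f : ι → E → ℂ} {b : ι → ℝ} (hb : Summable b)
    (hf : ∀ i, DifferentiableOn ℂ (f i) U) (hfb : ∀ i, ∀ p ∈ U, ‖f i p‖ ≤ b i) :
    DifferentiableOn ℂ (fun p => ∑' i, f i p) U := by
  intro p hp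
  obtain ⟨ε, hε, hball⟩ := Metric.isOpen_iff.1 hU p hp
  let : NormedSpace ℝ E := NormedSpace.restrictScalars ℝ ℂ E
  have hsub : ∀ q ∈ ball p (ε / 2), ball q (ε / 2) ⊆ U := fun q hq => by
    refine (ball_subset_ball' ?_).trans hball
    have := mem_ball.1 hq
    linarith
  have hqU : ∀ q ∈ ball p (ε / 2), q ∈ U := fun q hq => hsub q hq (mem_ball_self (by positivity))
  refine (hasFDerivAt_tsum_of_isPreconnected (𝕜 := ℂ) (f' := fun i q => fderiv ℂ (f i) q)
    (u := fun i => (b i + b i) / (ε / 2)) ((hb.add hb).div_const _) isOpen_ball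
    (convex_ball p (ε / 2)).isPreconnected (fun i q hq => ?_) (fun i q hq => ?_)
    (mem_ball_self (by positivity)) ?_
    (mem_ball_self (by positivity))).differentiableAt.differentiableWithinAt
  · exact ((hf i).differentiableAt (hU.mem_nhds (hqU q hq))).hasFDerivAt
  · refine Complex.norm_fderiv_le_div_of_mapsTo_ball ((hf i).mono (hsub q hq)) (fun r hr => ?_)
      (by positivity)
    rw [mem_closedBall, dist_eq_norm]
    exact (norm_sub_le _ _).trans (add_le_add (hfb i r (hsub q hq hr)) (hfb i q (hqU q hq)))
  · exact Summable.of_norm_bounded hb fun i => hfb i p hp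

end SeveralVariables

/-! ### The quadric cone -/

/-- The quadratic form `w₀ w₃ - w₁ w₂`. -/
def quadric (w : Fin 4 → ℂ) : ℂ := w 0 * w 3 - w 1 * w 2

/-- The differential of `quadric` at `p`. -/
def dquadric (p : Fin 4 → ℂ) : (Fin 4 → ℂ) →ₗ[ℂ] ℂ :=
  p 3 • LinearMap.proj 0 + p 0 • LinearMap.proj 3 - p 2 • LinearMap.proj 1 - p 1 • LinearMap.proj 2

theorem dquadric_apply (p v : Fin 4 → ℂ) :
    dquadric p v = p 3 * v 0 + p 0 * v 3 - p 2 * v 1 - p 1 * v 2 := by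
  simp [dquadric]

theorem mem_domainG {w : Fin 4 → ℂ} :
    w ∈ domainG ↔ ∑ j, ‖w j‖ ^ 2 < 1 ∧ w 0 * w 3 = w 1 * w 2 := Iff.rfl

theorem quadric_eq_zero {w : Fin 4 → ℂ} (hw : w ∈ domainG) : quadric w = 0 :=
  sub_eq_zero.2 hw.2

/-- The matrix of the polar form of `quadric`. -/
def quadricMatrix : Matrix (Fin 4) (Fin 4) ℂ :=
  !![0, 0, 0, 1; 0, 0, -1, 0; 0, -1, 0, 0; 1, 0, 0, 0]

theorem toBilin'_quadricMatrix (u v : Fin 4 → ℂ) :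
    Matrix.toBilin' quadricMatrix u v = dquadric u v := by
  rw [Matrix.toBilin'_apply, dquadric_apply]
  simp [quadricMatrix, Fin.sum_univ_four]
  ring

theorem quadric_add (u v : Fin 4 → ℂ) :
    quadric (u + v) = quadric u + quadric v + dquadric u v := by
  simp only [quadric, dquadric_apply, Pi.add_apply]; ring

/-- A nondegenerate quadratic form in four variables has no isotropic subspace of dimension
three. -/
theorem not_isotropic {D : (Fin 3 → ℂ) →ₗ[ℂ] (Fin 4 → ℂ)} (hD : Function.Injective D) :
    ¬ ∀ u, quadric (D u) = 0 := by
  intro h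
  have hdet : quadricMatrix.det ≠ 0 := by
    simp [quadricMatrix, Matrix.det_succ_row_zero, Fin.sum_univ_succ, Fin.succAbove]
  set B := Matrix.toBilin' quadricMatrix
  have hB : B.Nondegenerate :=
    LinearMap.BilinForm.nondegenerate_toBilin'_of_det_ne_zero' _ hdet
  -- By polarization an isotropic subspace lies in its own orthogonal complement. For nondegenerate
  -- B the dimensions would give 3 ≤ 4 − 3.
  have hle : LinearMap.range D ≤ B.orthogonal (LinearMap.range D) := by
    rintro _ ⟨u, rfl⟩
    rw [LinearMap.BilinForm.mem_orthogonal_iff]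
    rintro _ ⟨v, rfl⟩
    have h1 := quadric_add (D v) (D u)
    rw [← map_add, h, h, h, zero_add, zero_add] at h1
    exact (toBilin'_quadricMatrix _ _).trans h1.symm
  have h2 := Submodule.finrank_mono hle
  rw [LinearMap.BilinForm.finrank_orthogonal hB, LinearMap.finrank_range_of_inj hD] at h2
  simp at h2

theorem LocalParam.hasFDerivAt {n N : ℕ} {X : Set (Fin N → ℂ)} (γ : LocalParam n X)
    {x : Fin n → ℂ} (hx : x ∈ γ.source) : HasFDerivAt γ.toFun (fderiv ℂ γ.toFun x) x :=
  (γ.differentiableOn.differentiableAt (γ.isOpen_source.mem_nhds hx)).hasFDerivAt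

theorem LocalParam.mapsTo {n N : ℕ} {X : Set (Fin N → ℂ)} (γ : LocalParam n X) :
    MapsTo γ.toFun γ.source X := by
  obtain ⟨U, -, hU⟩ := γ.isOpen_image _ Subset.rfl γ.isOpen_source
  exact fun x hx => (hU ▸ mem_image_of_mem γ.toFun hx : γ.toFun x ∈ U ∩ X).2

/-- The cone is singular at the vertex. If γ(x) = 0, then k·γ(x + u/k) tends to the derivative Du;
by homogeneity these vectors lie on the quadric, and so does Du. The injective image of D would be
an isotropic subspace of dimension three. -/
theorem LocalParam.ne_zero (γ : LocalParam 3 domainG) {x : Fin 3 → ℂ} (hx : x ∈ γ.source) :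
    γ.toFun x ≠ 0 := by
  intro h0
  refine not_isotropic (D := (fderiv ℂ γ.toFun x).toLinearMap) (γ.immersion x hx) fun u => ?_
  have hc : Tendsto (fun k : ℕ => ‖(k : ℂ)‖) atTop atTop := by
    simpa using tendsto_natCast_atTop_atTop (R := ℝ)
  have hlim := (γ.hasFDerivAt hx).lim u hc
  have hq : Continuous quadric := by unfold quadric; fun_prop
  have hlim' := (hq.tendsto _).comp hlim
  refine tendsto_nhds_unique hlim' (tendsto_const_nhds.congr' ?_)
  have hinv : Tendsto (fun k : ℕ => x + (k : ℂ)⁻¹ • u) atTop (𝓝 x) := by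
    have h1 : Tendsto (fun k : ℕ => (k : ℂ)⁻¹) atTop (𝓝 0) := tendsto_inv_atTop_nhds_zero_nat
    simpa using (h1.smul_const u).const_add x
  filter_upwards [hinv.eventually (γ.isOpen_source.mem_nhds hx)] with k hk
  have h2 := quadric_eq_zero (γ.mapsTo hk)
  simp only [Function.comp, h0, sub_zero, quadric, Pi.smul_apply, smul_eq_mul] at h2 ⊢
  linear_combination -(k : ℂ) ^ 2 * h2

theorem LocalParam.dquadric_fderiv (γ : LocalParam 3 domainG) {x : Fin 3 → ℂ}
    (hx : x ∈ γ.source) (u : Fin 3 → ℂ) : dquadric (γ.toFun x) (fderiv ℂ γ.toFun x u) = 0 := by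
  have hfd : HasFDerivAt γ.toFun (fderiv ℂ γ.toFun x) (x + (0 : ℂ) • u) := by
    simpa using γ.hasFDerivAt hx
  have hline : HasDerivAt (fun t : ℂ => x + t • u) u 0 := by
    simpa using ((hasDerivAt_id (0 : ℂ)).smul_const u).const_add x
  have hc := hasDerivAt_pi.1 (hfd.comp_hasDerivAt (0 : ℂ) hline)
  have hQ := ((hc 0).mul (hc 3)).sub ((hc 1).mul (hc 2))
  have hev : ∀ᶠ t : ℂ in 𝓝 0, x + t • u ∈ γ.source := by
    refine hline.continuousAt.eventually (γ.isOpen_source.mem_nhds ?_)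
    simpa using hx
  have h0 : HasDerivAt (fun _ : ℂ => (0 : ℂ)) _ 0 := hQ.congr_of_eventuallyEq (by
    filter_upwards [hev] with t ht
    exact (quadric_eq_zero (γ.mapsTo ht)).symm)
  have h1 := h0.unique (hasDerivAt_const (0 : ℂ) (0 : ℂ))
  simp only [Function.comp, zero_smul, add_zero] at h1
  rw [dquadric_apply]
  linear_combination h1

theorem dquadric_ne_zero {p : Fin 4 → ℂ} (hp : p ≠ 0) : dquadric p ≠ 0 := by
  intro h
  refine hp (funext fun i => ?_)
  have := fun j => LinearMap.congr_fun h (Pi.single j 1)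
  have h0 := this 0; have h1 := this 1; have h2 := this 2; have h3 := this 3
  simp [dquadric_apply] at h0 h1 h2 h3
  fin_cases i <;> assumption

theorem finrank_ker_dquadric {p : Fin 4 → ℂ} (hp : p ≠ 0) :
    Module.finrank ℂ (LinearMap.ker (dquadric p)) = 3 := by
  have h1 := LinearMap.finrank_range_add_finrank_ker (dquadric p)
  have h2 : LinearMap.range (dquadric p) = ⊤ :=
    LinearMap.range_eq_top.2 (LinearMap.surjective (dquadric_ne_zero hp))
  rw [h2] at h1
  simp at h1
  omega

theorem LocalParam.range_fderiv (γ : LocalParam 3 domainG) {x : Fin 3 → ℂ} (hx : x ∈ γ.source) :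
    LinearMap.range (fderiv ℂ γ.toFun x).toLinearMap = LinearMap.ker (dquadric (γ.toFun x)) := by
  refine Submodule.eq_of_le_of_finrank_eq ?_ ?_
  · rintro _ ⟨u, rfl⟩
    exact γ.dquadric_fderiv hx u
  · rw [finrank_ker_dquadric (γ.ne_zero hx),
      LinearMap.finrank_range_of_inj (f := (fderiv ℂ γ.toFun x).toLinearMap) (γ.immersion x hx)]
    simp

/-- One parametrization already has the whole kernel as the range of its differential, by
`LocalParam.range_fderiv`, so the span over all parametrizations is no larger. -/
theorem tangentSpace_eq {p : Fin 4 → ℂ} (hp : p ∈ regularPart 3 domainG) :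
    tangentSpace 3 domainG p = LinearMap.ker (dquadric p) := by
  refine le_antisymm (Submodule.span_le.2 ?_) ?_
  · rintro _ ⟨γ, x, hx, rfl, u, rfl⟩
    exact γ.dquadric_fderiv hx u
  · obtain ⟨γ, x, hx, rfl⟩ := hp
    rw [← γ.range_fderiv hx]
    rintro _ ⟨u, rfl⟩
    exact Submodule.subset_span ⟨γ, x, hx, rfl, u, rfl⟩

/-! ### Explicit charts -/

/-- The permutation `i ↦ a xor i` of the coordinates, a symmetry of `domainG`. -/
noncomputable def twist (a : Fin 4) : (Fin 4 → ℂ) →L[ℂ] (Fin 4 → ℂ) :=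
  ContinuousLinearMap.pi fun i => ContinuousLinearMap.proj (a ^^^ i)

@[simp] theorem twist_apply (a : Fin 4) (w : Fin 4 → ℂ) (i : Fin 4) :
    twist a w i = w (a ^^^ i) := rfl

theorem twist_twist (a : Fin 4) (w : Fin 4 → ℂ) : twist a (twist a w) = w := by
  funext i
  have : a ^^^ (a ^^^ i) = i := by revert a i; decide
  simp [this]

theorem sum_norm_twist (a : Fin 4) (w : Fin 4 → ℂ) :
    ∑ j, ‖twist a w j‖ ^ 2 = ∑ j, ‖w j‖ ^ 2 := by
  fin_cases a <;> simp [Fin.sum_univ_four] <;> ring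

/-- The pairs {0, 3} and {1, 2} are the cosets of {0, 3} under xor; the permutation either preserves
or exchanges them, and with them the two sides of the equation. -/
theorem twist_mem {a : Fin 4} {w : Fin 4 → ℂ} : twist a w ∈ domainG ↔ w ∈ domainG := by
  rw [mem_domainG, mem_domainG, sum_norm_twist]
  refine and_congr_right fun _ => ?_
  fin_cases a <;> simp <;> constructor <;> intro h <;> grind

/-- The parameters of a neighbourhood of the ruling coordinates. -/
def baseDomain : Set (Fin 3 → ℂ) :=
  {p | p 0 ≠ 0 ∧ ‖p 0‖ ^ 2 * (1 + ‖p 1‖ ^ 2) * (1 + ‖p 2‖ ^ 2) < 1}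

/-- The parametrization `(x, y, z) ↦ (x, x y, x z, x y z)` of the cone. -/
noncomputable def baseMap (p : Fin 3 → ℂ) : Fin 4 → ℂ := ![p 0, p 0 * p 1, p 0 * p 2, p 0 * p 1 * p 2]

/-- The inverse of `baseMap`. -/
noncomputable def baseInv (w : Fin 4 → ℂ) : Fin 3 → ℂ := ![w 0, w 1 / w 0, w 2 / w 0]

theorem isOpen_baseDomain : IsOpen baseDomain := by
  have h1 : IsOpen {p : Fin 3 → ℂ | p 0 ≠ 0} :=
    isOpen_ne_fun (continuous_apply 0) continuous_const
  have h2 : Continuous fun p : Fin 3 → ℂ => ‖p 0‖ ^ 2 * (1 + ‖p 1‖ ^ 2) * (1 + ‖p 2‖ ^ 2) := by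
    fun_prop
  exact h1.inter (isOpen_lt h2 continuous_const)

theorem sum_norm_baseMap (p : Fin 3 → ℂ) :
    ∑ j, ‖baseMap p j‖ ^ 2 = ‖p 0‖ ^ 2 * (1 + ‖p 1‖ ^ 2) * (1 + ‖p 2‖ ^ 2) := by
  simp [Fin.sum_univ_four, baseMap]
  ring

theorem baseMap_mem {p : Fin 3 → ℂ} (hp : p ∈ baseDomain) : baseMap p ∈ domainG := by
  refine ⟨(sum_norm_baseMap p).trans_lt hp.2, ?_⟩
  simp [baseMap]; ring

theorem baseInv_baseMap {p : Fin 3 → ℂ} (hp : p 0 ≠ 0) : baseInv (baseMap p) = p := by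
  funext i
  fin_cases i <;> simp [baseInv, baseMap, hp]

theorem baseMap_baseInv {w : Fin 4 → ℂ} (hw : w ∈ domainG) (h0 : w 0 ≠ 0) :
    baseMap (baseInv w) = w := by
  have := hw.2
  funext i
  fin_cases i <;> simp [baseInv, baseMap] <;> field_simp
  linear_combination -this

theorem baseInv_mem {w : Fin 4 → ℂ} (hw : w ∈ domainG) (h0 : w 0 ≠ 0) :
    baseInv w ∈ baseDomain := by
  refine ⟨h0, ?_⟩
  rw [← sum_norm_baseMap, baseMap_baseInv hw h0]
  exact hw.1

theorem differentiable_baseMap : Differentiable ℂ baseMap := by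
  refine differentiable_pi.2 fun i => ?_
  fin_cases i <;> simp [baseMap] <;> fun_prop

theorem differentiableOn_baseInv : DifferentiableOn ℂ baseInv {w | w 0 ≠ 0} := by
  have h : ∀ i : Fin 4, DifferentiableOn ℂ (fun w : Fin 4 → ℂ => w i) {w | w 0 ≠ 0} := by
    intro i; fun_prop
  have h1 : ∀ i : Fin 4, DifferentiableOn ℂ (fun w : Fin 4 → ℂ => w i / w 0) {w | w 0 ≠ 0} := by
    intro i
    simp only [div_eq_mul_inv]
    exact (h i).fun_mul ((h 0).fun_inv fun w hw => hw)
  refine differentiableOn_pi.2 fun i => ?_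
  fin_cases i
  · exact h 0
  · exact h1 1
  · exact h1 2

/-- The chart centred at the `a`-th coordinate axis. -/
noncomputable def chartMap (a : Fin 4) (p : Fin 3 → ℂ) : Fin 4 → ℂ := twist a (baseMap p)

/-- The inverse of `chartMap a`. -/
noncomputable def chartInv (a : Fin 4) (w : Fin 4 → ℂ) : Fin 3 → ℂ := baseInv (twist a w)

theorem twist_zero_apply (a : Fin 4) (w : Fin 4 → ℂ) : twist a w 0 = w a := by
  have : a ^^^ 0 = a := by revert a; decide
  simp [this]

theorem chartInv_chartMap (a : Fin 4) {p : Fin 3 → ℂ} (hp : p 0 ≠ 0) :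
    chartInv a (chartMap a p) = p := by
  rw [chartInv, chartMap, twist_twist, baseInv_baseMap hp]

theorem chartMap_chartInv {a : Fin 4} {w : Fin 4 → ℂ} (hw : w ∈ domainG) (ha : w a ≠ 0) :
    chartMap a (chartInv a w) = w := by
  rw [chartInv, chartMap, baseMap_baseInv (twist_mem.2 hw) (by rwa [twist_zero_apply]),
    twist_twist]

theorem chartMap_mem (a : Fin 4) {p : Fin 3 → ℂ} (hp : p ∈ baseDomain) : chartMap a p ∈ domainG :=
  twist_mem.2 (baseMap_mem hp)

theorem chartInv_mem {a : Fin 4} {w : Fin 4 → ℂ} (hw : w ∈ domainG) (ha : w a ≠ 0) :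
    chartInv a w ∈ baseDomain :=
  baseInv_mem (twist_mem.2 hw) (by rwa [twist_zero_apply])

theorem chartMap_apply_self (a : Fin 4) (p : Fin 3 → ℂ) : chartMap a p a = p 0 := by
  have : a ^^^ a = 0 := by revert a; decide
  simp [chartMap, this, baseMap]

theorem differentiable_chartMap (a : Fin 4) : Differentiable ℂ (chartMap a) :=
  (twist a).differentiable.comp differentiable_baseMap

theorem differentiableOn_chartInv (a : Fin 4) :
    DifferentiableOn ℂ (chartInv a) {w | w a ≠ 0} :=
  differentiableOn_baseInv.comp (twist a).differentiable.differentiableOn fun w hw => by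
    rw [mem_ofPred_eq, twist_zero_apply]; exact hw

theorem isOpen_ne_zero (a : Fin 4) : IsOpen {w : Fin 4 → ℂ | w a ≠ 0} :=
  isOpen_ne_fun (continuous_apply a) continuous_const

/-- The charts `chartMap a` as parametrizations of the regular part of `domainG`. -/
noncomputable def chart (a : Fin 4) : LocalParam 3 domainG where
  source := baseDomain
  toFun := chartMap a
  isOpen_source := isOpen_baseDomain
  differentiableOn := (differentiable_chartMap a).differentiableOn
  injOn := fun p hp q hq h => by
    rw [← chartInv_chartMap a hp.1, h, chartInv_chartMap a hq.1]
  immersion := fun p hp => by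
    -- The chart has a holomorphic left inverse, so the chain rule makes its differential injective.
    have h1 : DifferentiableAt ℂ (chartInv a) (chartMap a p) :=
      (differentiableOn_chartInv a).differentiableAt
        ((isOpen_ne_zero a).mem_nhds (by rw [mem_ofPred_eq, chartMap_apply_self]; exact hp.1))
    have h2 := h1.hasFDerivAt.comp p (differentiable_chartMap a p).hasFDerivAt
    have h3 : HasFDerivAt (chartInv a ∘ chartMap a) (ContinuousLinearMap.id ℂ _) p :=
      (hasFDerivAt_id p).congr_of_eventuallyEq (by
        filter_upwards [isOpen_baseDomain.mem_nhds hp] with q hq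
        exact chartInv_chartMap a hq.1)
    have h4 := h2.unique h3
    intro u v huv
    have h5 := DFunLike.congr_fun h4 u
    have h6 := DFunLike.congr_fun h4 v
    simp only [ContinuousLinearMap.comp_apply, ContinuousLinearMap.id_apply] at h5 h6
    rw [← h5, huv, h6]
  isOpen_image := fun W hW hWo => by
    refine ⟨{w | w a ≠ 0} ∩ chartInv a ⁻¹' W, ?_, ?_⟩
    · exact (differentiableOn_chartInv a).continuousOn.isOpen_inter_preimage (isOpen_ne_zero a) hWo
    · ext w
      constructor
      · rintro ⟨p, hp, rfl⟩
        have := hW hp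
        refine ⟨⟨?_, ?_⟩, chartMap_mem a this⟩
        · rw [mem_ofPred_eq, chartMap_apply_self]; exact this.1
        · rw [mem_preimage, chartInv_chartMap a this.1]; exact hp
      · rintro ⟨⟨h1, h2⟩, h3⟩
        exact ⟨chartInv a w, h2, chartMap_chartInv h3 h1⟩

theorem exists_ne_zero {p : Fin 4 → ℂ} (hp : p ≠ 0) : ∃ a, p a ≠ 0 := Function.ne_iff.1 hp

theorem mem_regularPart {p : Fin 4 → ℂ} : p ∈ regularPart 3 domainG ↔ p ∈ domainG ∧ p ≠ 0 := by
  constructor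
  · rintro ⟨γ, x, hx, rfl⟩
    exact ⟨γ.mapsTo hx, γ.ne_zero hx⟩
  · rintro ⟨hp, h0⟩
    obtain ⟨a, ha⟩ := exists_ne_zero h0
    exact ⟨chart a, chartInv a p, chartInv_mem hp ha, chartMap_chartInv hp ha⟩

/-! ### Calculus of the hermitian wedge product -/

section Wedge

variable {E F : Type*} [AddCommGroup E] [Module ℂ E] [AddCommGroup F] [Module ℂ F]

@[simp] theorem restrictReal_apply {n : ℕ} (φ : E [⋀^Fin n]→ₗ[ℂ] ℂ) (v : Fin n → E) :
    restrictReal φ v = φ v := rfl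

@[simp] theorem conjForm_apply {n : ℕ} (φ : E [⋀^Fin n]→ₗ[ℝ] ℂ) (v : Fin n → E) :
    conjForm φ v = (starRingEnd ℂ) (φ v) := rfl

/-- A sum over shuffles is a sum over cosets of permutations. Multiplied by m! n! it becomes a sum
over all permutations, in which the algebraic rules for `hermWedge` can be read off term by term and
the factor cancelled. -/
theorem factorial_mul_wedge {m n : ℕ} (α : E [⋀^Fin m]→ₗ[ℝ] ℂ) (β : E [⋀^Fin n]→ₗ[ℝ] ℂ)
    (v : Fin (m + n) → E) :
    ((m.factorial * n.factorial : ℕ) : ℂ) * wedge α β v =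
      ∑ σ : Equiv.Perm (Fin m ⊕ Fin n), ((Equiv.Perm.sign σ : ℤ) : ℂ) *
        (α (fun i => v (finSumFinEquiv (σ (Sum.inl i)))) *
          β (fun i => v (finSumFinEquiv (σ (Sum.inr i))))) := by
  have h := congrArg (fun g => LinearMap.mul' ℝ ℂ (g (v ∘ finSumFinEquiv)))
    (MultilinearMap.domCoprod_alternization_eq α β)
  simp only [MultilinearMap.alternatization_apply, map_sum, Fintype.card_fin,
    AlternatingMap.smul_apply, map_nsmul] at h
  rw [nsmul_eq_mul] at h
  refine h.symm.trans (Finset.sum_congr rfl fun σ _ => ?_)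
  rw [Units.smul_def, map_zsmul, zsmul_eq_mul]
  rfl

theorem hermWedge_apply {n : ℕ} (φ ψ : E [⋀^Fin n]→ₗ[ℂ] ℂ) (v : Fin (n + n) → E) :
    hermWedge φ ψ v = Complex.I ^ (n ^ 2) * wedge (restrictReal φ) (conjForm (restrictReal ψ)) v :=
  rfl

theorem factorial_mul_hermWedge {n : ℕ} (φ ψ : E [⋀^Fin n]→ₗ[ℂ] ℂ) (v : Fin (n + n) → E) :
    ((n.factorial * n.factorial : ℕ) : ℂ) * hermWedge φ ψ v =
      Complex.I ^ (n ^ 2) * ∑ σ : Equiv.Perm (Fin n ⊕ Fin n), ((Equiv.Perm.sign σ : ℤ) : ℂ) *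
        (φ (fun i => v (finSumFinEquiv (σ (Sum.inl i)))) *
          (starRingEnd ℂ) (ψ (fun i => v (finSumFinEquiv (σ (Sum.inr i)))))) := by
  rw [hermWedge_apply, mul_left_comm, factorial_mul_wedge]
  simp

theorem factorial_cast_ne_zero (n : ℕ) : ((n.factorial * n.factorial : ℕ) : ℂ) ≠ 0 := by
  exact_mod_cast mul_ne_zero n.factorial_ne_zero n.factorial_ne_zero

theorem hermWedge_smul_smul {n : ℕ} (a b : ℂ) (φ ψ : E [⋀^Fin n]→ₗ[ℂ] ℂ) (v : Fin (n + n) → E) :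
    hermWedge (a • φ) (b • ψ) v = a * (starRingEnd ℂ) b * hermWedge φ ψ v := by
  apply mul_left_cancel₀ (factorial_cast_ne_zero n)
  rw [mul_left_comm, factorial_mul_hermWedge, factorial_mul_hermWedge, Finset.mul_sum,
    Finset.mul_sum, Finset.mul_sum]
  refine Finset.sum_congr rfl fun σ _ => ?_
  simp only [AlternatingMap.smul_apply, smul_eq_mul, map_mul]
  ring

theorem hermWedge_sum_sum {n : ℕ} {ι : Type*} (s : Finset ι) (φ ψ : ι → E [⋀^Fin n]→ₗ[ℂ] ℂ)
    (v : Fin (n + n) → E) :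
    hermWedge (∑ i ∈ s, φ i) (∑ j ∈ s, ψ j) v = ∑ i ∈ s, ∑ j ∈ s, hermWedge (φ i) (ψ j) v := by
  apply mul_left_cancel₀ (factorial_cast_ne_zero n)
  simp only [Finset.mul_sum, factorial_mul_hermWedge]
  have h : ∀ (φ : ι → E [⋀^Fin n]→ₗ[ℂ] ℂ) (w : Fin n → E),
      (∑ i ∈ s, φ i) w = ∑ i ∈ s, φ i w := fun φ w =>
    map_sum ({ toFun := fun φ => φ w, map_zero' := rfl, map_add' := fun _ _ => rfl } :
      (E [⋀^Fin n]→ₗ[ℂ] ℂ) →+ ℂ) φ s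
  simp only [h, map_sum, Finset.sum_mul_sum]
  simp only [Finset.mul_sum]
  rw [Finset.sum_comm]
  refine Finset.sum_congr rfl fun i _ => ?_
  rw [Finset.sum_comm]

theorem hermWedge_comp {n : ℕ} (φ ψ : E [⋀^Fin n]→ₗ[ℂ] ℂ) (f : F →ₗ[ℂ] E) (v : Fin (n + n) → F) :
    hermWedge φ ψ (fun i => f (v i)) =
      hermWedge (φ.compLinearMap f) (ψ.compLinearMap f) v := by
  apply mul_left_cancel₀ (factorial_cast_ne_zero n)
  rw [factorial_mul_hermWedge, factorial_mul_hermWedge]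
  rfl

/-- The product of the coordinates as a real multilinear form. -/
noncomputable def prodCoord : MultilinearMap ℝ (fun _ : Fin 3 => Fin 3 → ℂ) ℂ :=
  (MultilinearMap.mkPiAlgebra ℝ (Fin 3) ℂ).compLinearMap fun i => LinearMap.proj i

/-- The product of the conjugate coordinates as a real multilinear form. -/
noncomputable def prodConjCoord : MultilinearMap ℝ (fun _ : Fin 3 => Fin 3 → ℂ) ℂ :=
  (MultilinearMap.mkPiAlgebra ℝ (Fin 3) ℂ).compLinearMap fun i =>
    Complex.conjAe.toLinearMap ∘ₗ LinearMap.proj i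

theorem restrictReal_det :
    restrictReal (Matrix.detRowAlternating (n := Fin 3) (R := ℂ)) =
      MultilinearMap.alternatization prodCoord := by
  ext v
  simp only [restrictReal_apply, MultilinearMap.alternatization_apply]
  exact (Matrix.det_apply _)

theorem conjForm_det :
    conjForm (restrictReal (Matrix.detRowAlternating (n := Fin 3) (R := ℂ))) =
      MultilinearMap.alternatization prodConjCoord := by
  ext v
  simp only [conjForm_apply, restrictReal_apply, MultilinearMap.alternatization_apply]
  refine (congrArg _ (Matrix.det_apply _)).trans ?_
  rw [map_sum]
  refine Finset.sum_congr rfl fun σ _ => ?_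
  simp [prodConjCoord, Units.smul_def]

/-- Both factors are alternatizations of products of coordinates. Their wedge is the alternatization
of the product of all six coordinates z, z̄, that is, a 6×6 determinant. -/
theorem wedge_det (v : Fin (3 + 3) → Fin 3 → ℂ) :
    wedge (restrictReal (Matrix.detRowAlternating (n := Fin 3) (R := ℂ)))
      (conjForm (restrictReal (Matrix.detRowAlternating (n := Fin 3) (R := ℂ)))) v =
      Matrix.det (Matrix.of fun (k j : Fin 3 ⊕ Fin 3) =>
        Sum.elim (fun i => v (finSumFinEquiv k) i)
          (fun i => (starRingEnd ℂ) (v (finSumFinEquiv k) i)) j) := by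
  rw [conjForm_det, restrictReal_det, wedge, ← MultilinearMap.domCoprod_alternization,
    Matrix.det_apply]
  simp only [AlternatingMap.domDomCongr_apply, LinearMap.compAlternatingMap_apply,
    MultilinearMap.alternatization_apply, map_sum]
  refine Finset.sum_congr rfl fun σ _ => ?_
  rw [Units.smul_def, Units.smul_def, map_zsmul, Fintype.prod_sum_type]
  rfl

/-- Reordering to dz₁dz̄₁dz₂dz̄₂dz₃dz̄₃ costs the sign −1, each pair contributes −2i, and i⁹ = i:
altogether i·(−1)·(−2i)³ = 8. -/
theorem hermWedge_det_orientedBasis :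
    hermWedge (Matrix.detRowAlternating (n := Fin 3) (R := ℂ))
      (Matrix.detRowAlternating (n := Fin 3) (R := ℂ)) (LocalParam.orientedBasis 3) = 8 := by
  rw [hermWedge_apply, wedge_det, ← Matrix.det_submatrix_equiv_self finSumFinEquiv.symm]
  have : (Matrix.of fun (k j : Fin 3 ⊕ Fin 3) =>
        Sum.elim (fun i => LocalParam.orientedBasis 3 (finSumFinEquiv k) i)
          (fun i => (starRingEnd ℂ) (LocalParam.orientedBasis 3 (finSumFinEquiv k) i)) j).submatrix
          finSumFinEquiv.symm finSumFinEquiv.symm =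
      (!![1, 0, 0, 1, 0, 0; Complex.I, 0, 0, -Complex.I, 0, 0; 0, 1, 0, 0, 1, 0;
        0, Complex.I, 0, 0, -Complex.I, 0; 0, 0, 1, 0, 0, 1;
        0, 0, Complex.I, 0, 0, -Complex.I] : Matrix (Fin (3 + 3)) (Fin (3 + 3)) ℂ) := by
    ext k j
    fin_cases k <;> fin_cases j <;>
      simp [LocalParam.orientedBasis, finSumFinEquiv, Fin.addCases, Pi.single_apply]
  rw [this]
  simp [Matrix.det_succ_row_zero, Fin.sum_univ_succ, Fin.succAbove]
  ring_nf
  rw [Complex.I_pow_four, one_mul]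

end Wedge

/-! ### Top degree forms in a chart -/

section TopForms

variable {n N : ℕ} {X : Set (Fin N → ℂ)}

theorem RealForm.congr_point {k : ℕ} (ω : RealForm n k X) {p q : regularPart n X} (h : p = q)
    {v : Fin k → tangentSpace n X p} {w : Fin k → tangentSpace n X q}
    (hvw : ∀ i, (v i : Fin N → ℂ) = w i) : ω p v = ω q w := by
  subst h
  exact congrArg _ (funext fun i => Subtype.ext (hvw i))

/-- A form of top degree transforms with the determinant. -/
theorem map_comp_eq_det_smul {E : Type*} [AddCommGroup E] [Module ℝ E] [Module.Finite ℝ E]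
    {m : ℕ} (hm : Module.finrank ℝ E = m) (g : E [⋀^Fin m]→ₗ[ℝ] ℂ) (L : E →ₗ[ℝ] E)
    (b : Fin m → E) : g (fun i => L (b i)) = LinearMap.det L • g b := by
  set e := Module.finBasisOfFinrankEq ℝ E hm
  have h : ∀ v, g v = e.det v • g e := fun v => by
    have h0 : g = ((LinearMap.toSpanSingleton ℝ ℂ (g e)).compAlternatingMap e.det) := by
      refine Module.Basis.ext_alternating e fun v hv => ?_
      let σ := Equiv.ofBijective v (Finite.injective_iff_bijective.1 hv)
      have h1 : (fun i => e (v i)) = fun i => (e ∘ σ) i := rfl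
      rw [h1]
      change g (e ∘ σ) = e.det (e ∘ σ) • g e
      rw [AlternatingMap.map_perm, AlternatingMap.map_perm, Module.Basis.det_self]
      simp [Units.smul_def]
    exact DFunLike.congr_fun h0 v
  rw [h (fun i => L (b i)), h b, smul_smul]
  congr 1
  exact Module.Basis.det_comp e L b

/-- Being nonnegative, this real Jacobian shows that holomorphic coordinate changes preserve
orientation. -/
theorem det_restrictScalars_eq {E : Type*} [AddCommGroup E] [Module ℂ E] [Module.Finite ℂ E]
    (L : E →ₗ[ℂ] E) : LinearMap.det (L.restrictScalars ℝ) = ‖LinearMap.det L‖ ^ 2 := by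
  rw [LinearMap.det_restrictScalars, Algebra.norm_complex_apply, Complex.normSq_eq_norm_sq]

variable (γ : LocalParam n X)

/-- The differential of a parametrization as a linear map into the tangent space. -/
noncomputable def LocalParam.pushMap (x : γ.source) :
    (Fin n → ℂ) →ₗ[ℂ] tangentSpace n X (γ.pt x) where
  toFun := γ.push x
  map_add' u v := Subtype.ext (map_add _ u v)
  map_smul' c u := Subtype.ext (map_smul _ c u)

theorem LocalParam.pushMap_apply (x : γ.source) (u : Fin n → ℂ) :
    γ.pushMap x u = γ.push x u := rfl

theorem LocalParam.topCoeff_of_mem (ω : RealForm n (n + n) X) {x : Fin n → ℂ} (hx : x ∈ γ.source) :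
    γ.topCoeff ω x = ω (γ.pt ⟨x, hx⟩) fun k => γ.push ⟨x, hx⟩ (orientedBasis n k) := dif_pos hx

@[simp] theorem LocalParam.coe_push (x : γ.source) (u : Fin n → ℂ) :
    (γ.push x u : Fin N → ℂ) = fderiv ℂ γ.toFun x u := rfl

/-- Transformation of the top coefficient under a change of parameters. -/
theorem LocalParam.topCoeff_eq_of_comp (γ' : LocalParam n X) (ω : RealForm n (n + n) X)
    {h : (Fin n → ℂ) → (Fin n → ℂ)} {x : Fin n → ℂ} (hx : x ∈ γ.source) (hhx : h x ∈ γ'.source)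
    {h' : (Fin n → ℂ) →L[ℂ] (Fin n → ℂ)} (hh : HasFDerivAt h h' x)
    (hev : γ.toFun =ᶠ[𝓝 x] γ'.toFun ∘ h) :
    γ.topCoeff ω x = |(h'.restrictScalars ℝ).det| • γ'.topCoeff ω (h x) := by
  have hfd : fderiv ℂ γ.toFun x = (fderiv ℂ γ'.toFun (h x)).comp h' := by
    rw [hev.fderiv_eq]
    have := (γ'.differentiableOn.differentiableAt (γ'.isOpen_source.mem_nhds hhx)).hasFDerivAt
    exact (this.comp x hh).fderiv
  rw [topCoeff, topCoeff, dif_pos hx, dif_pos hhx]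
  have hdet : (h'.restrictScalars ℝ).det = ‖LinearMap.det h'.toLinearMap‖ ^ 2 :=
    det_restrictScalars_eq h'.toLinearMap
  -- The form transforms with the signed determinant; its nonnegativity matches this with the
  -- absolute value in the change of variables formula.
  rw [abs_of_nonneg (by rw [hdet]; positivity)]
  have hpt : γ.pt ⟨x, hx⟩ = γ'.pt ⟨h x, hhx⟩ := Subtype.ext hev.self_of_nhds
  set g : (Fin n → ℂ) [⋀^Fin (n + n)]→ₗ[ℝ] ℂ :=
    (ω (γ'.pt ⟨h x, hhx⟩)).compLinearMap ((γ'.pushMap ⟨h x, hhx⟩).restrictScalars ℝ)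
  have hrank : Module.finrank ℝ (Fin n → ℂ) = n + n := by
    rw [Module.finrank_pi_fintype]
    simp [Complex.finrank_real_complex, mul_two]
  refine (ω.congr_point hpt (w := fun k => γ'.push ⟨h x, hhx⟩
    (h'.restrictScalars ℝ (orientedBasis n k))) fun k => ?_).trans ?_
  · simp [hfd]
  · exact map_comp_eq_det_smul hrank g (h'.restrictScalars ℝ).toLinearMap (orientedBasis n)

end TopForms

/-! ### The holomorphic volume form of the cone -/

/-- Contraction of the standard volume form of `ℂ⁴`. -/
noncomputable def contr (u : Fin 4 → ℂ) : (Fin 4 → ℂ) [⋀^Fin 3]→ₗ[ℂ] ℂ :=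
  (Matrix.detRowAlternating (n := Fin 4) (R := ℂ)).curryLeft u

theorem contr_apply (u : Fin 4 → ℂ) (v : Fin 3 → Fin 4 → ℂ) :
    contr u v = Matrix.det (Matrix.of (Matrix.vecCons u v)) := by
  rw [contr, AlternatingMap.curryLeft_apply_apply]
  rfl

theorem contr_sub (u u' : Fin 4 → ℂ) (v : Fin 3 → Fin 4 → ℂ) :
    contr (u - u') v = contr u v - contr u' v := by
  have h : contr (u - u') = contr u - contr u' :=
    map_sub (Matrix.detRowAlternating (n := Fin 4) (R := ℂ)).curryLeft u u'
  rw [h, AlternatingMap.sub_apply]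

/-- The conjugate gradient of `quadric`. -/
noncomputable def conjGrad (p : Fin 4 → ℂ) : Fin 4 → ℂ :=
  ![(starRingEnd ℂ) (p 3), -(starRingEnd ℂ) (p 2), -(starRingEnd ℂ) (p 1), (starRingEnd ℂ) (p 0)]

/-- The squared norm, as a real number. -/
noncomputable def normSq4 (p : Fin 4 → ℂ) : ℝ := ∑ j, ‖p j‖ ^ 2

theorem normSq4_pos {p : Fin 4 → ℂ} (hp : p ≠ 0) : 0 < normSq4 p := by
  obtain ⟨a, ha⟩ := exists_ne_zero hp
  exact Finset.sum_pos' (fun _ _ => by positivity) ⟨a, Finset.mem_univ _, by positivity⟩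

/-- A vector with `dquadric p (normal p) = 1`. -/
noncomputable def normal (p : Fin 4 → ℂ) : Fin 4 → ℂ := ((normSq4 p : ℂ))⁻¹ • conjGrad p

theorem dquadric_normal {p : Fin 4 → ℂ} (hp : p ≠ 0) : dquadric p (normal p) = 1 := by
  have h1 : (normSq4 p : ℂ) ≠ 0 := by exact_mod_cast (normSq4_pos hp).ne'
  have h2 : dquadric p (conjGrad p) = normSq4 p := by
    simp only [dquadric_apply, conjGrad, normSq4, Fin.sum_univ_four]
    push_cast
    simp only [← Complex.mul_conj']
    simp
    ring
  rw [normal, map_smul, h2, smul_eq_mul, inv_mul_cancel₀ h1]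

/-- The vector u − u' is tangent, like the three v i, and four vectors in a space of dimension three
are dependent. Hence the residue does not depend on the transversal vector, which may be chosen
non-holomorphically, as in `normal`, or adapted to a chart. -/
theorem contr_eq_of_dquadric_eq {p : Fin 4 → ℂ} (hp : p ≠ 0) {u u' : Fin 4 → ℂ}
    (h : dquadric p u = dquadric p u') {v : Fin 3 → Fin 4 → ℂ} (hv : ∀ i, dquadric p (v i) = 0) :
    contr u v = contr u' v := by
  rw [← sub_eq_zero, ← contr_sub, contr_apply]
  refine AlternatingMap.map_linearDependent Matrix.detRowAlternating
    (Matrix.vecCons (u - u') v) fun hli => ?_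
  set w : Fin 4 → LinearMap.ker (dquadric p) := fun i =>
    ⟨Matrix.vecCons (u - u') v i, by
      refine Fin.cases ?_ (fun j => ?_) i
      · simp [h]
      · simpa using hv j⟩
  have hw : LinearIndependent ℂ w := by
    refine LinearIndependent.of_comp (LinearMap.ker (dquadric p)).subtype ?_
    exact hli
  have := hw.fintype_card_le_finrank
  rw [finrank_ker_dquadric hp] at this
  simp at this

theorem contr_ne_zero {p u : Fin 4 → ℂ} (hu : dquadric p u ≠ 0) {v : Fin 3 → Fin 4 → ℂ}
    (hli : LinearIndependent ℂ v) (hv : ∀ i, dquadric p (v i) = 0) : contr u v ≠ 0 := by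
  have h1 : LinearIndependent ℂ (Matrix.vecCons u v) := by
    refine linearIndependent_finCons.2 ⟨hli, fun hmem => hu ?_⟩
    have : Submodule.span ℂ (range v) ≤ LinearMap.ker (dquadric p) := by
      rw [Submodule.span_le]
      rintro _ ⟨i, rfl⟩
      exact hv i
    exact this hmem
  have h2 : IsUnit (Matrix.of (Matrix.vecCons u v)) :=
    Matrix.linearIndependent_rows_iff_isUnit.1 h1
  rw [contr_apply]
  exact ((Matrix.isUnit_iff_isUnit_det _).1 h2).ne_zero

/-- The holomorphic volume form of the regular part of the cone: the residue of
`dw₀ ∧ dw₁ ∧ dw₂ ∧ dw₃ / (w₀ w₃ - w₁ w₂)`. -/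
noncomputable def omega : HolForm 3 domainG := fun p =>
  (contr (normal p)).compLinearMap (tangentSpace 3 domainG p).subtype

theorem omega_apply (p : regularPart 3 domainG) (v : Fin 3 → tangentSpace 3 domainG p) :
    omega p v = contr (normal p) fun i => v i := rfl

theorem regularPart_ne_zero (p : regularPart 3 domainG) : (p : Fin 4 → ℂ) ≠ 0 :=
  (mem_regularPart.1 p.2).2

/-- The coefficient of `omega`, computed with an arbitrary transversal vector. -/
theorem coeff_omega_eq (γ : LocalParam 3 domainG) {x : Fin 3 → ℂ} (hx : x ∈ γ.source)
    {u : Fin 4 → ℂ} (hu : dquadric (γ.toFun x) u = 1) :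
    γ.coeff omega x = contr u fun i => fderiv ℂ γ.toFun x (Pi.single i 1) := by
  rw [LocalParam.coeff, dif_pos hx, omega_apply]
  exact contr_eq_of_dquadric_eq (γ.ne_zero hx)
    ((dquadric_normal (γ.ne_zero hx)).trans hu.symm) fun i => γ.dquadric_fderiv hx _

theorem LocalParam.linearIndependent_fderiv (γ : LocalParam 3 domainG) {x : Fin 3 → ℂ}
    (hx : x ∈ γ.source) :
    LinearIndependent ℂ fun i : Fin 3 => fderiv ℂ γ.toFun x (Pi.single i 1) := by
  have := (Pi.basisFun ℂ (Fin 3)).linearIndependent.map'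
    (fderiv ℂ γ.toFun x).toLinearMap (LinearMap.ker_eq_bot.2 (γ.immersion x hx))
  simpa [Function.comp_def] using this

theorem coeff_omega_ne_zero (γ : LocalParam 3 domainG) {x : Fin 3 → ℂ} (hx : x ∈ γ.source) :
    γ.coeff omega x ≠ 0 := by
  have hd := dquadric_normal (γ.ne_zero hx)
  rw [coeff_omega_eq γ hx hd]
  exact contr_ne_zero (hd.trans_ne one_ne_zero) (γ.linearIndependent_fderiv hx)
    fun i => γ.dquadric_fderiv hx _

/-- The form `f • omega` on the regular part of the cone. -/
noncomputable def ofFun (f : (Fin 4 → ℂ) → ℂ) : HolForm 3 domainG := fun p => f p • omega p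

/-- Top-degree covectors on a three-dimensional tangent space form a line, and `omega` spans it at
every point. -/
theorem exists_eq_ofFun (φ : HolForm 3 domainG) : ∃ f, φ = ofFun f := by
  classical
  have key : ∀ p : regularPart 3 domainG, ∃ c : ℂ, φ p = c • omega p := by
    rintro ⟨p, γ, x, hx, rfl⟩
    have hx0 := coeff_omega_ne_zero γ hx
    rw [LocalParam.coeff, dif_pos hx] at hx0
    set p : regularPart 3 domainG := γ.pt ⟨x, hx⟩
    set v : Fin 3 → tangentSpace 3 domainG p := fun j => γ.push ⟨x, hx⟩ (Pi.single j 1)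
    have hli : LinearIndependent ℂ v := by
      refine LinearIndependent.of_comp (tangentSpace 3 domainG p).subtype ?_
      exact γ.linearIndependent_fderiv hx
    have hrank : Fintype.card (Fin 3) = Module.finrank ℂ (tangentSpace 3 domainG p) := by
      rw [tangentSpace_eq p.2, finrank_ker_dquadric (regularPart_ne_zero p)]
      simp
    set b := basisOfLinearIndependentOfCardEqFinrank hli hrank
    have hb : (b : Fin 3 → _) = v := coe_basisOfLinearIndependentOfCardEqFinrank hli hrank
    refine ⟨φ p v / omega p v, ?_⟩
    change φ p = _ • omega p
    have h1 := (φ p).eq_smul_basis_det b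
    have h2 := (omega p).eq_smul_basis_det b
    rw [hb] at h1 h2
    have h3 : φ p v = φ p v / omega p v * omega p v := (div_mul_cancel₀ _ hx0).symm
    calc φ p = φ p v • b.det := h1
      _ = (φ p v / omega p v) • (omega p v • b.det) := by rw [smul_smul, ← h3]
      _ = _ := congrArg _ h2.symm
  choose c hc using key
  refine ⟨fun p => if h : p ∈ regularPart 3 domainG then c ⟨p, h⟩ else 0, funext fun p => ?_⟩
  rw [ofFun, dif_pos p.2]
  exact hc p

theorem coeff_ofFun (γ : LocalParam 3 domainG) (f : (Fin 4 → ℂ) → ℂ) {x : Fin 3 → ℂ}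
    (hx : x ∈ γ.source) : γ.coeff (ofFun f) x = f (γ.toFun x) * γ.coeff omega x := by
  rw [LocalParam.coeff, LocalParam.coeff, dif_pos hx, dif_pos hx]
  rfl

theorem ofFun_eq_iff {f g : (Fin 4 → ℂ) → ℂ} :
    ofFun f = ofFun g ↔ ∀ p ∈ regularPart 3 domainG, f p = g p := by
  refine ⟨?_, fun h => funext fun p => by rw [ofFun, ofFun, h p p.2]⟩
  rintro h _ ⟨γ, x, hx, rfl⟩
  have := congrArg (fun φ => γ.coeff φ x) h
  simp only [coeff_ofFun γ _ hx] at this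
  exact mul_right_cancel₀ (coeff_omega_ne_zero γ hx) this

/-- The coefficient of `omega` in a parametrization is holomorphic. -/
theorem differentiableOn_coeff_omega (γ : LocalParam 3 domainG) :
    DifferentiableOn ℂ (γ.coeff omega) γ.source := by
  intro x hx
  obtain ⟨a, ha⟩ := exists_ne_zero (γ.ne_zero hx)
  have hcont : ContinuousAt (fun y => γ.toFun y a) x :=
    (continuous_apply a).continuousAt.comp (γ.hasFDerivAt hx).continuousAt
  have hcomp : ∀ i, DifferentiableOn ℂ (fun y => γ.toFun y i) γ.source :=
    fun i => differentiableOn_pi.1 γ.differentiableOn i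
  have hder : ∀ i u, DifferentiableOn ℂ (fun y => fderiv ℂ γ.toFun y u i) γ.source := by
    intro i u
    refine (differentiableOn_fderiv_apply γ.isOpen_source (hcomp i) u).congr fun y hy => ?_
    have := (hasFDerivAt_pi'.1 (γ.hasFDerivAt hy) i).fderiv
    rw [this]; rfl
  -- The vector `normal` is not holomorphic in the point. Where the a-th coordinate is nonzero, a
  -- multiple of the basis vector with index b = 3 − a is a holomorphic transversal vector that can
  -- replace it.
  obtain ⟨b, ε, hε, hb⟩ : ∃ b : Fin 4, ∃ ε : ℂ, ε ≠ 0 ∧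
      ∀ p : Fin 4 → ℂ, dquadric p (Pi.single b 1) = ε * p a := by
    fin_cases a
    · exact ⟨3, 1, by simp, fun p => by simp [dquadric_apply]⟩
    · exact ⟨2, -1, by simp, fun p => by simp [dquadric_apply]⟩
    · exact ⟨1, -1, by simp, fun p => by simp [dquadric_apply]⟩
    · exact ⟨0, 1, by simp, fun p => by simp [dquadric_apply]⟩
  have hev : γ.coeff omega =ᶠ[𝓝 x] fun y => contr ((ε * γ.toFun y a)⁻¹ • Pi.single b 1)
      fun i => fderiv ℂ γ.toFun y (Pi.single i 1) := by
    filter_upwards [hcont.eventually_ne ha, γ.isOpen_source.mem_nhds hx] with y hy hys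
    refine coeff_omega_eq γ hys ?_
    rw [map_smul, hb, smul_eq_mul, inv_mul_cancel₀ (mul_ne_zero hε hy)]
  refine (DifferentiableAt.congr_of_eventuallyEq ?_ hev).differentiableWithinAt
  have hd : ∀ i u, DifferentiableAt ℂ (fun y => fderiv ℂ γ.toFun y u i) x := fun i u =>
    (hder i u).differentiableAt (γ.isOpen_source.mem_nhds hx)
  have hinv : DifferentiableAt ℂ (fun y => (ε * γ.toFun y a)⁻¹) x :=
    (((hcomp a).differentiableAt (γ.isOpen_source.mem_nhds hx)).const_mul ε).fun_inv
      (mul_ne_zero hε ha)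
  have hentry : ∀ i j : Fin 4, DifferentiableAt ℂ (fun y =>
      (Matrix.vecCons ((ε * γ.toFun y a)⁻¹ • Pi.single b (1 : ℂ))
        fun i : Fin 3 => fderiv ℂ γ.toFun y (Pi.single i 1)) i j) x := by
    intro i j
    refine Fin.cases ?_ (fun k => ?_) i
    · simpa using hinv.mul_const _
    · simpa using hd j _
  simp only [contr_apply, Matrix.det_apply, Matrix.of_apply]
  refine DifferentiableAt.fun_sum fun σ _ => ?_
  refine DifferentiableAt.const_smul ?_ _
  simp only [Fin.prod_univ_four]
  exact (((hentry _ _).fun_mul (hentry _ _)).fun_mul (hentry _ _)).fun_mul (hentry _ _)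

/-! ### Coefficients in the charts -/

theorem chartMap_zero (p : Fin 3 → ℂ) : chartMap 0 p = baseMap p := by
  funext i
  have : (0 : Fin 4) ^^^ i = i := by revert i; decide
  simp [chartMap, this]

theorem fderiv_baseMap (p : Fin 3 → ℂ) :
    fderiv ℂ baseMap p (Pi.single 0 1) = ![1, p 1, p 2, p 1 * p 2] ∧
    fderiv ℂ baseMap p (Pi.single 1 1) = ![0, p 0, 0, p 0 * p 2] ∧
    fderiv ℂ baseMap p (Pi.single 2 1) = ![0, 0, p 0, p 0 * p 1] := by
  have key : ∀ (u : Fin 3 → ℂ) (w : Fin 4 → ℂ),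
      HasDerivAt (fun t : ℂ => baseMap (p + t • u)) w 0 → fderiv ℂ baseMap p u = w := by
    intro u w h
    have hline : HasDerivAt (fun t : ℂ => p + t • u) u 0 := by
      simpa using ((hasDerivAt_id (0 : ℂ)).smul_const u).const_add p
    have hfd : HasFDerivAt baseMap (fderiv ℂ baseMap p) (p + (0 : ℂ) • u) := by
      simpa using (differentiable_baseMap p).hasFDerivAt
    have h3 := hfd.comp_hasDerivAt (0 : ℂ) hline
    exact h3.unique h
  have hid : ∀ c : ℂ, HasDerivAt (fun t : ℂ => c + t) 1 0 := fun c => (hasDerivAt_id _).const_add c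
  refine ⟨key _ _ (hasDerivAt_pi.2 fun i => ?_), key _ _ (hasDerivAt_pi.2 fun i => ?_),
    key _ _ (hasDerivAt_pi.2 fun i => ?_)⟩
  · fin_cases i <;> simp [baseMap]
    · exact hid _
    · simpa using (hid (p 0)).mul_const (p 1)
    · simpa using (hid (p 0)).mul_const (p 2)
    · simpa using ((hid (p 0)).mul_const (p 1)).mul_const (p 2)
  · fin_cases i <;> simp [baseMap]
    · exact hasDerivAt_const _ _
    · simpa using (hid (p 1)).const_mul (p 0)
    · exact hasDerivAt_const _ _
    · simpa using ((hid (p 1)).const_mul (p 0)).mul_const (p 2)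
  · fin_cases i <;> simp [baseMap]
    · exact hasDerivAt_const _ _
    · exact hasDerivAt_const _ _
    · simpa using (hid (p 2)).const_mul (p 0)
    · simpa using (hid (p 2)).const_mul (p 0 * p 1)

/-- This coefficient is the source of the weight |x|² in all integrals over `baseDomain`, and of the
factor `p 0` in `repr`. -/
theorem coeff_chart_zero_omega {p : Fin 3 → ℂ} (hp : p ∈ baseDomain) :
    (chart 0).coeff omega p = -p 0 := by
  have hto : (chart 0).toFun = baseMap := funext chartMap_zero
  have hp0 : p 0 ≠ 0 := hp.1
  rw [coeff_omega_eq (chart 0) hp (u := (p 0)⁻¹ • Pi.single 3 1)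
    (by rw [hto]; simp [dquadric_apply, baseMap, hp0]), hto, contr_apply]
  obtain ⟨h0, h1, h2⟩ := fderiv_baseMap p
  have : (Matrix.of (Matrix.vecCons ((p 0)⁻¹ • Pi.single 3 (1 : ℂ))
      fun i : Fin 3 => fderiv ℂ baseMap p (Pi.single i 1)) : Matrix (Fin 4) (Fin 4) ℂ) =
      !![0, 0, 0, (p 0)⁻¹; 1, p 1, p 2, p 1 * p 2; 0, p 0, 0, p 0 * p 2;
        0, 0, p 0, p 0 * p 1] := by
    ext i j
    refine Fin.cases ?_ (fun k => ?_) i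
    · fin_cases j <;> simp
    · fin_cases k
      · simp [h0]
      · simp [h1]
      · simp [h2]
  rw [this]
  simp [Matrix.det_succ_row_zero, Fin.sum_univ_succ, Fin.succAbove]
  field_simp

theorem hermWedge_of_comp_eq_smul_det {E : Type*} [AddCommGroup E] [Module ℂ E]
    {φ ψ : E [⋀^Fin 3]→ₗ[ℂ] ℂ} {L : (Fin 3 → ℂ) →ₗ[ℂ] E} {a b : ℂ}
    (h1 : φ.compLinearMap L = a • Matrix.detRowAlternating)
    (h2 : ψ.compLinearMap L = b • Matrix.detRowAlternating) :
    hermWedge φ ψ (fun k => L (LocalParam.orientedBasis 3 k)) = a * (starRingEnd ℂ) b * 8 := by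
  rw [hermWedge_comp, h1, h2, hermWedge_smul_smul, hermWedge_det_orientedBasis]

theorem topCoeff_hermWedge (γ : LocalParam 3 domainG) (f g : (Fin 4 → ℂ) → ℂ) {x : Fin 3 → ℂ}
    (hx : x ∈ γ.source) :
    γ.topCoeff (fun p => hermWedge (ofFun f p) (ofFun g p)) x =
      8 * ‖γ.coeff omega x‖ ^ 2 * (f (γ.toFun x) * (starRingEnd ℂ) (g (γ.toFun x))) := by
  have h2 : ∀ f : (Fin 4 → ℂ) → ℂ, (ofFun f (γ.pt ⟨x, hx⟩)).compLinearMap (γ.pushMap ⟨x, hx⟩) =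
      (f (γ.toFun x) * γ.coeff omega x) • Matrix.detRowAlternating := fun f => by
    have h := ((ofFun f (γ.pt ⟨x, hx⟩)).compLinearMap (γ.pushMap ⟨x, hx⟩)).eq_smul_basis_det
      (Pi.basisFun ℂ (Fin 3))
    rw [Pi.basisFun_det] at h
    rw [h, ← coeff_ofFun γ f hx, LocalParam.coeff, dif_pos hx]
    congr 1
    simp only [AlternatingMap.compLinearMap_apply, Pi.basisFun_apply]
    rfl
  have h3 := hermWedge_of_comp_eq_smul_det (h2 f) (h2 g)
  simp only [LocalParam.pushMap_apply] at h3
  rw [γ.topCoeff_of_mem _ hx, h3, map_mul, ← Complex.mul_conj']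
  ring

/-- Holomorphy of a form, tested on the coefficient function in the four charts. -/
theorem isHolomorphic_ofFun_iff {f : (Fin 4 → ℂ) → ℂ} :
    IsHolomorphic (ofFun f) ↔ ∀ a, DifferentiableOn ℂ (fun p => f (chartMap a p)) baseDomain := by
  constructor
  · intro h a
    have h1 := h (chart a)
    have h2 := differentiableOn_coeff_omega (chart a)
    refine (h1.fun_mul (h2.fun_inv fun x hx => coeff_omega_ne_zero (chart a) hx)).congr
      fun x hx => ?_
    rw [coeff_ofFun _ _ hx, mul_inv_cancel_right₀ (coeff_omega_ne_zero (chart a) hx)]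
    rfl
  · intro h γ
    have key : DifferentiableOn ℂ (fun x => f (γ.toFun x)) γ.source := by
      intro x hx
      obtain ⟨a, ha⟩ := exists_ne_zero (γ.ne_zero hx)
      have hcont := (γ.hasFDerivAt hx).continuousAt
      have hev : (fun y => f (γ.toFun y)) =ᶠ[𝓝 x]
          fun y => f (chartMap a (chartInv a (γ.toFun y))) := by
        filter_upwards [hcont.eventually ((isOpen_ne_zero a).mem_nhds ha),
          γ.isOpen_source.mem_nhds hx] with y hy hys
        rw [chartMap_chartInv (γ.mapsTo hys) hy]
      refine (DifferentiableAt.congr_of_eventuallyEq ?_ hev).differentiableWithinAt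
      have h1 : DifferentiableAt ℂ (fun p => f (chartMap a p)) (chartInv a (γ.toFun x)) :=
        (h a).differentiableAt (isOpen_baseDomain.mem_nhds (chartInv_mem (γ.mapsTo hx) ha))
      have h2 : DifferentiableAt ℂ (chartInv a) (γ.toFun x) :=
        (differentiableOn_chartInv a).differentiableAt ((isOpen_ne_zero a).mem_nhds ha)
      exact DifferentiableAt.comp (g := fun p => f (chartMap a p)) x h1
        (h2.comp x (γ.hasFDerivAt hx).differentiableAt)
    refine (key.fun_mul (differentiableOn_coeff_omega γ)).congr fun x hx => ?_
    rw [coeff_ofFun _ _ hx]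

/-! ### Integration -/

section Transition

variable (γ : LocalParam 3 domainG) (a : Fin 4)

/-- The part of the parameter domain that is mapped to `w a ≠ 0`. -/
def LocalParam.part : Set (Fin 3 → ℂ) := γ.source ∩ γ.toFun ⁻¹' {w | w a ≠ 0}

/-- The transition to the chart with index `a`. -/
noncomputable def LocalParam.trans (x : Fin 3 → ℂ) : Fin 3 → ℂ := chartInv a (γ.toFun x)

theorem LocalParam.isOpen_part : IsOpen (γ.part a) :=
  γ.differentiableOn.continuousOn.isOpen_inter_preimage γ.isOpen_source (isOpen_ne_zero a)

variable {a}

theorem LocalParam.trans_mem {x : Fin 3 → ℂ} (hx : x ∈ γ.part a) : γ.trans a x ∈ baseDomain :=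
  chartInv_mem (γ.mapsTo hx.1) hx.2

theorem LocalParam.chartMap_trans {x : Fin 3 → ℂ} (hx : x ∈ γ.part a) :
    chartMap a (γ.trans a x) = γ.toFun x :=
  chartMap_chartInv (γ.mapsTo hx.1) hx.2

theorem LocalParam.hasFDerivAt_trans {x : Fin 3 → ℂ} (hx : x ∈ γ.part a) :
    HasFDerivAt (γ.trans a) (fderiv ℂ (γ.trans a) x) x := by
  have h2 : DifferentiableAt ℂ (chartInv a) (γ.toFun x) :=
    (differentiableOn_chartInv a).differentiableAt ((isOpen_ne_zero a).mem_nhds hx.2)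
  exact (h2.comp x (γ.hasFDerivAt hx.1).differentiableAt).hasFDerivAt

theorem LocalParam.injOn_trans : InjOn (γ.trans a) (γ.part a) := fun x hx y hy h => by
  refine γ.injOn hx.1 hy.1 ?_
  rw [← γ.chartMap_trans hx, h, γ.chartMap_trans hy]

theorem LocalParam.eventuallyEq_trans {x : Fin 3 → ℂ} (hx : x ∈ γ.part a) :
    γ.toFun =ᶠ[𝓝 x] (chart a).toFun ∘ γ.trans a := by
  filter_upwards [(γ.isOpen_part a).mem_nhds hx] with y hy using (γ.chartMap_trans hy).symm

/-- The injective differential of γ factors through that of the transition, which is therefore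
injective. -/
theorem LocalParam.det_trans_ne_zero {x : Fin 3 → ℂ} (hx : x ∈ γ.part a) :
    ((fderiv ℂ (γ.trans a) x).restrictScalars ℝ).det ≠ 0 := by
  have h1 : fderiv ℂ γ.toFun x =
      (fderiv ℂ (chartMap a) (γ.trans a x)).comp (fderiv ℂ (γ.trans a) x) := by
    rw [(γ.eventuallyEq_trans hx).fderiv_eq]
    exact (((differentiable_chartMap a _).hasFDerivAt).comp x (γ.hasFDerivAt_trans hx)).fderiv
  have hinj : Function.Injective (fderiv ℂ (γ.trans a) x) := by
    have := γ.immersion x hx.1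
    rw [h1, ContinuousLinearMap.coe_comp] at this
    exact this.of_comp
  have h2 : LinearMap.det (fderiv ℂ (γ.trans a) x).toLinearMap ≠ 0 := by
    intro h0
    exact (LinearMap.bot_lt_ker_of_det_eq_zero h0).ne' (LinearMap.ker_eq_bot.2 hinj)
  have h3 : ((fderiv ℂ (γ.trans a) x).restrictScalars ℝ).det =
      ‖LinearMap.det (fderiv ℂ (γ.trans a) x).toLinearMap‖ ^ 2 :=
    det_restrictScalars_eq _
  rw [h3]
  positivity

theorem LocalParam.hasFDerivWithinAt_trans {x : Fin 3 → ℂ} (hx : x ∈ γ.part a)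
    (s : Set (Fin 3 → ℂ)) :
    HasFDerivWithinAt (γ.trans a) ((fderiv ℂ (γ.trans a) x).restrictScalars ℝ) s x :=
  ((γ.hasFDerivAt_trans hx).restrictScalars ℝ).hasFDerivWithinAt

/-- The measure of the image is the integral of the Jacobian over s; a positive function with
integral zero lives on a null set. -/
theorem LocalParam.volume_eq_zero_of_image {s : Set (Fin 3 → ℂ)} (hs : MeasurableSet s)
    (hsub : s ⊆ γ.part a) (h0 : volume (γ.trans a '' s) = 0) : volume s = 0 := by
  have hder : ∀ x ∈ s, HasFDerivWithinAt (γ.trans a)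
      ((fderiv ℂ (γ.trans a) x).restrictScalars ℝ) s x :=
    fun x hx => γ.hasFDerivWithinAt_trans (hsub hx) s
  have h1 := lintegral_abs_det_fderiv_eq_addHaar_image volume hs hder (γ.injOn_trans.mono hsub)
  rw [h0, lintegral_eq_zero_iff' (aemeasurable_ofReal_abs_det_fderivWithin volume hs hder)] at h1
  have h2 : ∀ᵐ x ∂volume.restrict s, False := by
    filter_upwards [h1, ae_restrict_mem hs] with x hx hxs
    have := γ.det_trans_ne_zero (hsub hxs)
    simp [this] at hx
  rw [ae_iff] at h2
  simpa using h2

/-- The divisor `w 0 = 0` is a null set in every parametrization. -/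
theorem LocalParam.volume_diff_part : volume (γ.source \ γ.part 0) = 0 := by
  have hcover : γ.source \ γ.part 0 ⊆ ⋃ a, (γ.part a \ γ.part 0) := by
    intro x hx
    obtain ⟨a, ha⟩ := exists_ne_zero (γ.ne_zero hx.1)
    exact mem_iUnion.2 ⟨a, ⟨hx.1, ha⟩, hx.2⟩
  refine measure_mono_null hcover (measure_iUnion_null fun a => ?_)
  refine γ.volume_eq_zero_of_image (a := a)
    ((γ.isOpen_part a).measurableSet.diff (γ.isOpen_part 0).measurableSet) sdiff_subset ?_
  -- In the chart with index a, the coordinate w 0 is x, xy, xz or xyz with x ≠ 0, so it vanishes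
  -- only on two hyperplanes.
  have hsub : γ.trans a '' (γ.part a \ γ.part 0) ⊆ {q | q 1 = 0} ∪ {q | q 2 = 0} := by
    rintro _ ⟨x, hx, rfl⟩
    have h0 : γ.toFun x 0 = 0 := by
      by_contra h
      exact hx.2 ⟨hx.1.1, h⟩
    rw [← γ.chartMap_trans hx.1, chartMap, twist_zero_apply] at h0
    have hq := (γ.trans_mem hx.1).1
    generalize γ.trans a x = q at *
    fin_cases a <;> simp [baseMap, hq] at h0 ⊢ <;> tauto
  refine measure_mono_null hsub (measure_union_null ?_ ?_)
  · exact Measure.pi_hyperplane _ 1 0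
  · exact Measure.pi_hyperplane _ 2 0

end Transition

/-! ### Transport of single pieces to the base chart -/

section Pieces

variable (γ : LocalParam 3 domainG) (ω : RealForm 3 (3 + 3) domainG) {s : Set (Fin 3 → ℂ)}

theorem LocalParam.ae_eq_inter_part (hsub : s ⊆ γ.source) :
    (s ∩ γ.part 0 : Set (Fin 3 → ℂ)) =ᵐ[volume] s := by
  refine inter_subset_left.eventuallyLE.antisymm (ae_le_set.2 ?_)
  · refine measure_mono_null (fun x hx => ?_) γ.volume_diff_part
    exact ⟨hsub hx.1, fun h => hx.2 ⟨hx.1, h⟩⟩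

/-- The image of a measurable piece in the base chart. -/
def LocalParam.baseImage (s : Set (Fin 3 → ℂ)) : Set (Fin 3 → ℂ) := γ.trans 0 '' (s ∩ γ.part 0)

theorem LocalParam.measurableSet_baseImage (hs : MeasurableSet s) :
    MeasurableSet (γ.baseImage s) :=
  measurable_image_of_fderivWithin (hs.inter (γ.isOpen_part 0).measurableSet)
    (fun _ hx => γ.hasFDerivWithinAt_trans hx.2 _) (γ.injOn_trans.mono inter_subset_right)

theorem LocalParam.topCoeff_eq_trans {x : Fin 3 → ℂ} (hx : x ∈ γ.part 0) :
    γ.topCoeff ω x = |((fderiv ℂ (γ.trans 0) x).restrictScalars ℝ).det| •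
      (chart 0).topCoeff ω (γ.trans 0 x) :=
  γ.topCoeff_eq_of_comp (chart 0) ω hx.1 (γ.trans_mem hx) (γ.hasFDerivAt_trans hx)
    (γ.eventuallyEq_trans hx)

theorem LocalParam.integrableOn_topCoeff_iff (hs : MeasurableSet s) (hsub : s ⊆ γ.source) :
    IntegrableOn (γ.topCoeff ω) s ↔ IntegrableOn ((chart 0).topCoeff ω) (γ.baseImage s) := by
  have hm := hs.inter (γ.isOpen_part 0).measurableSet
  rw [baseImage, integrableOn_image_iff_integrableOn_abs_det_fderiv_smul volume hm
    (fun _ hx => γ.hasFDerivWithinAt_trans hx.2 _) (γ.injOn_trans.mono inter_subset_right),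
    ← integrableOn_congr_set_ae (γ.ae_eq_inter_part hsub)]
  exact integrableOn_congr_fun (fun x hx => γ.topCoeff_eq_trans ω hx.2) hm

theorem LocalParam.setIntegral_topCoeff (hs : MeasurableSet s) (hsub : s ⊆ γ.source) :
    ∫ x in s, γ.topCoeff ω x = ∫ q in γ.baseImage s, (chart 0).topCoeff ω q := by
  have hm := hs.inter (γ.isOpen_part 0).measurableSet
  rw [baseImage, integral_image_eq_integral_abs_det_fderiv_smul volume hm
    (fun _ hx => γ.hasFDerivWithinAt_trans hx.2 _) (γ.injOn_trans.mono inter_subset_right),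
    ← setIntegral_congr_set (γ.ae_eq_inter_part hsub)]
  exact setIntegral_congr_fun hm (fun x hx => γ.topCoeff_eq_trans ω hx.2)

theorem LocalParam.setIntegral_norm_topCoeff (hs : MeasurableSet s) (hsub : s ⊆ γ.source) :
    ∫ x in s, ‖γ.topCoeff ω x‖ = ∫ q in γ.baseImage s, ‖(chart 0).topCoeff ω q‖ := by
  have hm := hs.inter (γ.isOpen_part 0).measurableSet
  rw [baseImage, integral_image_eq_integral_abs_det_fderiv_smul volume hm
    (fun _ hx => γ.hasFDerivWithinAt_trans hx.2 _) (γ.injOn_trans.mono inter_subset_right),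
    ← setIntegral_congr_set (γ.ae_eq_inter_part hsub)]
  refine setIntegral_congr_fun hm (fun x hx => ?_)
  simp only [γ.topCoeff_eq_trans ω hx.2, norm_smul, Real.norm_eq_abs, abs_abs, smul_eq_mul]

end Pieces

/-! ### Independence of the integral from the dissection -/

namespace Dissection

variable (D : Dissection 3 domainG) (ω : RealForm 3 (3 + 3) domainG)

/-- The pieces of the dissection in the base chart. -/
def basePiece (j : ℕ) : Set (Fin 3 → ℂ) := (D.chart j).baseImage (D.piece j)

theorem measurableSet_basePiece (j : ℕ) : MeasurableSet (D.basePiece j) :=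
  (D.chart j).measurableSet_baseImage (D.measurableSet_piece j)

theorem chartMap_mem_of_mem_basePiece {j : ℕ} {q : Fin 3 → ℂ} (hq : q ∈ D.basePiece j) :
    chartMap 0 q ∈ (D.chart j).toFun '' D.piece j := by
  obtain ⟨x, hx, rfl⟩ := hq
  exact ⟨x, hx.1, ((D.chart j).chartMap_trans hx.2).symm⟩

theorem iUnion_basePiece : ⋃ j, D.basePiece j = baseDomain := by
  refine Subset.antisymm (iUnion_subset fun j => ?_) fun q hq => ?_
  · rintro _ ⟨x, hx, rfl⟩
    exact (D.chart j).trans_mem hx.2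
  · have h1 : chartMap 0 q ∈ regularPart 3 domainG := ⟨Bergman.chart 0, q, hq, rfl⟩
    rw [← D.cover] at h1
    obtain ⟨j, x, hx, hxq⟩ := mem_iUnion.1 h1
    refine mem_iUnion.2 ⟨j, x, ⟨hx, D.piece_subset j hx, ?_⟩, ?_⟩
    · rw [mem_preimage, hxq, mem_ofPred_eq, chartMap_apply_self]
      exact hq.1
    · rw [LocalParam.trans, hxq, chartInv_chartMap 0 hq.1]

theorem pairwise_disjoint_basePiece : Pairwise fun i j => Disjoint (D.basePiece i) (D.basePiece j) :=
  fun _ _ hij => Set.disjoint_left.2 fun _ hi hj =>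
    Set.disjoint_left.1 (D.disjoint hij) (D.chartMap_mem_of_mem_basePiece hi)
      (D.chartMap_mem_of_mem_basePiece hj)

/-- The transported pieces partition `baseDomain`, so countable additivity turns the condition on
the pieces into one that no longer mentions D. -/
theorem integrable_iff :
    D.Integrable ω ↔ IntegrableOn ((Bergman.chart 0).topCoeff ω) baseDomain := by
  have h1 : ∀ j, IntegrableOn ((D.chart j).topCoeff ω) (D.piece j) ↔
      IntegrableOn ((Bergman.chart 0).topCoeff ω) (D.basePiece j) := fun j =>
    (D.chart j).integrableOn_topCoeff_iff ω (D.measurableSet_piece j) (D.piece_subset j)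
  have h2 : ∀ j, ∫ x in D.piece j, ‖(D.chart j).topCoeff ω x‖ =
      ∫ q in D.basePiece j, ‖(Bergman.chart 0).topCoeff ω q‖ := fun j =>
    (D.chart j).setIntegral_norm_topCoeff ω (D.measurableSet_piece j) (D.piece_subset j)
  rw [Dissection.Integrable]
  simp only [h1, h2]
  rw [← D.iUnion_basePiece]
  constructor
  · rintro ⟨h3, h4⟩
    exact integrableOn_iUnion_of_summable_integral_norm h3 h4
  · intro h3
    exact ⟨fun j => h3.mono_set (subset_iUnion _ j), (hasSum_integral_iUnion
      D.measurableSet_basePiece D.pairwise_disjoint_basePiece h3.norm).summable⟩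

theorem integral_eq (h : IntegrableOn ((Bergman.chart 0).topCoeff ω) baseDomain) :
    D.integral ω = ∫ q in baseDomain, (Bergman.chart 0).topCoeff ω q := by
  have h2 : ∀ j, ∫ x in D.piece j, (D.chart j).topCoeff ω x =
      ∫ q in D.basePiece j, (Bergman.chart 0).topCoeff ω q := fun j =>
    (D.chart j).setIntegral_topCoeff ω (D.measurableSet_piece j) (D.piece_subset j)
  rw [Dissection.integral]
  simp only [h2]
  rw [← D.iUnion_basePiece] at h ⊢
  exact (hasSum_integral_iUnion D.measurableSet_basePiece D.pairwise_disjoint_basePiece h).tsum_eq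

/-- The dissection by the first coordinate that does not vanish. -/
noncomputable def standard : Dissection 3 domainG where
  -- The index is reduced modulo 4, which is harmless because the pieces with j ≥ 4 are empty.
  chart j := Bergman.chart (Fin.ofNat 4 j)
  piece j := if j < 4 then
    {q ∈ baseDomain | ∀ b : Fin 4, (b : ℕ) < j → chartMap (Fin.ofNat 4 j) q b = 0} else ∅
  measurableSet_piece j := by
    split_ifs
    · have h : {q ∈ baseDomain | ∀ b : Fin 4, (b : ℕ) < j → chartMap (Fin.ofNat 4 j) q b = 0} =
          baseDomain ∩ ⋂ b : Fin 4, ⋂ _ : (b : ℕ) < j, {q | chartMap (Fin.ofNat 4 j) q b = 0} := by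
        ext q; simp
      rw [h]
      refine isOpen_baseDomain.measurableSet.inter ?_
      refine MeasurableSet.iInter fun b => MeasurableSet.iInter fun _ => IsClosed.measurableSet ?_
      exact isClosed_eq ((continuous_apply b).comp (differentiable_chartMap _).continuous)
        continuous_const
    · exact MeasurableSet.empty
  piece_subset j := by
    split_ifs
    · exact fun q hq => hq.1
    · exact empty_subset _
  disjoint := by
    have key (i j : ℕ) (hij : i < j) (w : Fin 4 → ℂ) :
        w ∈ (Bergman.chart (Fin.ofNat 4 i)).toFun '' (if i < 4 then
          {q ∈ baseDomain | ∀ b : Fin 4, (b : ℕ) < i → chartMap (Fin.ofNat 4 i) q b = 0} else ∅) →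
        w ∈ (Bergman.chart (Fin.ofNat 4 j)).toFun '' (if j < 4 then
          {q ∈ baseDomain | ∀ b : Fin 4, (b : ℕ) < j → chartMap (Fin.ofNat 4 j) q b = 0} else ∅) →
        False := by
      intro hi hj
      by_cases hj4 : j < 4
      · rw [if_pos (hij.trans hj4)] at hi
        rw [if_pos hj4] at hj
        obtain ⟨q, hq, rfl⟩ := hi
        obtain ⟨r, hr, hrq⟩ := hj
        have h1 := hr.2 (Fin.ofNat 4 i) (by
          rw [Fin.val_ofNat, Nat.mod_eq_of_lt (hij.trans hj4)]; exact hij)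
        have h2 : chartMap (Fin.ofNat 4 i) q (Fin.ofNat 4 i) = 0 :=
          (congrFun hrq (Fin.ofNat 4 i)).symm.trans h1
        rw [chartMap_apply_self] at h2
        exact hq.1.1 h2
      · rw [if_neg hj4] at hj
        simp at hj
    intro i j hij
    refine Set.disjoint_left.2 fun w hi hj => ?_
    rcases lt_or_gt_of_ne hij with h | h
    · exact key i j h w hi hj
    · exact key j i h w hj hi
  cover := by
    classical
    refine Subset.antisymm (iUnion_subset fun j => ?_) fun w hw => ?_
    · rintro _ ⟨q, hq, rfl⟩
      split_ifs at hq
      · exact ⟨Bergman.chart (Fin.ofNat 4 j), q, hq.1, rfl⟩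
      · exact hq.elim
    · obtain ⟨hG, h0⟩ := mem_regularPart.1 hw
      have hex : ∃ j : ℕ, ∃ h : j < 4, w ⟨j, h⟩ ≠ 0 := by
        obtain ⟨a, ha⟩ := exists_ne_zero h0
        exact ⟨a, a.2, ha⟩
      obtain ⟨hj4, hj⟩ := Nat.find_spec hex
      have hof : Fin.ofNat 4 (Nat.find hex) = ⟨Nat.find hex, hj4⟩ :=
        Fin.ext (by rw [Fin.val_ofNat, Nat.mod_eq_of_lt hj4])
      refine mem_iUnion.2 ⟨Nat.find hex, chartInv ⟨Nat.find hex, hj4⟩ w, ?_, ?_⟩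
      · rw [if_pos hj4, hof]
        refine ⟨chartInv_mem hG hj, fun b hb => ?_⟩
        rw [chartMap_chartInv hG hj]
        by_contra hb0
        exact Nat.find_min hex hb ⟨b.2, hb0⟩
      · rw [hof]
        exact chartMap_chartInv hG hj

end Dissection

theorem formIntegrable_iff (ω : RealForm 3 (3 + 3) domainG) :
    FormIntegrable ω ↔ IntegrableOn ((chart 0).topCoeff ω) baseDomain :=
  ⟨fun ⟨D, hD⟩ => (D.integrable_iff ω).1 hD, fun h => ⟨Dissection.standard,
    (Dissection.standard.integrable_iff ω).2 h⟩⟩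

theorem formIntegral_eq (ω : RealForm 3 (3 + 3) domainG) :
    formIntegral ω = ∫ q in baseDomain, (chart 0).topCoeff ω q := by
  rw [formIntegral]
  split_ifs with h
  · exact h.choose.integral_eq ω ((h.choose.integrable_iff ω).1 h.choose_spec)
  -- Without integrability both sides take the default value zero.
  · refine (integral_undef fun hi => h ((formIntegrable_iff ω).2 hi)).symm

/-- The coefficient of `ofFun f` in the base chart, normalized so that the inner product of the
Bergman space becomes that of `L²(baseDomain)`. -/
noncomputable def repr (f : (Fin 4 → ℂ) → ℂ) (p : Fin 3 → ℂ) : ℂ :=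
  (Real.sqrt 8 : ℂ) * p 0 * f (baseMap p)

theorem topCoeff_chart_zero (f g : (Fin 4 → ℂ) → ℂ) {p : Fin 3 → ℂ} (hp : p ∈ baseDomain) :
    (chart 0).topCoeff (fun p => hermWedge (ofFun f p) (ofFun g p)) p =
      repr f p * (starRingEnd ℂ) (repr g p) := by
  have h8 : (Real.sqrt 8 : ℂ) * (Real.sqrt 8 : ℂ) = 8 := by
    rw [← Complex.ofReal_mul, Real.mul_self_sqrt (by norm_num)]; norm_num
  rw [topCoeff_hermWedge (chart 0) f g hp, coeff_chart_zero_omega hp, repr, repr, norm_neg,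
    ← Complex.mul_conj']
  have : (chart 0).toFun p = baseMap p := chartMap_zero p
  rw [this]
  simp only [map_mul, Complex.conj_ofReal]
  linear_combination -(p 0 * (starRingEnd ℂ) (p 0) * f (baseMap p) *
    (starRingEnd ℂ) (g (baseMap p))) * h8

theorem innerForm_ofFun (f g : (Fin 4 → ℂ) → ℂ) :
    innerForm (ofFun f) (ofFun g) =
      ∫ p in baseDomain, repr f p * (starRingEnd ℂ) (repr g p) := by
  rw [innerForm, formIntegral_eq]
  exact setIntegral_congr_fun isOpen_baseDomain.measurableSet
    fun p hp => topCoeff_chart_zero f g hp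

theorem mem_bergmanSpace_ofFun {f : (Fin 4 → ℂ) → ℂ} :
    ofFun f ∈ bergmanSpace 3 domainG ↔
      (∀ a, DifferentiableOn ℂ (fun p => f (chartMap a p)) baseDomain) ∧
        IntegrableOn (fun p => ‖repr f p‖ ^ 2) baseDomain := by
  refine (and_congr isHolomorphic_ofFun_iff (formIntegrable_iff _)).trans
    (and_congr_right fun _ => ?_)
  rw [integrableOn_congr_fun (fun p hp => topCoeff_chart_zero f f hp)
    isOpen_baseDomain.measurableSet]
  simp only [Complex.mul_conj']
  norm_cast
  exact ⟨fun h => by simpa [IntegrableOn, ← Complex.ofReal_pow] using h.re, fun h => h.ofReal⟩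

/-! ### Norms of the monomials -/

section Norms

/-- The boundary term of the integration by parts that raises both exponents in `integral_pow_div`.
-/
theorem hasDerivAt_pow_div (m k : ℕ) (r : ℝ) :
    HasDerivAt (fun r : ℝ => r ^ (m + 1) / (1 + r ^ 2) ^ (k + 1))
      ((m + 1) * (r ^ m / (1 + r ^ 2) ^ (k + 1)) -
        2 * (k + 1) * (r ^ (m + 2) / (1 + r ^ 2) ^ (k + 2))) r := by
  have h1 : HasDerivAt (fun r : ℝ => 1 + r ^ 2) (2 * r) r := by
    simpa using (hasDerivAt_pow 2 r).const_add 1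
  have h0 : (1 + r ^ 2 : ℝ) ≠ 0 := by positivity
  have h2 := (hasDerivAt_pow (m + 1) r).fun_div (h1.fun_pow (k + 1)) (pow_ne_zero _ h0)
  refine h2.congr_deriv ?_
  simp only [Nat.add_sub_cancel]
  push_cast
  field_simp
  ring

/-- The radial integral behind the norms of the monomials. -/
theorem integral_pow_div (a : ℕ) : ∀ k, a ≤ k →
    IntegrableOn (fun r : ℝ => r ^ (2 * a + 1) / (1 + r ^ 2) ^ (k + 2)) (Ioi 0) ∧
      ∫ r in Ioi (0 : ℝ), r ^ (2 * a + 1) / (1 + r ^ 2) ^ (k + 2) =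
        (1 : ℝ) / (2 * (k + 1) * k.choose a) := by
  have hlim : ∀ k : ℕ, Tendsto (fun r : ℝ => 1 / (1 + r ^ 2) ^ (k + 1)) atTop (𝓝 0) := by
    intro k
    refine Tendsto.div_atTop tendsto_const_nhds ?_
    refine (tendsto_pow_atTop (Nat.succ_ne_zero k)).comp ?_
    exact tendsto_atTop_add_const_left _ _ (tendsto_pow_atTop two_ne_zero)
  induction a with
  | zero =>
    intro k _
    have hderiv : ∀ r ∈ Ici (0 : ℝ), HasDerivAt
        (fun r : ℝ => -(1 / (2 * (k + 1)) * (1 / (1 + r ^ 2) ^ (k + 1))))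
        (r ^ (2 * 0 + 1) / (1 + r ^ 2) ^ (k + 2)) r := by
      intro r _
      have h1 : HasDerivAt (fun r : ℝ => 1 + r ^ 2) (2 * r) r := by
        simpa using (hasDerivAt_pow 2 r).const_add 1
      have h0 : (1 + r ^ 2 : ℝ) ≠ 0 := by positivity
      have h2 := ((((hasDerivAt_const r (1 : ℝ)).fun_div (h1.fun_pow (k + 1))
        (pow_ne_zero _ h0)).const_mul (1 / (2 * ((k : ℝ) + 1))))).fun_neg
      refine h2.congr_deriv ?_
      simp only [Nat.add_sub_cancel]
      push_cast
      field_simp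
      ring
    have hl : Tendsto (fun r : ℝ => -(1 / (2 * ((k : ℝ) + 1)) * (1 / (1 + r ^ 2) ^ (k + 1))))
        atTop (𝓝 0) := by
      simpa using ((hlim k).const_mul (1 / (2 * ((k : ℝ) + 1)))).neg
    have hpos : ∀ r ∈ Ioi (0 : ℝ), 0 ≤ r ^ (2 * 0 + 1) / (1 + r ^ 2) ^ (k + 2) := by
      intro r hr
      have : (0 : ℝ) < r := hr
      positivity
    refine ⟨integrableOn_Ioi_deriv_of_nonneg' hderiv hpos hl, ?_⟩
    rw [integral_Ioi_of_hasDerivAt_of_nonneg' hderiv hpos hl]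
    simp
  | succ a ih =>
    intro k hk
    -- From here on k + 1 stands for the former k, so that the induction hypothesis is used for the
    -- pair (a, k).
    obtain ⟨k, rfl⟩ := Nat.exists_eq_add_of_le' (Nat.one_le_of_lt hk)
    have hak : a ≤ k := by omega
    obtain ⟨hint, hval⟩ := ih k hak
    have hint' : IntegrableOn (fun r : ℝ => r ^ (2 * a + 1 + 2) / (1 + r ^ 2) ^ (k + 1 + 2))
        (Ioi 0) := by
      refine Integrable.mono' hint ?_ ?_
      · have h0 : ∀ r : ℝ, (1 + r ^ 2) ^ (k + 1 + 2) ≠ 0 := fun r => by positivity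
        exact (Continuous.div (by fun_prop) (by fun_prop) h0).aestronglyMeasurable
      · filter_upwards [ae_restrict_mem measurableSet_Ioi] with r hr
        have hr0 : (0 : ℝ) < r := hr
        rw [Real.norm_of_nonneg (by positivity), div_le_div_iff₀ (by positivity) (by positivity)]
        have : r ^ (2 * a + 1) * (1 + r ^ 2) ^ (k + 1 + 2) -
            r ^ (2 * a + 1 + 2) * (1 + r ^ 2) ^ (k + 2) =
            r ^ (2 * a + 1) * (1 + r ^ 2) ^ (k + 2) := by ring
        have h2 : 0 ≤ r ^ (2 * a + 1) * (1 + r ^ 2) ^ (k + 2) := by positivity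
        linarith
    have hderiv : ∀ r ∈ Ici (0 : ℝ), HasDerivAt
        (fun r : ℝ => r ^ (2 * a + 1 + 1) / (1 + r ^ 2) ^ (k + 1 + 1)) _ r :=
      fun r _ => hasDerivAt_pow_div (2 * a + 1) (k + 1) r
    have hl : Tendsto (fun r : ℝ => r ^ (2 * a + 1 + 1) / (1 + r ^ 2) ^ (k + 1 + 1))
        atTop (𝓝 0) := by
      refine squeeze_zero (fun r => ?_) (fun r => ?_) (hlim 0)
      · have : r ^ (2 * a + 1 + 1) = (r ^ (a + 1)) ^ 2 := by ring
        rw [this]; positivity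
      · rw [div_le_div_iff₀ (by positivity) (by positivity), one_mul]
        have h1 : r ^ (2 * a + 1 + 1) = (r ^ 2) ^ (a + 1) := by ring
        calc r ^ (2 * a + 1 + 1) * (1 + r ^ 2) ^ (0 + 1)
            ≤ (1 + r ^ 2) ^ (a + 1) * (1 + r ^ 2) ^ (0 + 1) := by
              rw [h1]; gcongr; linarith [sq_nonneg r]
          _ = (1 + r ^ 2) ^ (a + 1 + 1) := by ring
          _ ≤ (1 + r ^ 2) ^ (k + 1 + 1) :=
              pow_le_pow_right₀ (by linarith [sq_nonneg r]) (by omega)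
    have hI1 := hint.const_mul (((2 * a + 1 : ℕ) : ℝ) + 1)
    have hI2 := hint'.const_mul (2 * (((k + 1 : ℕ) : ℝ) + 1))
    have hFTC := integral_Ioi_of_hasDerivAt_of_tendsto' hderiv (hI1.sub hI2) hl
    have hsub := integral_sub hI1 hI2
    rw [integral_const_mul, integral_const_mul, hval] at hsub
    have hch : ((k + 1 : ℕ) : ℝ) * k.choose a = (k + 1).choose (a + 1) * ((a + 1 : ℕ) : ℝ) := by
      exact_mod_cast Nat.add_one_mul_choose_eq k a
    have hc0 : ((k.choose a : ℕ) : ℝ) ≠ 0 := by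
      exact_mod_cast (Nat.choose_pos hak).ne'
    have hc1 : (((k + 1).choose (a + 1) : ℕ) : ℝ) ≠ 0 := by
      exact_mod_cast (Nat.choose_pos hk).ne'
    refine ⟨hint', ?_⟩
    have heq := hsub.symm.trans hFTC
    have e1 : 2 * (a + 1) + 1 = 2 * a + 1 + 2 := by ring
    rw [e1]
    set B := ∫ r in Ioi (0 : ℝ), r ^ (2 * a + 1 + 2) / (1 + r ^ 2) ^ (k + 1 + 2)
    have h0 : (0 : ℝ) ^ (2 * a + 1 + 1) / (1 + 0 ^ 2) ^ (k + 1 + 1) = 0 := by simp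
    rw [h0, sub_zero] at heq
    push_cast at heq hch ⊢
    rw [eq_div_iff (by positivity)]
    -- The recursion from (a, k) to (a+1, k+1); the boundary terms vanish at 0 and at infinity. It
    -- is then matched with (k+1) C(k,a) = (a+1) C(k+1,a+1).
    have hB : B * (2 * (k + 1 + 1)) = (2 * a + 1 + 1) * (1 / (2 * (k + 1) * k.choose a)) := by
      linarith
    rw [← mul_assoc, hB]
    field_simp
    linear_combination -2 * hch

theorem integral_radial (f : ℝ → ℝ) :
    ∫ z : ℂ, f ‖z‖ = 2 * Real.pi * ∫ r in Ioi (0 : ℝ), r * f r := by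
  rw [integral_fun_norm_addHaar volume f]
  simp [Complex.finrank_real_complex, Measure.real, mul_assoc]

theorem integrable_radial {f : ℝ → ℝ} (hf : IntegrableOn (fun r => r * f r) (Ioi 0)) :
    Integrable fun z : ℂ => f ‖z‖ := by
  rw [integrable_fun_norm_addHaar volume]
  simpa [Complex.finrank_real_complex] using hf

theorem integral_complex_pow_div {a k : ℕ} (h : a ≤ k) :
    Integrable (fun y : ℂ => ‖y‖ ^ (2 * a) / (1 + ‖y‖ ^ 2) ^ (k + 2)) ∧
      ∫ y : ℂ, ‖y‖ ^ (2 * a) / (1 + ‖y‖ ^ 2) ^ (k + 2) = Real.pi / ((k + 1) * k.choose a) := by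
  obtain ⟨h1, h2⟩ := integral_pow_div a k h
  have h3 : ∀ r : ℝ, r * (r ^ (2 * a) / (1 + r ^ 2) ^ (k + 2)) =
      r ^ (2 * a + 1) / (1 + r ^ 2) ^ (k + 2) := fun r => by ring
  constructor
  · exact integrable_radial (f := fun r => r ^ (2 * a) / (1 + r ^ 2) ^ (k + 2)) (by simpa only [h3])
  · rw [integral_radial fun r => r ^ (2 * a) / (1 + r ^ 2) ^ (k + 2)]
    simp only [h3]
    rw [h2]
    have hc0 : ((k.choose a : ℕ) : ℝ) ≠ 0 := by exact_mod_cast (Nat.choose_pos h).ne'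
    field_simp

/-- The x-integral over a slice of `baseDomain` with y, z fixed, where ρ = (1+|y|²)(1+|z|²) and the
slice is a punctured disc of radius ρ^(−1/2). -/
theorem integral_complex_pow_disc (k : ℕ) {ρ : ℝ} (hρ : 0 < ρ) :
    Integrable (fun x : ℂ => if ‖x‖ ^ 2 * ρ < 1 then ‖x‖ ^ (2 * k + 2) else 0) ∧
      ∫ x : ℂ, (if ‖x‖ ^ 2 * ρ < 1 then ‖x‖ ^ (2 * k + 2) else 0) =
        Real.pi / ((k + 2) * ρ ^ (k + 2)) := by
  set R := (Real.sqrt ρ)⁻¹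
  have hR : 0 < R := by positivity
  have hR2 : R ^ 2 = ρ⁻¹ := by rw [inv_pow, Real.sq_sqrt hρ.le]
  have h3 : ∀ r ∈ Ioi (0 : ℝ), r * (if r ^ 2 * ρ < 1 then r ^ (2 * k + 2) else 0) =
      (Ioo 0 R).indicator (fun r => r ^ (2 * k + 3)) r := by
    intro r hr
    have hr0 : (0 : ℝ) < r := hr
    have hiff : r ^ 2 * ρ < 1 ↔ r < R := by
      rw [← lt_div_iff₀ hρ, one_div, ← hR2]
      exact pow_lt_pow_iff_left₀ hr0.le hR.le two_ne_zero
    by_cases h : r < R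
    · rw [indicator_of_mem (show r ∈ Ioo 0 R from ⟨hr0, h⟩), if_pos (hiff.2 h)]; ring
    · rw [indicator_of_notMem (fun h' => h h'.2), if_neg (fun h' => h (hiff.1 h')), mul_zero]
  have hint : IntegrableOn (fun r : ℝ => r ^ (2 * k + 3)) (Ioo 0 R) :=
    ((continuous_pow _).integrableOn_Icc (a := 0) (b := R)).mono_set Ioo_subset_Icc_self
  constructor
  · refine integrable_radial (f := fun r => if r ^ 2 * ρ < 1 then r ^ (2 * k + 2) else 0) ?_
    refine IntegrableOn.congr_fun ?_ (fun r hr => (h3 r hr).symm) measurableSet_Ioi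
    exact ((integrable_indicator_iff measurableSet_Ioo).2 hint).integrableOn
  · rw [integral_radial fun r => if r ^ 2 * ρ < 1 then r ^ (2 * k + 2) else 0,
      setIntegral_congr_fun measurableSet_Ioi h3, setIntegral_indicator measurableSet_Ioo,
      inter_eq_right.2 Ioo_subset_Ioi_self, ← integral_Ioc_eq_integral_Ioo,
      ← intervalIntegral.integral_of_le hR.le, integral_pow]
    have : R ^ (2 * k + 3 + 1) = (ρ ^ (k + 2))⁻¹ := by
      rw [show 2 * k + 3 + 1 = 2 * (k + 2) by ring, pow_mul, hR2, inv_pow]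
    rw [this]
    push_cast
    field_simp
    ring

/-- Tonelli's theorem in three complex variables. -/
theorem lintegral_fin_three {g : ℂ → ℂ → ℂ → ENNReal}
    (hg : Measurable fun q : ℂ × ℂ × ℂ => g q.2.2 q.1 q.2.1) :
    ∫⁻ p : Fin 3 → ℂ, g (p 0) (p 1) (p 2) = ∫⁻ y : ℂ, ∫⁻ z : ℂ, ∫⁻ x : ℂ, g x y z := by
  -- Splitting off coordinate 1 and swapping the remaining pair gives the order y, z, x, so that x,
  -- whose range depends on y and z, is integrated first.
  have e1 := (volume_preserving_piFinSuccAbove (fun _ : Fin 3 => ℂ) 1)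
  have e2 := (MeasurePreserving.id (volume : Measure ℂ)).prod
    ((Measure.measurePreserving_swap (μ := (volume : Measure ℂ)) (ν := (volume : Measure ℂ))).comp
      (volume_preserving_finTwoArrow ℂ))
  have e3 := e2.comp e1
  have e4 := e3.lintegral_comp hg
  refine Eq.trans ?_ (e4.trans ?_)
  · rfl
  · rw [lintegral_prod _ hg.aemeasurable]
    refine lintegral_congr fun y => ?_
    exact lintegral_prod _ (hg.comp measurable_prodMk_left).aemeasurable

/-- The squared norm of a monomial form, up to the constant `8`. -/
theorem lintegral_monomial {k a b : ℕ} (ha : a ≤ k) (hb : b ≤ k) :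
    ∫⁻ p in baseDomain,
        ENNReal.ofReal (‖p 0‖ ^ (2 * k + 2) * ‖p 1‖ ^ (2 * a) * ‖p 2‖ ^ (2 * b)) =
      ENNReal.ofReal (Real.pi ^ 3 / ((k + 2) * (k + 1) ^ 2 * k.choose a * k.choose b)) := by
  set g : ℂ → ℂ → ℂ → ENNReal := fun x y z => ENNReal.ofReal
    ((if ‖x‖ ^ 2 * ((1 + ‖y‖ ^ 2) * (1 + ‖z‖ ^ 2)) < 1 then ‖x‖ ^ (2 * k + 2) else 0) *
      (‖y‖ ^ (2 * a) * ‖z‖ ^ (2 * b))) with hg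
  have hmeas : Measurable fun q : ℂ × ℂ × ℂ => g q.2.2 q.1 q.2.1 := by
    refine ENNReal.measurable_ofReal.comp (Measurable.mul (Measurable.ite ?_ ?_ ?_) ?_)
    · exact measurableSet_lt (by fun_prop) (by fun_prop)
    all_goals fun_prop
  have h1 : ∫⁻ p in baseDomain,
      ENNReal.ofReal (‖p 0‖ ^ (2 * k + 2) * ‖p 1‖ ^ (2 * a) * ‖p 2‖ ^ (2 * b)) =
      ∫⁻ p : Fin 3 → ℂ, g (p 0) (p 1) (p 2) := by
    rw [← lintegral_indicator isOpen_baseDomain.measurableSet]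
    refine lintegral_congr fun p => ?_
    by_cases hp : p ∈ baseDomain
    · have h2 : ‖p 0‖ ^ 2 * ((1 + ‖p 1‖ ^ 2) * (1 + ‖p 2‖ ^ 2)) < 1 := by
        rw [← mul_assoc]; exact hp.2
      rw [indicator_of_mem hp, hg]
      simp only [if_pos h2, mul_assoc]
    · rw [indicator_of_notMem hp, hg]
      -- The set x = 0 is excluded from `baseDomain` but not from the inequality defining g; there
      -- the positive power of |x| makes g vanish.
      by_cases h0 : p 0 = 0
      · simp [h0]
      · have h2 : ¬ ‖p 0‖ ^ 2 * ((1 + ‖p 1‖ ^ 2) * (1 + ‖p 2‖ ^ 2)) < 1 := fun h =>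
          hp ⟨h0, by rw [mul_assoc]; exact h⟩
        simp only [if_neg h2]
        simp
  have hx : ∀ y z : ℂ, ∫⁻ x, g x y z =
      ENNReal.ofReal (Real.pi / (k + 2) * (‖y‖ ^ (2 * a) / (1 + ‖y‖ ^ 2) ^ (k + 2))) *
        ENNReal.ofReal (‖z‖ ^ (2 * b) / (1 + ‖z‖ ^ 2) ^ (k + 2)) := by
    intro y z
    obtain ⟨i1, i2⟩ := integral_complex_pow_disc k
      (show 0 < (1 + ‖y‖ ^ 2) * (1 + ‖z‖ ^ 2) by positivity)
    rw [hg, ← ofReal_integral_eq_lintegral_ofReal (i1.mul_const _), integral_mul_const, i2,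
      ← ENNReal.ofReal_mul (by positivity)]
    · congr 1
      rw [mul_pow]
      field_simp
    · refine Eventually.of_forall fun x => ?_
      dsimp only [Pi.zero_apply]
      split_ifs <;> positivity
  obtain ⟨y1, y2⟩ := integral_complex_pow_div ha
  obtain ⟨z1, z2⟩ := integral_complex_pow_div hb
  rw [h1, lintegral_fin_three hmeas]
  simp only [hx]
  have hz : ∫⁻ z : ℂ, ENNReal.ofReal (‖z‖ ^ (2 * b) / (1 + ‖z‖ ^ 2) ^ (k + 2)) =
      ENNReal.ofReal (Real.pi / ((k + 1) * k.choose b)) := by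
    rw [← z2, ofReal_integral_eq_lintegral_ofReal z1 (Eventually.of_forall fun z => by
      dsimp only [Pi.zero_apply]; positivity)]
  have hy : ∫⁻ y : ℂ, ENNReal.ofReal
      (Real.pi / (k + 2) * (‖y‖ ^ (2 * a) / (1 + ‖y‖ ^ 2) ^ (k + 2))) =
      ENNReal.ofReal (Real.pi / (k + 2) * (Real.pi / ((k + 1) * k.choose a))) := by
    rw [← y2, ← integral_const_mul, ofReal_integral_eq_lintegral_ofReal (y1.const_mul _)
      (Eventually.of_forall fun z => by dsimp only [Pi.zero_apply]; positivity)]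
  have hm : ∀ c : ℕ, Measurable fun z : ℂ =>
      ENNReal.ofReal (‖z‖ ^ (2 * c) / (1 + ‖z‖ ^ 2) ^ (k + 2)) := fun c => by fun_prop
  have hm' : Measurable fun y : ℂ =>
      ENNReal.ofReal (Real.pi / (k + 2) * (‖y‖ ^ (2 * a) / (1 + ‖y‖ ^ 2) ^ (k + 2))) := by fun_prop
  simp only [lintegral_const_mul _ (hm b), hz]
  rw [lintegral_mul_const _ hm', hy, ← ENNReal.ofReal_mul (by positivity)]
  congr 1
  field_simp

end Norms

/-- Polynomials on `ℂ⁴` that restrict to `x ^ k y ^ a z ^ b` in the base chart. -/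
def mono (k a b : ℕ) (w : Fin 4 → ℂ) : ℂ :=
  w 3 ^ min a b * w 1 ^ (a - min a b) * w 2 ^ (b - min a b) * w 0 ^ (k - max a b)

theorem differentiable_mono (k a b : ℕ) : Differentiable ℂ (mono k a b) := by
  unfold mono; fun_prop

theorem mono_baseMap {k a b : ℕ} (ha : a ≤ k) (hb : b ≤ k) (p : Fin 3 → ℂ) :
    mono k a b (baseMap p) = p 0 ^ k * p 1 ^ a * p 2 ^ b := by
  rcases le_total a b with h | h
  · obtain ⟨c, rfl⟩ := Nat.exists_eq_add_of_le h
    obtain ⟨d, rfl⟩ := Nat.exists_eq_add_of_le hb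
    simp [mono, baseMap]
    ring
  · obtain ⟨c, rfl⟩ := Nat.exists_eq_add_of_le h
    obtain ⟨d, rfl⟩ := Nat.exists_eq_add_of_le ha
    simp [mono, baseMap]
    ring

/-! ### The orthonormal system of monomials -/

/-- The index set of the monomials `x ^ k y ^ a z ^ b` with `a, b ≤ k`. -/
abbrev Idx : Type := Σ k : ℕ, Fin (k + 1) × Fin (k + 1)

/-- The squared normalizing constant. -/
noncomputable def normConstSq (i : Idx) : ℝ :=
  (i.1 + 2) * (i.1 + 1) ^ 2 * i.1.choose i.2.1 * i.1.choose i.2.2 / (8 * Real.pi ^ 3)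

/-- The coefficient functions of the orthonormal basis. -/
noncomputable def basisFun (i : Idx) (w : Fin 4 → ℂ) : ℂ :=
  (Real.sqrt (normConstSq i) : ℂ) * mono i.1 i.2.1 i.2.2 w

theorem Idx.le_left (i : Idx) : (i.2.1 : ℕ) ≤ i.1 := Nat.lt_succ_iff.1 i.2.1.2

theorem Idx.le_right (i : Idx) : (i.2.2 : ℕ) ≤ i.1 := Nat.lt_succ_iff.1 i.2.2.2

theorem normConstSq_pos (i : Idx) : 0 < normConstSq i := by
  have h1 : (0 : ℝ) < i.1.choose i.2.1 := by exact_mod_cast Nat.choose_pos i.le_left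
  have h2 : (0 : ℝ) < i.1.choose i.2.2 := by exact_mod_cast Nat.choose_pos i.le_right
  have := Real.pi_pos
  unfold normConstSq
  positivity

theorem norm_basisFun_sq (i : Idx) (w : Fin 4 → ℂ) :
    ‖basisFun i w‖ ^ 2 = normConstSq i * ‖mono i.1 i.2.1 i.2.2 w‖ ^ 2 := by
  rw [basisFun, norm_mul, mul_pow, Complex.norm_real, Real.norm_eq_abs, sq_abs,
    Real.sq_sqrt (normConstSq_pos i).le]

theorem norm_repr_sq (f : (Fin 4 → ℂ) → ℂ) (p : Fin 3 → ℂ) :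
    ‖repr f p‖ ^ 2 = 8 * (‖p 0‖ ^ 2 * ‖f (baseMap p)‖ ^ 2) := by
  rw [repr, norm_mul, norm_mul, mul_pow, mul_pow, Complex.norm_real, Real.norm_eq_abs, sq_abs,
    Real.sq_sqrt (by norm_num)]
  ring

theorem norm_repr_basisFun_sq (i : Idx) (p : Fin 3 → ℂ) :
    ‖repr (basisFun i) p‖ ^ 2 = 8 * normConstSq i *
      (‖p 0‖ ^ (2 * i.1 + 2) * ‖p 1‖ ^ (2 * (i.2.1 : ℕ)) * ‖p 2‖ ^ (2 * (i.2.2 : ℕ))) := by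
  rw [norm_repr_sq, norm_basisFun_sq, mono_baseMap i.le_left i.le_right]
  simp only [norm_mul, norm_pow]
  ring

theorem integrable_repr_basisFun (i : Idx) :
    IntegrableOn (fun p => ‖repr (basisFun i) p‖ ^ 2) baseDomain ∧
      ∫ p in baseDomain, ‖repr (basisFun i) p‖ ^ 2 = 1 := by
  have h := lintegral_monomial i.le_left i.le_right
  set m : (Fin 3 → ℂ) → ℝ := fun p =>
    ‖p 0‖ ^ (2 * i.1 + 2) * ‖p 1‖ ^ (2 * (i.2.1 : ℕ)) * ‖p 2‖ ^ (2 * (i.2.2 : ℕ)) with hm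
  have hcont : Continuous m := by rw [hm]; fun_prop
  have hpos : ∀ p, 0 ≤ m p := fun p => by rw [hm]; positivity
  have hint : IntegrableOn m baseDomain := by
    refine ⟨hcont.aestronglyMeasurable, ?_⟩
    rw [hasFiniteIntegral_iff_ofReal (Eventually.of_forall hpos), h]
    exact ENNReal.ofReal_lt_top
  have hval : ∫ p in baseDomain, m p =
      Real.pi ^ 3 / ((i.1 + 2) * (i.1 + 1) ^ 2 * i.1.choose i.2.1 * i.1.choose i.2.2) := by
    rw [integral_eq_lintegral_of_nonneg_ae (Eventually.of_forall hpos)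
      hcont.aestronglyMeasurable, h, ENNReal.toReal_ofReal (by positivity)]
  simp only [norm_repr_basisFun_sq]
  refine ⟨hint.const_mul _, ?_⟩
  rw [integral_const_mul]
  change _ * ∫ p in baseDomain, m p = _
  rw [hval, normConstSq]
  have h1 : (0 : ℝ) < i.1.choose i.2.1 := by exact_mod_cast Nat.choose_pos i.le_left
  have h2 : (0 : ℝ) < i.1.choose i.2.2 := by exact_mod_cast Nat.choose_pos i.le_right
  have := Real.pi_pos
  field_simp

/-- Every point of the cone is of the form `(α γ, α δ, β γ, β δ)`. -/
theorem exists_segre {w : Fin 4 → ℂ} (hw : w 0 * w 3 = w 1 * w 2) :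
    ∃ α β γ δ : ℂ, w 0 = α * γ ∧ w 1 = α * δ ∧ w 2 = β * γ ∧ w 3 = β * δ := by
  by_cases h0 : w 0 = 0
  · by_cases h1 : w 1 = 0
    · exact ⟨0, 1, w 2, w 3, by simp [h0], by simp [h1], by simp, by simp⟩
    · have h2 : w 2 = 0 := by
        rw [h0, zero_mul] at hw
        exact (mul_eq_zero.1 hw.symm).resolve_left h1
      exact ⟨1, w 3 / w 1, w 0, w 1, by simp, by simp, by simp [h0, h2], by field_simp⟩
  · refine ⟨1, w 2 / w 0, w 0, w 1, by simp, by simp, by field_simp, ?_⟩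
    field_simp
    linear_combination hw

/-- The monomial separates into a binomial term of degree k in (γ, δ) and one in (α, β). This lets
the sum over a and b factor. -/
theorem mono_segre {k a b : ℕ} (ha : a ≤ k) (hb : b ≤ k) {w : Fin 4 → ℂ} {α β γ δ : ℂ}
    (h0 : w 0 = α * γ) (h1 : w 1 = α * δ) (h2 : w 2 = β * γ) (h3 : w 3 = β * δ) :
    mono k a b w = δ ^ a * γ ^ (k - a) * (β ^ b * α ^ (k - b)) := by
  rw [mono, h0, h1, h2, h3]
  rcases le_total a b with h | h
  · obtain ⟨c, rfl⟩ := Nat.exists_eq_add_of_le h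
    obtain ⟨d, rfl⟩ := Nat.exists_eq_add_of_le hb
    have e1 : a + c + d - a = c + d := by omega
    simp [e1]
    ring
  · obtain ⟨c, rfl⟩ := Nat.exists_eq_add_of_le h
    obtain ⟨d, rfl⟩ := Nat.exists_eq_add_of_le ha
    have e1 : b + c + d - b = c + d := by omega
    simp [e1]
    ring

theorem sum_choose_norm (k : ℕ) (γ δ : ℂ) :
    ∑ a : Fin (k + 1), (k.choose a : ℝ) * ‖δ ^ (a : ℕ) * γ ^ (k - a)‖ ^ 2 =
      (‖δ‖ ^ 2 + ‖γ‖ ^ 2) ^ k := by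
  rw [add_pow, Finset.sum_range]
  refine Finset.sum_congr rfl fun a _ => ?_
  rw [norm_mul, norm_pow, norm_pow, mul_pow, ← pow_mul, ← pow_mul, ← pow_mul, ← pow_mul,
    mul_comm (a : ℕ) 2, mul_comm (k - a) 2]
  ring

/-- The sum over the monomials of degree `k`. -/
theorem sum_norm_basisFun (k : ℕ) {w : Fin 4 → ℂ} (hw : w 0 * w 3 = w 1 * w 2) :
    ∑ c : Fin (k + 1) × Fin (k + 1), ‖basisFun ⟨k, c⟩ w‖ ^ 2 =
      (k + 2) * (k + 1) ^ 2 / (8 * Real.pi ^ 3) * normSq4 w ^ k := by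
  obtain ⟨α, β, γ, δ, h0, h1, h2, h3⟩ := exists_segre hw
  have hn : normSq4 w = (‖δ‖ ^ 2 + ‖γ‖ ^ 2) * (‖β‖ ^ 2 + ‖α‖ ^ 2) := by
    rw [normSq4, Fin.sum_univ_four, h0, h1, h2, h3]
    simp only [norm_mul]
    ring
  rw [hn, mul_pow, ← sum_choose_norm, ← sum_choose_norm, Finset.sum_mul_sum, Finset.mul_sum,
    Fintype.sum_prod_type]
  refine Finset.sum_congr rfl fun a _ => ?_
  rw [Finset.mul_sum]
  refine Finset.sum_congr rfl fun b _ => ?_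
  rw [norm_basisFun_sq, mono_segre (Nat.lt_succ_iff.1 a.2) (Nat.lt_succ_iff.1 b.2) h0 h1 h2 h3,
    norm_mul _ (β ^ (b : ℕ) * α ^ (k - b)), normConstSq]
  ring

/-- A single term is at most the whole sum of its degree. The resulting majorant is uniform on |w| ≤
s and summable over all indices by `summable_idx`. -/
theorem norm_basisFun_le {w : Fin 4 → ℂ} (hw : w 0 * w 3 = w 1 * w 2) {s : ℝ} (hs : 0 ≤ s)
    (hws : normSq4 w ≤ s ^ 2) (i : Idx) : ‖basisFun i w‖ ≤ (i.1 + 2) ^ 2 * s ^ i.1 := by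
  obtain ⟨k, c⟩ := i
  have h1 : ‖basisFun ⟨k, c⟩ w‖ ^ 2 ≤
      ∑ c : Fin (k + 1) × Fin (k + 1), ‖basisFun ⟨k, c⟩ w‖ ^ 2 :=
    Finset.single_le_sum (f := fun c => ‖basisFun ⟨k, c⟩ w‖ ^ 2) (fun _ _ => by positivity)
      (Finset.mem_univ c)
  rw [sum_norm_basisFun k hw] at h1
  have hn0 : 0 ≤ normSq4 w := Finset.sum_nonneg fun _ _ => by positivity
  refine abs_le_of_sq_le_sq' ?_ (by positivity) |>.2
  refine h1.trans ?_
  have hpi : (1 : ℝ) ≤ 8 * Real.pi ^ 3 := by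
    have := Real.pi_gt_three
    have h2 : (1 : ℝ) ≤ Real.pi ^ 3 := one_le_pow₀ (by linarith)
    linarith
  have h3 : ((k : ℝ) + 2) * (k + 1) ^ 2 / (8 * Real.pi ^ 3) ≤ (k + 2) ^ 4 := by
    refine (div_le_self (by positivity) hpi).trans ?_
    have hk : (0 : ℝ) ≤ k := Nat.cast_nonneg k
    calc ((k : ℝ) + 2) * ((k : ℝ) + 1) ^ 2 ≤ ((k : ℝ) + 2) * ((k : ℝ) + 2) ^ 2 := by gcongr; norm_num
      _ = ((k : ℝ) + 2) ^ 3 := by ring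
      _ ≤ ((k : ℝ) + 2) ^ 4 := pow_le_pow_right₀ (by linarith) (by norm_num)
  calc _ ≤ ((k : ℝ) + 2) ^ 4 * (s ^ 2) ^ k := by gcongr
    _ = _ := by ring

theorem summable_idx {s : ℝ} (hs0 : 0 ≤ s) (hs : s < 1) :
    Summable fun i : Idx => ((i.1 : ℝ) + 2) ^ 2 * s ^ i.1 := by
  rw [summable_sigma_of_nonneg fun i => by positivity]
  refine ⟨fun k => Summable.of_finite, ?_⟩
  simp only [tsum_fintype, Finset.sum_const, Finset.card_univ, Fintype.card_prod, Fintype.card_fin,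
    nsmul_eq_mul]
  have h1 : ‖s‖ < 1 := by rwa [Real.norm_of_nonneg hs0]
  have h2 : ∀ j : ℕ, Summable fun k : ℕ => (k : ℝ) ^ j * s ^ k := fun j =>
    summable_pow_mul_geometric_of_norm_lt_one j h1
  -- Degree k contains (k+1)² indices, and (k+1)²(k+2)² = k⁴ + 6k³ + 13k² + 12k + 4.
  refine (((((h2 4).add ((h2 3).mul_left 6)).add ((h2 2).mul_left 13)).add
    ((h2 1).mul_left 12)).add ((h2 0).mul_left 4)).congr fun k => ?_
  push_cast
  ring

/-- The kernel on the diagonal as a function of `|w|²`. -/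
noncomputable def kernelFun (t : ℝ) : ℝ :=
  ∑' k : ℕ, ((k : ℝ) + 2) * (k + 1) ^ 2 / (8 * Real.pi ^ 3) * t ^ k

theorem hasSum_norm_basisFun {w : Fin 4 → ℂ} (hw : w ∈ domainG) :
    HasSum (fun i => ‖basisFun i w‖ ^ 2) (kernelFun (normSq4 w)) := by
  have hn0 : 0 ≤ normSq4 w := Finset.sum_nonneg fun _ _ => by positivity
  have hn1 : normSq4 w < 1 := hw.1
  have h1 : ‖normSq4 w‖ < 1 := by rwa [Real.norm_of_nonneg hn0]
  have h2 : ∀ j : ℕ, Summable fun k : ℕ => (k : ℝ) ^ j * normSq4 w ^ k := fun j =>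
    summable_pow_mul_geometric_of_norm_lt_one j h1
  have h3 : Summable fun k : ℕ =>
      ((k : ℝ) + 2) * (k + 1) ^ 2 / (8 * Real.pi ^ 3) * normSq4 w ^ k := by
    -- Expansion of (k+2)(k+1)² as k³ + 4k² + 5k + 2.
    refine (((((h2 3).add ((h2 2).mul_left 4)).add ((h2 1).mul_left 5)).add
      ((h2 0).mul_left 2)).mul_left (8 * Real.pi ^ 3)⁻¹).congr fun k => ?_
    ring
  have hfib : ∀ k : ℕ, HasSum (fun c => ‖basisFun ⟨k, c⟩ w‖ ^ 2)
      (((k : ℝ) + 2) * (k + 1) ^ 2 / (8 * Real.pi ^ 3) * normSq4 w ^ k) := fun k => by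
    rw [← sum_norm_basisFun k hw.2]
    exact hasSum_fintype _
  have hs : Summable fun i : Idx => ‖basisFun i w‖ ^ 2 := by
    rw [summable_sigma_of_nonneg fun i => by positivity]
    refine ⟨fun k => (hfib k).summable, ?_⟩
    simpa only [(hfib _).tsum_eq] using h3
  exact HasSum.of_sigma hfib h3.hasSum hs.hasSum.cauchySeq

/-! ### The action of the torus -/

/-- The normalized Haar measure of the torus. -/
noncomputable abbrev torusMeasure : Measure (UnitAddTorus (Fin 3)) :=
  Measure.pi fun _ => AddCircle.haarAddCircle

theorem mFourierCoeff_eq (f : UnitAddTorus (Fin 3) → ℂ) (m : Fin 3 → ℤ) :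
    UnitAddTorus.mFourierCoeff f m = ∫ t, UnitAddTorus.mFourier (-m) t * f t ∂torusMeasure := rfl

/-- The `j`-th coordinate of the torus as a complex number of modulus one. -/
noncomputable def phase (θ : UnitAddTorus (Fin 3)) (j : Fin 3) : ℂ := fourier 1 (θ j)

@[simp] theorem norm_phase (θ : UnitAddTorus (Fin 3)) (j : Fin 3) : ‖phase θ j‖ = 1 := by
  rw [phase, fourier_apply]; exact Circle.norm_coe _

theorem phase_ne_zero (θ : UnitAddTorus (Fin 3)) (j : Fin 3) : phase θ j ≠ 0 := by
  rw [← norm_ne_zero_iff]; simp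

theorem phase_add (θ φ : UnitAddTorus (Fin 3)) (j : Fin 3) :
    phase (θ + φ) j = phase θ j * phase φ j := by
  simp [phase, AddCircle.toCircle_add]

@[simp] theorem phase_zero (j : Fin 3) : phase 0 j = 1 := by simp [phase]

theorem continuous_phase (j : Fin 3) : Continuous fun θ => phase θ j := by
  unfold phase; fun_prop

theorem fourier_eq_zpow (n : ℤ) (x : UnitAddCircle) :
    (fourier n x : ℂ) = (fourier 1 x : ℂ) ^ n := by
  rw [fourier_apply, fourier_apply, one_zsmul, AddCircle.toCircle_zsmul, Circle.coe_zpow]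

theorem mFourier_eq (m : Fin 3 → ℤ) (θ : UnitAddTorus (Fin 3)) :
    UnitAddTorus.mFourier m θ = phase θ 0 ^ m 0 * phase θ 1 ^ m 1 * phase θ 2 ^ m 2 := by
  simp only [UnitAddTorus.mFourier, ContinuousMap.coe_mk, Fin.prod_univ_three, phase]
  rw [fourier_eq_zpow (m 0), fourier_eq_zpow (m 1), fourier_eq_zpow (m 2)]

theorem mFourier_add_apply (m : Fin 3 → ℤ) (θ φ : UnitAddTorus (Fin 3)) :
    UnitAddTorus.mFourier m (θ + φ) = UnitAddTorus.mFourier m θ * UnitAddTorus.mFourier m φ := by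
  simp only [mFourier_eq, phase_add, mul_zpow]; ring

/-- The action of the torus on the coordinates `(x, y, z)`. -/
noncomputable def rot (θ : UnitAddTorus (Fin 3)) (p : Fin 3 → ℂ) : Fin 3 → ℂ :=
  fun j => phase θ j * p j

/-- The action of the torus on `ℂ⁴` that corresponds to `rot`. -/
noncomputable def act (θ : UnitAddTorus (Fin 3)) (w : Fin 4 → ℂ) : Fin 4 → ℂ :=
  ![phase θ 0 * w 0, phase θ 0 * phase θ 1 * w 1, phase θ 0 * phase θ 2 * w 2,
    phase θ 0 * phase θ 1 * phase θ 2 * w 3]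

theorem baseMap_rot (θ : UnitAddTorus (Fin 3)) (p : Fin 3 → ℂ) :
    baseMap (rot θ p) = act θ (baseMap p) := by
  ext i; fin_cases i <;> simp [baseMap, rot, act] <;> ring

theorem act_add (θ φ : UnitAddTorus (Fin 3)) (w : Fin 4 → ℂ) :
    act (θ + φ) w = act θ (act φ w) := by
  ext i; fin_cases i <;> simp [act, phase_add] <;> ring

@[simp] theorem act_zero (w : Fin 4 → ℂ) : act 0 w = w := by
  ext i; fin_cases i <;> simp [act]

@[simp] theorem norm_rot (θ : UnitAddTorus (Fin 3)) (p : Fin 3 → ℂ) (j : Fin 3) :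
    ‖rot θ p j‖ = ‖p j‖ := by simp [rot]

@[simp] theorem norm_act (θ : UnitAddTorus (Fin 3)) (w : Fin 4 → ℂ) (i : Fin 4) :
    ‖act θ w i‖ = ‖w i‖ := by fin_cases i <;> simp [act]

theorem act_apply_ne_zero {θ : UnitAddTorus (Fin 3)} {w : Fin 4 → ℂ} {i : Fin 4} :
    act θ w i ≠ 0 ↔ w i ≠ 0 := by
  rw [← norm_ne_zero_iff, norm_act, norm_ne_zero_iff]

theorem rot_mem {θ : UnitAddTorus (Fin 3)} {p : Fin 3 → ℂ} :
    rot θ p ∈ baseDomain ↔ p ∈ baseDomain := by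
  have h : ∀ p : Fin 3 → ℂ, p ∈ baseDomain ↔
      ‖p 0‖ ≠ 0 ∧ ‖p 0‖ ^ 2 * (1 + ‖p 1‖ ^ 2) * (1 + ‖p 2‖ ^ 2) < 1 := fun p => by
    rw [norm_ne_zero_iff]; rfl
  rw [h, h]; simp only [norm_rot]

theorem act_mem {θ : UnitAddTorus (Fin 3)} {w : Fin 4 → ℂ} (hw : w ∈ domainG) :
    act θ w ∈ domainG := by
  refine ⟨by simpa only [norm_act] using hw.1, ?_⟩
  simp only [act, Matrix.cons_val_zero, Matrix.cons_val_one, Matrix.cons_val]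
  linear_combination (phase θ 0 ^ 2 * phase θ 1 * phase θ 2) * hw.2

theorem continuous_act : Continuous fun q : UnitAddTorus (Fin 3) × (Fin 4 → ℂ) => act q.1 q.2 := by
  have h : ∀ j, Continuous fun q : UnitAddTorus (Fin 3) × (Fin 4 → ℂ) => phase q.1 j := fun j =>
    (continuous_phase j).comp continuous_fst
  refine continuous_pi fun i => ?_
  have h0 := h 0
  have h1 := h 1
  have h2 := h 2
  fin_cases i <;> simp only [act] <;> simp <;> fun_prop

theorem continuous_rot : Continuous fun q : UnitAddTorus (Fin 3) × (Fin 3 → ℂ) => rot q.1 q.2 :=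
  continuous_pi fun j => ((continuous_phase j).comp continuous_fst).mul
    ((continuous_apply j).comp continuous_snd)

theorem differentiable_act (θ : UnitAddTorus (Fin 3)) : Differentiable ℂ (act θ) := by
  refine differentiable_pi.2 fun i => ?_
  fin_cases i <;> simp [act] <;> fun_prop

theorem measurePreserving_rot (θ : UnitAddTorus (Fin 3)) :
    MeasurePreserving (rot θ) (volume.restrict baseDomain) (volume.restrict baseDomain) := by
  have h : MeasurePreserving (rot θ) volume volume := by
    refine volume_preserving_pi (α' := fun _ : Fin 3 => ℂ) (β' := fun _ : Fin 3 => ℂ)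
      (f := fun j z => phase θ j * z) fun j => ?_
    let c : Circle := (θ j).toCircle
    have h1 : (fun z : ℂ => phase θ j * z) = rotation c := by
      funext z
      rw [rotation_apply, phase, fourier_one]
    rw [h1]
    exact (rotation c).measurePreserving
  have h2 := h.restrict_preimage isOpen_baseDomain.measurableSet
  have h3 : rot θ ⁻¹' baseDomain = baseDomain := by ext p; exact rot_mem
  rwa [h3] at h2

/-! ### Fourier coefficients -/

/-- Functions on the cone with holomorphic expressions in all charts. -/
def ConeHol (f : (Fin 4 → ℂ) → ℂ) : Prop :=
  ∀ a, DifferentiableOn ℂ (fun p => f (chartMap a p)) baseDomain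

theorem ConeHol.continuousOn {f : (Fin 4 → ℂ) → ℂ} (hf : ConeHol f) :
    ContinuousOn f (domainG \ {0}) := by
  rintro w ⟨hw, h0⟩
  obtain ⟨a, ha⟩ := exists_ne_zero h0
  have h1 : ContinuousWithinAt (fun w => f (chartMap a (chartInv a w))) (domainG ∩ {w | w a ≠ 0}) w :=
    ((hf a).continuousOn.comp ((differentiableOn_chartInv a).continuousOn.mono inter_subset_right)
      fun w hw => chartInv_mem hw.1 hw.2) w ⟨hw, ha⟩
  have h2 : ContinuousWithinAt f (domainG ∩ {w | w a ≠ 0}) w :=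
    h1.congr (fun y hy => by rw [chartMap_chartInv hy.1 hy.2]) (by rw [chartMap_chartInv hw ha])
  refine h2.mono_of_mem_nhdsWithin (mem_of_superset (inter_mem_nhdsWithin _
    ((isOpen_ne_zero a).mem_nhds ha)) fun y hy => ⟨hy.1.1, hy.2⟩)

theorem chartMap_ne_zero (a : Fin 4) {p : Fin 3 → ℂ} (hp : p ∈ baseDomain) :
    chartMap a p ≠ 0 := fun h => hp.1 <| by rw [← chartMap_apply_self a p, h]; rfl

theorem act_ne_zero {θ : UnitAddTorus (Fin 3)} {w : Fin 4 → ℂ} (hw : w ≠ 0) : act θ w ≠ 0 := by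
  obtain ⟨a, ha⟩ := exists_ne_zero hw
  exact fun h => act_apply_ne_zero.2 ha (by rw [h]; rfl)

/-- The torus only multiplies coordinates by phases, so it maps the image of each chart into itself
and acts there holomorphically. -/
theorem ConeHol.comp_act {f : (Fin 4 → ℂ) → ℂ} (hf : ConeHol f) (θ : UnitAddTorus (Fin 3)) :
    ConeHol fun w => f (act θ w) := by
  intro a
  have hne : ∀ p ∈ baseDomain, act θ (chartMap a p) a ≠ 0 := fun p hp =>
    act_apply_ne_zero.2 (by rw [chartMap_apply_self]; exact hp.1)
  have h : DifferentiableOn ℂ (fun p => f (chartMap a (chartInv a (act θ (chartMap a p)))))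
      baseDomain := by
    refine (hf a).comp (t := baseDomain) (f := fun p => chartInv a (act θ (chartMap a p))) ?_
      fun p hp => chartInv_mem (act_mem (chartMap_mem a hp)) (hne p hp)
    exact (differentiableOn_chartInv a).comp
      ((differentiable_act θ).comp (differentiable_chartMap a)).differentiableOn hne
  refine h.congr fun p hp => ?_
  rw [chartMap_chartInv (act_mem (chartMap_mem a hp)) (hne p hp)]

theorem ConeHol.continuousOn_act {f : (Fin 4 → ℂ) → ℂ} (hf : ConeHol f) (a : Fin 4) :
    ContinuousOn (fun q : UnitAddTorus (Fin 3) × (Fin 3 → ℂ) => f (act q.1 (chartMap a q.2)))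
      (univ ×ˢ baseDomain) := by
  refine hf.continuousOn.comp (f := fun q : UnitAddTorus (Fin 3) × (Fin 3 → ℂ) =>
    act q.1 (chartMap a q.2)) ?_ fun q hq =>
    ⟨act_mem (chartMap_mem a hq.2), act_ne_zero (chartMap_ne_zero a hq.2)⟩
  exact (continuous_act.comp (continuous_fst.prodMk
    ((differentiable_chartMap a).continuous.comp continuous_snd))).continuousOn

theorem ConeHol.continuous_act {f : (Fin 4 → ℂ) → ℂ} (hf : ConeHol f) {w : Fin 4 → ℂ}
    (hw : w ∈ domainG) (h0 : w ≠ 0) : Continuous fun θ => f (act θ w) := by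
  rw [← continuousOn_univ]
  refine hf.continuousOn.comp (f := fun θ => act θ w) ?_ fun θ _ => ⟨act_mem hw, act_ne_zero h0⟩
  exact (Bergman.continuous_act.comp (continuous_id.prodMk continuous_const)).continuousOn

/-- The Fourier coefficient of `f` along the orbits of the torus. -/
noncomputable def orbitCoeff (f : (Fin 4 → ℂ) → ℂ) (m : Fin 3 → ℤ) (w : Fin 4 → ℂ) : ℂ :=
  UnitAddTorus.mFourierCoeff (fun θ => f (act θ w)) m

theorem ConeHol.orbitCoeff {f : (Fin 4 → ℂ) → ℂ} (hf : ConeHol f) (m : Fin 3 → ℤ) :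
    ConeHol (orbitCoeff f m) := by
  intro a
  simp only [Bergman.orbitCoeff, mFourierCoeff_eq]
  refine differentiableOn_integral (μ := torusMeasure)
    (F := fun θ p => UnitAddTorus.mFourier (-m) θ * f (act θ (chartMap a p)))
    isOpen_baseDomain (fun θ => (hf.comp_act θ a).const_mul _) (fun p hp => ?_) fun p hp => ?_
  · exact ((UnitAddTorus.mFourier (-m)).continuous.mul (hf.continuous_act (chartMap_mem a hp)
      (chartMap_ne_zero a hp))).aestronglyMeasurable
  · obtain ⟨ε, hε, hb⟩ := Metric.nhds_basis_closedBall.mem_iff.1 (isOpen_baseDomain.mem_nhds hp)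
    obtain ⟨M, hM⟩ := (isCompact_univ.prod (isCompact_closedBall p ε)).exists_bound_of_continuousOn
      ((hf.continuousOn_act a).mono (prod_mono_right hb))
    refine ⟨ε, hε, M, fun θ q hq _ => ?_⟩
    have h1 : ‖UnitAddTorus.mFourier (-m) θ‖ = 1 := by simp [mFourier_eq]
    rw [norm_mul, h1, one_mul]
    exact hM (θ, q) ⟨mem_univ _, Metric.ball_subset_closedBall hq⟩

/-- Invariance of Haar measure makes the m-th coefficient transform by the character m. -/
theorem orbitCoeff_act (f : (Fin 4 → ℂ) → ℂ) (m : Fin 3 → ℤ) (φ : UnitAddTorus (Fin 3))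
    (w : Fin 4 → ℂ) :
    orbitCoeff f m (act φ w) = UnitAddTorus.mFourier m φ * orbitCoeff f m w := by
  simp only [orbitCoeff, mFourierCoeff_eq, ← act_add]
  rw [← integral_add_right_eq_self (μ := torusMeasure)
    (fun θ => UnitAddTorus.mFourier (-m) θ * f (act θ w)) φ, ← integral_const_mul]
  congr 1 with θ
  rw [mFourier_add_apply]
  have : UnitAddTorus.mFourier m φ * UnitAddTorus.mFourier (-m) φ = 1 := by
    have h0 := phase_ne_zero φ 0
    have h1 := phase_ne_zero φ 1
    have h2 := phase_ne_zero φ 2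
    simp only [mFourier_eq, Pi.neg_apply, zpow_neg]
    field_simp
  linear_combination (-(UnitAddTorus.mFourier (-m) θ) * f (act (θ + φ) w)) * this

/-! ### Equivariant holomorphic functions are monomials -/

/-- The part of `baseDomain` off the coordinate hyperplanes. -/
def baseTorus : Set (Fin 3 → ℂ) := {p | p ∈ baseDomain ∧ p 1 ≠ 0 ∧ p 2 ≠ 0}

theorem isOpen_baseTorus : IsOpen baseTorus :=
  isOpen_baseDomain.inter ((isOpen_ne_fun (continuous_apply 1) continuous_const).inter
    (isOpen_ne_fun (continuous_apply 2) continuous_const))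

/-- Logarithmic coordinates: after scaling x by √((1+|y|²)(1+|z|²)), the set is the product of a
punctured unit disc and two punctured planes, hence the continuous image of a half-plane times ℂ²
under exponentials. -/
theorem isPreconnected_baseTorus : IsPreconnected baseTorus := by
  let r : (ℂ × ℂ × ℂ) → ℝ := fun q =>
    Real.sqrt ((1 + ‖Complex.exp q.2.1‖ ^ 2) * (1 + ‖Complex.exp q.2.2‖ ^ 2))
  have hr : ∀ q, 0 < r q := fun q => Real.sqrt_pos.2 (by positivity)
  have hr2 : ∀ q, r q ^ 2 = (1 + ‖Complex.exp q.2.1‖ ^ 2) * (1 + ‖Complex.exp q.2.2‖ ^ 2) :=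
    fun q => Real.sq_sqrt (by positivity)
  have hrc : Continuous r := by fun_prop
  let E : (ℂ × ℂ × ℂ) → (Fin 3 → ℂ) := fun q =>
    ![Complex.exp q.1 / r q, Complex.exp q.2.1, Complex.exp q.2.2]
  have hE : Continuous E := by
    have h0 : ∀ q, (r q : ℂ) ≠ 0 := fun q => by exact_mod_cast (hr q).ne'
    refine continuous_pi fun i => ?_
    fin_cases i <;> simp [E]
    · exact (by fun_prop : Continuous fun q : ℂ × ℂ × ℂ => Complex.exp q.1).div
        (Complex.continuous_ofReal.comp hrc) h0
    · fun_prop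
    · fun_prop
  have hS : baseTorus = E '' ({z : ℂ | z.re < 0} ×ˢ univ) := by
    ext p
    constructor
    · rintro ⟨⟨h0, hp⟩, h1, h2⟩
      let q : ℂ × ℂ × ℂ := (0, Complex.log (p 1), Complex.log (p 2))
      have hq : r q ^ 2 = (1 + ‖p 1‖ ^ 2) * (1 + ‖p 2‖ ^ 2) := by
        rw [hr2]; simp only [q, Complex.exp_log h1, Complex.exp_log h2]
      have hrq : (r q : ℂ) ≠ 0 := by exact_mod_cast (hr q).ne'
      refine ⟨(Complex.log (p 0 * r q), Complex.log (p 1), Complex.log (p 2)), ⟨?_, mem_univ _⟩, ?_⟩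
      · change (Complex.log _).re < 0
        rw [Complex.log_re]
        refine Real.log_neg (norm_pos_iff.2 (mul_ne_zero h0 hrq)) ?_
        refine lt_of_pow_lt_pow_left₀ 2 zero_le_one ?_
        rw [norm_mul, mul_pow, Complex.norm_real, Real.norm_eq_abs, sq_abs, hq, ← mul_assoc, one_pow]
        exact hp
      · ext i
        fin_cases i
        · change Complex.exp (Complex.log (p 0 * r q)) / (r q : ℂ) = p 0
          rw [Complex.exp_log (mul_ne_zero h0 hrq)]
          field_simp
        · exact Complex.exp_log h1
        · exact Complex.exp_log h2
    · rintro ⟨q, ⟨hq, -⟩, rfl⟩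
      have hrq : (r q : ℂ) ≠ 0 := by exact_mod_cast (hr q).ne'
      refine ⟨⟨div_ne_zero (Complex.exp_ne_zero _) hrq, ?_⟩, Complex.exp_ne_zero _,
        Complex.exp_ne_zero _⟩
      change ‖Complex.exp q.1 / (r q : ℂ)‖ ^ 2 * (1 + ‖Complex.exp q.2.1‖ ^ 2) *
        (1 + ‖Complex.exp q.2.2‖ ^ 2) < 1
      rw [mul_assoc, ← hr2, norm_div, Complex.norm_real, Real.norm_eq_abs, abs_of_pos (hr q),
        div_pow, div_mul_cancel₀ _ (by have := hr q; positivity), Complex.norm_exp]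
      exact pow_lt_one₀ (Real.exp_nonneg _) (by simpa using hq) two_ne_zero
  rw [hS]
  refine IsPreconnected.image ?_ _ hE.continuousOn
  exact (((convex_halfSpace_re_lt 0).prod convex_univ)).isPreconnected

/-- The Laurent monomial with exponent `m`. -/
noncomputable def laurent (m : Fin 3 → ℤ) (p : Fin 3 → ℂ) : ℂ := p 0 ^ m 0 * p 1 ^ m 1 * p 2 ^ m 2

theorem laurent_rot (m : Fin 3 → ℤ) (θ : UnitAddTorus (Fin 3)) (p : Fin 3 → ℂ) :
    laurent m (rot θ p) = UnitAddTorus.mFourier m θ * laurent m p := by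
  simp only [laurent, rot, mFourier_eq, mul_zpow]; ring

theorem laurent_ne_zero {m : Fin 3 → ℤ} {p : Fin 3 → ℂ} (hp : p ∈ baseTorus) :
    laurent m p ≠ 0 :=
  mul_ne_zero (mul_ne_zero (zpow_ne_zero _ hp.1.1) (zpow_ne_zero _ hp.2.1)) (zpow_ne_zero _ hp.2.2)

theorem differentiableOn_laurent (m : Fin 3 → ℤ) : DifferentiableOn ℂ (laurent m) baseTorus := by
  intro p hp
  have h : ∀ j, p j ≠ 0 → DifferentiableAt ℂ (fun p : Fin 3 → ℂ => p j ^ m j) p := fun j hj =>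
    DifferentiableAt.comp p (g := fun z : ℂ => z ^ m j) (f := fun p : Fin 3 → ℂ => p j)
      (differentiableAt_zpow.2 (Or.inl hj)) (differentiableAt_apply j p)
  exact (((h 0 hp.1.1).mul (h 1 hp.2.1)).mul (h 2 hp.2.2)).differentiableWithinAt

theorem rot_mem_baseTorus {θ : UnitAddTorus (Fin 3)} {p : Fin 3 → ℂ} (hp : p ∈ baseTorus) :
    rot θ p ∈ baseTorus :=
  ⟨rot_mem.2 hp.1, mul_ne_zero (phase_ne_zero _ _) hp.2.1, mul_ne_zero (phase_ne_zero _ _) hp.2.2⟩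

/-- A holomorphic function that is invariant under the torus is constant. -/
theorem exists_eq_const_of_invariant {B : (Fin 3 → ℂ) → ℂ} (hB : DifferentiableOn ℂ B baseTorus)
    (hinv : ∀ θ, ∀ p ∈ baseTorus, B (rot θ p) = B p) : ∃ C, ∀ p ∈ baseTorus, B p = C := by
  refine isOpen_baseTorus.exists_is_const_of_fderiv_eq_zero isPreconnected_baseTorus hB ?_
  intro p hp
  have hBp := (hB.differentiableAt (isOpen_baseTorus.mem_nhds hp)).hasFDerivAt
  have hpj : ∀ j, p j ≠ 0 := by
    intro j; fin_cases j
    exacts [hp.1.1, hp.2.1, hp.2.2]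
  have key : ∀ j, fderiv ℂ B p (Pi.single j 1) = 0 := by
    intro j
    -- The orbit of p under the j-th circle. B is constant along it, and the velocity is a nonzero
    -- complex multiple of the j-th basis vector, so complex linearity of the derivative kills the
    -- whole j-th partial derivative.
    let c : ℝ → (Fin 3 → ℂ) := fun t => Function.update p j (Complex.exp (2 * Real.pi * Complex.I * t) * p j)
    have hc0 : c 0 = p := by simp [c]
    have hc : ∀ t, c t = rot (Pi.single j ((t : ℝ) : UnitAddCircle)) p := by
      intro t
      ext i
      rcases eq_or_ne i j with rfl | hij
      · simp only [c, Function.update_self, rot, phase, Pi.single_eq_same, fourier_coe_apply]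
        simp
      · simp [c, rot, phase, Function.update_of_ne hij, Pi.single_eq_of_ne hij]
    have hd : HasDerivAt c (Pi.single j (2 * Real.pi * Complex.I * p j)) 0 := by
      rw [hasDerivAt_pi]
      intro i
      rcases eq_or_ne i j with rfl | hij
      · simp only [c, Function.update_self, Pi.single_eq_same]
        have h1 : HasDerivAt (fun t : ℝ => 2 * Real.pi * Complex.I * (t : ℂ))
            (2 * Real.pi * Complex.I * 1) 0 :=
          (Complex.ofRealCLM.hasDerivAt (x := (0 : ℝ))).const_mul _
        have h2 := (h1.cexp).mul_const (p i)
        simpa using h2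
      · simp only [c, Function.update_of_ne hij, Pi.single_eq_of_ne hij]
        exact hasDerivAt_const _ _
    have h1 : HasDerivAt (fun t => B (c t))
        (fderiv ℂ B p (Pi.single j (2 * Real.pi * Complex.I * p j))) 0 := by
      rw [← hc0] at hBp
      have := (hBp.restrictScalars ℝ).comp_hasDerivAt (0 : ℝ) hd
      rw [hc0] at this
      exact this
    have h2 : (fun t => B (c t)) = fun _ => B p := by
      funext t; rw [hc, hinv _ _ hp]
    rw [h2] at h1
    have h3 := h1.unique (hasDerivAt_const _ _)
    have h4 : (Pi.single j (2 * Real.pi * Complex.I * p j) : Fin 3 → ℂ) =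
        (2 * Real.pi * Complex.I * p j) • Pi.single j 1 := by
      rw [← Pi.single_smul, smul_eq_mul, mul_one]
    rw [h4, map_smul, smul_eq_mul] at h3
    exact (mul_eq_zero.1 h3).resolve_left (mul_ne_zero Complex.two_pi_I_ne_zero (hpj j))
  ext v
  have hv : v = ∑ j, v j • (Pi.single j 1 : Fin 3 → ℂ) := by
    ext i; simp [Finset.sum_apply, Pi.single_apply]
  rw [hv, map_sum]
  simp [map_smul, key]

theorem baseMap_ne_zero {p : Fin 3 → ℂ} (hp : p ∈ baseDomain) : baseMap p ≠ 0 := by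
  rw [← chartMap_zero]; exact chartMap_ne_zero 0 hp

/-- The coefficient and the Laurent monomial transform by the same character, so their quotient is
invariant, hence constant. -/
theorem ConeHol.exists_orbitCoeff_eq {f : (Fin 4 → ℂ) → ℂ} (hf : ConeHol f) (m : Fin 3 → ℤ) :
    ∃ C : ℂ, ∀ p ∈ baseTorus, Bergman.orbitCoeff f m (baseMap p) = C * laurent m p := by
  have h0 := hf.orbitCoeff m 0
  simp only [chartMap_zero] at h0
  obtain ⟨C, hC⟩ := exists_eq_const_of_invariant
    (B := fun p => Bergman.orbitCoeff f m (baseMap p) * (laurent m p)⁻¹)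
    ((h0.mono fun p hp => hp.1).mul ((differentiableOn_laurent m).inv fun p hp =>
      laurent_ne_zero hp)) fun θ p hp => by
      rw [baseMap_rot, orbitCoeff_act, laurent_rot]
      have h1 := laurent_ne_zero (m := m) hp
      have h2 := laurent_ne_zero (m := m) (rot_mem_baseTorus (θ := θ) hp)
      rw [laurent_rot] at h2
      have h3 := left_ne_zero_of_mul h2
      field_simp
  refine ⟨C, fun p hp => ?_⟩
  rw [← hC p hp, inv_mul_cancel_right₀ (laurent_ne_zero hp)]

/-- A negative exponent −(k+1) would give the function y^(k+1) g(y) the two limits 0 and D at the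
origin. -/
theorem nonneg_of_eq_zpow {g : ℂ → ℂ} (hg : ContinuousAt g 0) {D : ℂ} (hD : D ≠ 0) {n : ℤ}
    (h : ∀ y : ℂ, y ≠ 0 → ‖y‖ < 1 → g y = D * y ^ n) : 0 ≤ n := by
  by_contra! hn
  obtain ⟨k, hk⟩ : ∃ k : ℕ, n = -((k : ℤ) + 1) := ⟨(-n - 1).toNat, by omega⟩
  have h1 : Tendsto (fun y : ℂ => y ^ (k + 1) * g y) (𝓝[≠] 0) (𝓝 (0 ^ (k + 1) * g 0)) :=
    ((continuousAt_id.pow (k + 1)).mul hg).tendsto.mono_left nhdsWithin_le_nhds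
  have h2 : Tendsto (fun y : ℂ => y ^ (k + 1) * g y) (𝓝[≠] 0) (𝓝 D) := by
    refine (tendsto_const_nhds (x := D)).congr' ?_
    filter_upwards [self_mem_nhdsWithin, mem_nhdsWithin_of_mem_nhds (Metric.ball_mem_nhds 0 one_pos)]
      with y hy hy1
    have hy0 : y ≠ 0 := hy
    rw [h y hy0 (by simpa using hy1), hk, zpow_neg, ← Nat.cast_succ, zpow_natCast]
    field_simp
  have h3 := tendsto_nhds_unique h1 h2
  simp at h3
  exact hD h3.symm

/-- Only the exponents of the holomorphic monomials of the cone occur. -/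
theorem ConeHol.exponent_bounds {f : (Fin 4 → ℂ) → ℂ} (hf : ConeHol f) {m : Fin 3 → ℤ} {C : ℂ}
    (hC : ∀ p ∈ baseTorus, f (baseMap p) = C * laurent m p) (h0 : C ≠ 0) :
    0 ≤ m 1 ∧ 0 ≤ m 2 ∧ m 1 ≤ m 0 ∧ m 2 ≤ m 0 := by
  -- A test disc through the divisor y = 0; the first coordinate 1/4 keeps it in the domain, since
  -- 2(1+|y|²)/16 < 1.
  have hmemY : ∀ y : ℂ, ‖y‖ < 1 → (![1 / 4, y, 1] : Fin 3 → ℂ) ∈ baseDomain := fun y hy => by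
    refine ⟨by simp, ?_⟩
    simp
    nlinarith [norm_nonneg y]
  have hmemZ : ∀ y : ℂ, ‖y‖ < 1 → (![1 / 4, 1, y] : Fin 3 → ℂ) ∈ baseDomain := fun y hy => by
    refine ⟨by simp, ?_⟩
    simp
    nlinarith [norm_nonneg y]
  have hcY : ∀ a, ContinuousAt (fun y : ℂ => f (chartMap a ![1 / 4, y, 1])) 0 := fun a => by
    have h1 := (hf a).continuousOn.continuousAt (isOpen_baseDomain.mem_nhds (hmemY 0 (by simp)))
    have h2 : Continuous fun y : ℂ => (![1 / 4, y, 1] : Fin 3 → ℂ) := by fun_prop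
    exact ContinuousAt.comp (f := fun y : ℂ => (![1 / 4, y, 1] : Fin 3 → ℂ)) h1 h2.continuousAt
  have hcZ : ∀ a, ContinuousAt (fun y : ℂ => f (chartMap a ![1 / 4, 1, y])) 0 := fun a => by
    have h1 := (hf a).continuousOn.continuousAt (isOpen_baseDomain.mem_nhds (hmemZ 0 (by simp)))
    have h2 : Continuous fun y : ℂ => (![1 / 4, 1, y] : Fin 3 → ℂ) := by fun_prop
    exact ContinuousAt.comp (f := fun y : ℂ => (![1 / 4, 1, y] : Fin 3 → ℂ)) h1 h2.continuousAt
  have hD : C * (1 / 4 : ℂ) ^ m 0 ≠ 0 := mul_ne_zero h0 (zpow_ne_zero _ (by norm_num))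
  -- The transition from chart 1 to chart 0 is (x, y, z) ↦ (xy, 1/y, z). On the test disc the
  -- monomial becomes a multiple of y^(m 0 − m 1), which gives the upper bound for m 1.
  have hinvY : ∀ y : ℂ, y ≠ 0 → ‖y‖ < 1 → (![1 / 4 * y, y⁻¹, 1] : Fin 3 → ℂ) ∈ baseTorus ∧
      chartMap 1 ![1 / 4, y, 1] = baseMap ![1 / 4 * y, y⁻¹, 1] := fun y hy hy1 => by
    have hy' : 0 < ‖y‖ := norm_pos_iff.2 hy
    refine ⟨⟨⟨by simp [hy], ?_⟩, by simp [hy], by simp⟩, ?_⟩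
    · simp
      field_simp
      nlinarith
    · ext i
      fin_cases i <;> simp [chartMap, baseMap] <;> field_simp
  have hinvZ : ∀ y : ℂ, y ≠ 0 → ‖y‖ < 1 → (![1 / 4 * y, 1, y⁻¹] : Fin 3 → ℂ) ∈ baseTorus ∧
      chartMap 2 ![1 / 4, 1, y] = baseMap ![1 / 4 * y, 1, y⁻¹] := fun y hy hy1 => by
    have hy' : 0 < ‖y‖ := norm_pos_iff.2 hy
    refine ⟨⟨⟨by simp [hy], ?_⟩, by simp, by simp [hy]⟩, ?_⟩
    · simp
      field_simp
      nlinarith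
    · ext i
      fin_cases i <;> simp [chartMap, baseMap] <;> field_simp
  refine ⟨?_, ?_, ?_, ?_⟩
  · refine nonneg_of_eq_zpow (hcY 0) hD fun y hy hy1 => ?_
    rw [chartMap_zero, hC _ ⟨hmemY y hy1, by simpa using hy, by simp⟩, laurent]
    simp
    ring
  · refine nonneg_of_eq_zpow (hcZ 0) hD fun y hy hy1 => ?_
    rw [chartMap_zero, hC _ ⟨hmemZ y hy1, by simp, by simpa using hy⟩, laurent]
    simp
    ring
  · refine sub_nonneg.1 (nonneg_of_eq_zpow (hcY 1) hD fun y hy hy1 => ?_)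
    rw [(hinvY y hy hy1).2, hC _ (hinvY y hy hy1).1, laurent]
    simp [mul_zpow, zpow_sub₀ hy]
    ring
  · refine sub_nonneg.1 (nonneg_of_eq_zpow (hcZ 2) hD fun y hy hy1 => ?_)
    rw [(hinvZ y hy hy1).2, hC _ (hinvZ y hy hy1).1, laurent]
    simp [mul_zpow, zpow_sub₀ hy]
    ring

/-! ### Completeness of the monomials -/

theorem baseDomain_subset_closure : baseDomain ⊆ closure baseTorus := by
  have hd : Dense (univ.pi fun _ : Fin 3 => ({0}ᶜ : Set ℂ)) :=
    dense_pi univ fun _ _ => dense_compl_singleton 0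
  refine (hd.open_subset_closure_inter isOpen_baseDomain).trans (closure_mono ?_)
  exact fun p hp => ⟨hp.1, hp.2 1 (mem_univ _), hp.2 2 (mem_univ _)⟩

theorem eqOn_baseDomain {g₁ g₂ : (Fin 3 → ℂ) → ℂ} (h₁ : ContinuousOn g₁ baseDomain)
    (h₂ : ContinuousOn g₂ baseDomain) (h : EqOn g₁ g₂ baseTorus) : EqOn g₁ g₂ baseDomain :=
  h.of_subset_closure h₁ h₂ (fun _ hp => hp.1) baseDomain_subset_closure

theorem ConeHol.continuousOn_baseMap {f : (Fin 4 → ℂ) → ℂ} (hf : ConeHol f) :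
    ContinuousOn (fun p => f (baseMap p)) baseDomain := by
  have h := (hf 0).continuousOn
  simpa only [chartMap_zero] using h

theorem ConeHol.aestronglyMeasurable_repr {f : (Fin 4 → ℂ) → ℂ} (hf : ConeHol f) :
    AEStronglyMeasurable (repr f) (volume.restrict baseDomain) := by
  refine ContinuousOn.aestronglyMeasurable ?_ isOpen_baseDomain.measurableSet
  unfold repr
  exact (continuous_const.mul (continuous_apply 0)).continuousOn.mul hf.continuousOn_baseMap

theorem ConeHol.memLp_repr_iff {f : (Fin 4 → ℂ) → ℂ} (hf : ConeHol f) :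
    MemLp (repr f) 2 (volume.restrict baseDomain) ↔
      IntegrableOn (fun p => ‖repr f p‖ ^ 2) baseDomain :=
  memLp_two_iff_integrable_sq_norm hf.aestronglyMeasurable_repr

theorem coneHol_of_differentiable {f : (Fin 4 → ℂ) → ℂ} (hf : Differentiable ℂ f) : ConeHol f :=
  fun a => (hf.comp (differentiable_chartMap a)).differentiableOn

theorem coneHol_basisFun (i : Idx) : ConeHol (basisFun i) :=
  coneHol_of_differentiable ((differentiable_mono _ _ _).const_mul _)

theorem memLp_repr_basisFun (i : Idx) : MemLp (repr (basisFun i)) 2 (volume.restrict baseDomain) :=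
  (coneHol_basisFun i).memLp_repr_iff.2 (integrable_repr_basisFun i).1

/-- The exponent of the monomial with index `i`. -/
def Idx.expo (i : Idx) : Fin 3 → ℤ := ![(i.1 : ℤ), (i.2.1 : ℕ), (i.2.2 : ℕ)]

theorem Idx.expo_injective : Function.Injective Idx.expo := by
  rintro ⟨k, a, b⟩ ⟨k', a', b'⟩ h
  have h0 := congrFun h 0
  have h1 := congrFun h 1
  have h2 := congrFun h 2
  simp [Idx.expo] at h0 h1 h2
  subst h0
  simp [Fin.ext_iff, h1, h2]

theorem basisFun_baseMap (i : Idx) (p : Fin 3 → ℂ) :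
    basisFun i (baseMap p) = (Real.sqrt (normConstSq i) : ℂ) * laurent i.expo p := by
  rw [basisFun, mono_baseMap i.le_left i.le_right]
  simp [laurent, Idx.expo]

theorem basisFun_act (i : Idx) (θ : UnitAddTorus (Fin 3)) (p : Fin 3 → ℂ) :
    basisFun i (act θ (baseMap p)) =
      UnitAddTorus.mFourier i.expo θ * basisFun i (baseMap p) := by
  rw [← baseMap_rot, basisFun_baseMap, basisFun_baseMap, laurent_rot]; ring

theorem phase_mul_conj (θ : UnitAddTorus (Fin 3)) (j : Fin 3) :
    phase θ j * starRingEnd ℂ (phase θ j) = 1 := by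
  rw [Complex.mul_conj, Complex.normSq_eq_norm_sq, norm_phase]; simp

/-- Only the Fourier coefficient with the exponent of a monomial contributes to the inner product
with it. -/
theorem integral_repr_mul_basisFun {f : (Fin 4 → ℂ) → ℂ} 
    (hL : MemLp (repr f) 2 (volume.restrict baseDomain)) (i : Idx) :
    ∫ p in baseDomain, repr f p * starRingEnd ℂ (repr (basisFun i) p) =
      ∫ p in baseDomain, repr (orbitCoeff f i.expo) p * starRingEnd ℂ (repr (basisFun i) p) := by
  set h : (Fin 3 → ℂ) → ℂ := fun p => repr f p * starRingEnd ℂ (repr (basisFun i) p) with hh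
  have hint : Integrable h (volume.restrict baseDomain) :=
    hL.integrable_mul (memLp_repr_basisFun i).star
  -- The phases of x from the two weights are conjugate and cancel; only the character of the
  -- monomial, conjugated, remains.
  have hrot : ∀ θ p, h (rot θ p) = (Real.sqrt 8 : ℂ) * p 0 *
      (UnitAddTorus.mFourier (-i.expo) θ * f (act θ (baseMap p))) *
        starRingEnd ℂ (repr (basisFun i) p) := by
    intro θ p
    simp only [hh, repr, baseMap_rot, basisFun_act, UnitAddTorus.mFourier_neg, map_mul]
    simp only [rot, map_mul]
    linear_combination (↑√8 * p 0 * f (act θ (baseMap p)) * (starRingEnd ℂ) ↑√8 *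
      (starRingEnd ℂ) (p 0) * (starRingEnd ℂ) (UnitAddTorus.mFourier i.expo θ) *
      (starRingEnd ℂ) (basisFun i (baseMap p))) * phase_mul_conj θ 0
  have hshear : MeasurePreserving (fun q : UnitAddTorus (Fin 3) × (Fin 3 → ℂ) => (q.1, rot q.1 q.2))
      (torusMeasure.prod (volume.restrict baseDomain))
      (torusMeasure.prod (volume.restrict baseDomain)) :=
    (MeasurePreserving.id torusMeasure).skew_product (g := rot) continuous_rot.measurable
      (Eventually.of_forall fun θ => (measurePreserving_rot θ).map_eq)
  have hprod : Integrable (fun q : UnitAddTorus (Fin 3) × (Fin 3 → ℂ) => h (rot q.1 q.2))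
      (torusMeasure.prod (volume.restrict baseDomain)) :=
    hshear.integrable_comp_of_integrable (hint.comp_snd torusMeasure)
  have h1 : ∀ θ, ∫ p in baseDomain, h (rot θ p) = ∫ p in baseDomain, h p := fun θ => by
    have hm := (measurePreserving_rot θ).map_eq
    have h2 := integral_map (μ := volume.restrict baseDomain) (φ := rot θ) (f := h)
      (measurePreserving_rot θ).measurable.aemeasurable (by rw [hm]; exact hint.1)
    rw [hm] at h2
    exact h2.symm
  -- Rotations preserve the integral, so it may be averaged over the torus; by Fubini the average
  -- over θ produces the Fourier coefficient of f.
  calc ∫ p in baseDomain, h p = ∫ θ, (∫ p in baseDomain, h (rot θ p)) ∂torusMeasure := by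
        simp [h1]
    _ = ∫ p in baseDomain, (∫ θ, h (rot θ p) ∂torusMeasure) := integral_integral_swap hprod
    _ = _ := by
        congr 1 with p
        simp only [hrot]
        rw [integral_mul_const, integral_const_mul]
        rfl

theorem exists_mFourier_ne {m m' : Fin 3 → ℤ} (h : m ≠ m') :
    ∃ φ, UnitAddTorus.mFourier m φ ≠ UnitAddTorus.mFourier m' φ := by
  obtain ⟨j, hj⟩ := Function.ne_iff.1 h
  have hn : m j - m' j ≠ 0 := sub_ne_zero.2 hj
  -- At this point the quotient of the two characters is exp(πi) = −1.
  let x : UnitAddCircle := ((1 / 2 / ((m j - m' j : ℤ) : ℝ) : ℝ) : UnitAddCircle)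
  refine ⟨Pi.single j x, fun he => ?_⟩
  have h1 : (fourier (m j - m' j) x : ℂ) = -1 := by
    have := fourier_add_half_inv_index hn one_pos (0 : UnitAddCircle)
    rwa [zero_add, fourier_eval_zero] at this
  have h2 : ∀ n : Fin 3 → ℤ, UnitAddTorus.mFourier n (Pi.single j x) = fourier (n j) x := by
    intro n
    simp only [UnitAddTorus.mFourier, ContinuousMap.coe_mk]
    rw [Finset.prod_eq_single j (fun i _ hi => by rw [Pi.single_eq_of_ne hi, fourier_eval_zero])
      (by simp), Pi.single_eq_same]
  rw [h2, h2] at he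
  rw [sub_eq_add_neg, fourier_add, he, ← fourier_add, add_neg_cancel, fourier_zero] at h1
  norm_num at h1

/-- The function transforms both by the character m and by that of the monomial; where the two
characters differ, this leaves only zero. -/
theorem orbitCoeff_basisFun {i : Idx} {m : Fin 3 → ℤ} (h : m ≠ i.expo) (p : Fin 3 → ℂ) :
    orbitCoeff (basisFun i) m (baseMap p) = 0 := by
  obtain ⟨φ, hφ⟩ := exists_mFourier_ne h
  have h1 := orbitCoeff_act (basisFun i) m φ (baseMap p)
  have h2 : orbitCoeff (basisFun i) m (act φ (baseMap p)) =
      UnitAddTorus.mFourier i.expo φ * orbitCoeff (basisFun i) m (baseMap p) := by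
    simp only [orbitCoeff, mFourierCoeff_eq]
    rw [← integral_const_mul]
    congr 1 with θ
    rw [← baseMap_rot φ, basisFun_act, basisFun_baseMap, laurent_rot, basisFun_act, basisFun_baseMap]
    ring
  rw [h1] at h2
  exact (mul_eq_zero.1 (by linear_combination h2 :
    (UnitAddTorus.mFourier m φ - UnitAddTorus.mFourier i.expo φ) * _ = 0)).resolve_left
      (sub_ne_zero.2 hφ)

theorem integral_repr_basisFun_of_ne {i j : Idx} (h : i ≠ j) :
    ∫ p in baseDomain, repr (basisFun i) p * starRingEnd ℂ (repr (basisFun j) p) = 0 := by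
  rw [integral_repr_mul_basisFun (memLp_repr_basisFun i)]
  simp [repr, orbitCoeff_basisFun (Idx.expo_injective.ne h.symm)]

theorem integral_repr_basisFun_self (i : Idx) :
    ∫ p in baseDomain, repr (basisFun i) p * starRingEnd ℂ (repr (basisFun i) p) = 1 := by
  simp only [Complex.mul_conj, Complex.normSq_eq_norm_sq]
  rw [integral_complex_ofReal, (integrable_repr_basisFun i).2, Complex.ofReal_one]

/-- A nonzero coefficient is C times a Laurent monomial whose exponent is admissible by
`ConeHol.exponent_bounds`, hence a multiple of some `basisFun i`. Its inner product with that
element equals the one of f, which is zero, so C = 0. -/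
theorem ConeHol.orbitCoeff_eq_zero {f : (Fin 4 → ℂ) → ℂ} (hf : ConeHol f)
    (hL : MemLp (repr f) 2 (volume.restrict baseDomain))
    (horth : ∀ i, ∫ p in baseDomain, repr f p * starRingEnd ℂ (repr (basisFun i) p) = 0)
    (m : Fin 3 → ℤ) {p : Fin 3 → ℂ} (hp : p ∈ baseTorus) :
    Bergman.orbitCoeff f m (baseMap p) = 0 := by
  obtain ⟨C, hC⟩ := hf.exists_orbitCoeff_eq m
  by_cases h0 : C = 0
  · rw [hC p hp, h0, zero_mul]
  exfalso
  obtain ⟨h1, h2, h3, h4⟩ := (hf.orbitCoeff m).exponent_bounds hC h0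
  obtain ⟨i, rfl⟩ : ∃ i : Idx, i.expo = m := by
    refine ⟨⟨(m 0).toNat, ⟨(m 1).toNat, by omega⟩, ⟨(m 2).toNat, by omega⟩⟩, ?_⟩
    ext j
    fin_cases j <;> simp [Idx.expo] <;> omega
  have hN : (Real.sqrt (normConstSq i) : ℂ) ≠ 0 := by
    exact_mod_cast (Real.sqrt_pos.2 (normConstSq_pos i)).ne'
  have h5 : EqOn (fun p => Bergman.orbitCoeff f i.expo (baseMap p))
      (fun p => C / (Real.sqrt (normConstSq i) : ℂ) * basisFun i (baseMap p)) baseDomain := by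
    refine eqOn_baseDomain (hf.orbitCoeff _).continuousOn_baseMap
      (continuousOn_const.mul (coneHol_basisFun i).continuousOn_baseMap) fun p hp => ?_
    simp only [hC p hp, basisFun_baseMap]
    field_simp
  have h6 := horth i
  rw [integral_repr_mul_basisFun hL, setIntegral_congr_fun
    (g := fun p => C / (Real.sqrt (normConstSq i) : ℂ) *
      (repr (basisFun i) p * starRingEnd ℂ (repr (basisFun i) p)))
    isOpen_baseDomain.measurableSet (fun p hp => ?_), integral_const_mul,
    integral_repr_basisFun_self, mul_one] at h6
  · exact div_ne_zero h0 hN h6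
  · have h7 : Bergman.orbitCoeff f i.expo (baseMap p) = _ := h5 hp
    simp only [repr]
    rw [h7]
    ring

theorem ConeHol.eq_zero {f : (Fin 4 → ℂ) → ℂ} (hf : ConeHol f)
    (hL : MemLp (repr f) 2 (volume.restrict baseDomain))
    (horth : ∀ i, ∫ p in baseDomain, repr f p * starRingEnd ℂ (repr (basisFun i) p) = 0)
    {w : Fin 4 → ℂ} (hw : w ∈ domainG) (h0 : w ≠ 0) : f w = 0 := by
  have h1 : ∀ p ∈ baseTorus, f (baseMap p) = 0 := by
    intro p hp
    have hc : ∀ m, UnitAddTorus.mFourierCoeff (fun θ => f (act θ (baseMap p))) m = 0 := fun m =>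
      hf.orbitCoeff_eq_zero hL horth m hp
    let F : C(UnitAddTorus (Fin 3), ℂ) :=
      ⟨fun θ => f (act θ (baseMap p)), hf.continuous_act (baseMap_mem hp.1) (baseMap_ne_zero hp.1)⟩
    have hF : UnitAddTorus.mFourierCoeff F = 0 := funext hc
    -- A continuous function with summable Fourier coefficients is the sum of its series; here all
    -- coefficients vanish, and θ = 0 gives back f at the point.
    have h2 := UnitAddTorus.hasSum_mFourier_series_apply_of_summable (f := F)
      (by rw [hF]; exact summable_zero) 0
    rw [hF] at h2
    have h3 : F 0 = 0 := by
      refine h2.unique ?_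
      simp [hasSum_zero]
    simpa [F] using h3
  obtain ⟨a, ha⟩ := exists_ne_zero h0
  have h2 : EqOn (fun p => f (chartMap a p)) (fun _ => 0) baseDomain := by
    refine eqOn_baseDomain (hf a).continuousOn continuousOn_const fun p hp => ?_
    -- On the dense set `baseTorus` all four coordinates are nonzero in every chart, so such points
    -- are already reached by chart 0.
    have hne : ∀ i, chartMap a p i ≠ 0 := by
      have : ∀ i, baseMap p i ≠ 0 := by
        intro i
        have h0 := hp.1.1
        have h1 := hp.2.1
        have h2 := hp.2.2
        fin_cases i <;> simp [baseMap, h0, h1, h2]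
      exact fun i => this (a ^^^ i)
    have hmem := chartMap_mem a hp.1
    have h3 : chartInv 0 (chartMap a p) ∈ baseTorus := by
      refine ⟨chartInv_mem hmem (hne 0), ?_, ?_⟩
      · simp [chartInv, baseInv, hne]
      · simp [chartInv, baseInv, hne]
    have h4 := h1 _ h3
    rwa [← chartMap_zero, chartMap_chartInv hmem (hne 0)] at h4
  have h3 := h2 (chartInv_mem hw ha)
  simpa only [chartMap_chartInv hw ha] using h3

/-! ### The Bergman space as a sequence space -/

/-- Square summable sequences of coefficients. -/
abbrev Coeffs : Type := lp (fun _ : Idx => ℂ) 2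

/-- The function on the cone with the coefficients `c`. -/
noncomputable def synth (c : Coeffs) (w : Fin 4 → ℂ) : ℂ := ∑' i, c i * basisFun i w

theorem norm_coeffs_mul_le (c : Coeffs) {w : Fin 4 → ℂ} (hw : w ∈ domainG) {s : ℝ} (hs : 0 ≤ s)
    (hws : normSq4 w ≤ s ^ 2) (i : Idx) :
    ‖c i * basisFun i w‖ ≤ ‖c‖ * (((i.1 : ℝ) + 2) ^ 2 * s ^ i.1) := by
  rw [norm_mul]
  exact mul_le_mul (lp.norm_apply_le_norm two_ne_zero c i) (norm_basisFun_le hw.2 hs hws i)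
    (norm_nonneg _) (norm_nonneg _)

theorem exists_radius {w : Fin 4 → ℂ} (hw : w ∈ domainG) :
    ∃ s : ℝ, 0 ≤ s ∧ s < 1 ∧ normSq4 w < s ^ 2 := by
  have hn1 : normSq4 w < 1 := hw.1
  have hn0 : 0 ≤ normSq4 w := Finset.sum_nonneg fun _ _ => by positivity
  obtain ⟨t, ht, ht1⟩ := exists_between hn1
  refine ⟨Real.sqrt t, Real.sqrt_nonneg _, ?_, ?_⟩
  · rw [Real.sqrt_lt' one_pos]; simpa using ht1
  · rwa [Real.sq_sqrt (hn0.trans ht.le)]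

theorem hasSum_synth (c : Coeffs) {w : Fin 4 → ℂ} (hw : w ∈ domainG) :
    HasSum (fun i => c i * basisFun i w) (synth c w) := by
  obtain ⟨s, hs0, hs1, hws⟩ := exists_radius hw
  exact (Summable.of_norm_bounded ((summable_idx hs0 hs1).mul_left ‖c‖)
    (norm_coeffs_mul_le c hw hs0 hws.le)).hasSum

theorem continuous_normSq4 : Continuous normSq4 := by unfold normSq4; fun_prop

theorem coneHol_synth (c : Coeffs) : ConeHol (synth c) := by
  intro a p hp
  obtain ⟨s, hs0, hs1, hws⟩ := exists_radius (chartMap_mem a hp)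
  have hU : IsOpen (baseDomain ∩ {p | normSq4 (chartMap a p) < s ^ 2}) :=
    isOpen_baseDomain.inter (isOpen_lt (continuous_normSq4.comp
      (differentiable_chartMap a).continuous) continuous_const)
  have h := differentiableOn_tsum_of_bound (f := fun i p => c i * basisFun i (chartMap a p)) hU
    ((summable_idx hs0 hs1).mul_left ‖c‖)
    (fun i => ((coneHol_basisFun i a).mono inter_subset_left).const_mul _)
    fun i q hq => norm_coeffs_mul_le c (chartMap_mem a hq.1) hs0 (le_of_lt hq.2) i
  exact (h.differentiableAt (hU.mem_nhds ⟨hp, hws⟩)).differentiableWithinAt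

/-- The Hilbert space of square integrable functions on `baseDomain`. -/
abbrev BaseL2 : Type := Lp ℂ 2 ((volume : Measure (Fin 3 → ℂ)).restrict baseDomain)

theorem inner_toLp {f g : (Fin 4 → ℂ) → ℂ}
    (hf : MemLp (repr f) 2 (volume.restrict baseDomain))
    (hg : MemLp (repr g) 2 (volume.restrict baseDomain)) :
    inner ℂ (hg.toLp _) (hf.toLp _) = ∫ p in baseDomain, repr f p * starRingEnd ℂ (repr g p) := by
  rw [L2.inner_def]
  refine integral_congr_ae ?_
  filter_upwards [hf.coeFn_toLp, hg.coeFn_toLp] with p h1 h2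
  rw [h1, h2, RCLike.inner_apply]

/-- The orthonormal system of the monomials. -/
noncomputable def basisVec (i : Idx) : BaseL2 := (memLp_repr_basisFun i).toLp _

theorem orthonormal_basisVec : Orthonormal ℂ basisVec := by
  classical
  rw [orthonormal_iff_ite]
  intro i j
  rw [basisVec, basisVec, inner_toLp]
  split_ifs with h
  · rw [h, integral_repr_basisFun_self]
  · exact integral_repr_basisFun_of_ne (Ne.symm h)

/-- The isometry of sequences into functions. -/
noncomputable def synthL2 : Coeffs →ₗᵢ[ℂ] BaseL2 :=
  orthonormal_basisVec.orthogonalFamily.linearIsometry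

theorem hasSum_synthL2 (c : Coeffs) : HasSum (fun i => c i • basisVec i) (synthL2 c) := by
  simpa using! orthonormal_basisVec.orthogonalFamily.hasSum_linearIsometry c

open Classical in
theorem synthL2_single (i : Idx) : synthL2 (lp.single 2 i 1) = basisVec i := by
  rw [synthL2, OrthogonalFamily.linearIsometry_apply_single]
  simp

/-- L² convergence yields almost everywhere convergence of a subsequence of partial sums, while the
same partial sums converge pointwise to `synth c`. Thus the Hilbert space sum has a holomorphic
representative. -/
theorem coeFn_synthL2 (c : Coeffs) : synthL2 c =ᵐ[volume.restrict baseDomain] repr (synth c) := by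
  have h1 : Tendsto (fun s : Finset Idx => ∑ i ∈ s, c i • basisVec i) atTop (𝓝 (synthL2 c)) :=
    hasSum_synthL2 c
  obtain ⟨ns, hns, hae⟩ := (tendstoInMeasure_of_tendsto_Lp h1).exists_seq_tendsto_ae'
  have h2 : ∀ᵐ p ∂volume.restrict baseDomain, ∀ i, basisVec i p = repr (basisFun i) p :=
    ae_all_iff.2 fun i => (memLp_repr_basisFun i).coeFn_toLp
  have h3 : ∀ᵐ p ∂volume.restrict baseDomain, ∀ i, (c i • basisVec i : BaseL2) p = c i * basisVec i p :=
    ae_all_iff.2 fun i => Lp.coeFn_smul _ _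
  have h4 : ∀ᵐ p ∂volume.restrict baseDomain, ∀ n, (∑ i ∈ ns n, c i • basisVec i : BaseL2) p =
      ∑ i ∈ ns n, (c i • basisVec i : BaseL2) p :=
    ae_all_iff.2 fun n => Lp.coeFn_fun_finsetSum _ _
  filter_upwards [hae, h2, h3, h4, ae_restrict_mem isOpen_baseDomain.measurableSet]
    with p h5 h6 h7 h8 hp
  refine tendsto_nhds_unique h5 ?_
  have h9 := ((hasSum_synth c (baseMap_mem hp)).mul_left ((Real.sqrt 8 : ℂ) * p 0)).comp hns
  refine h9.congr fun n => ?_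
  simp only [Function.comp_apply, h8, h7, h6, repr]
  exact Finset.sum_congr rfl fun i _ => by ring

theorem memLp_repr_synth (c : Coeffs) : MemLp (repr (synth c)) 2 (volume.restrict baseDomain) :=
  (memLp_congr_ae (coeFn_synthL2 c)).1 (Lp.memLp _)

theorem toLp_repr_synth (c : Coeffs) : (memLp_repr_synth c).toLp _ = synthL2 c := by
  refine Lp.ext ((memLp_repr_synth c).coeFn_toLp.trans (coeFn_synthL2 c).symm)

theorem innerForm_synth (c d : Coeffs) :
    innerForm (ofFun (synth c)) (ofFun (synth d)) = inner ℂ d c := by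
  rw [innerForm_ofFun, ← inner_toLp (memLp_repr_synth c) (memLp_repr_synth d), toLp_repr_synth,
    toLp_repr_synth, LinearIsometry.inner_map_map]

theorem mem_bergmanSpace_synth (c : Coeffs) : ofFun (synth c) ∈ bergmanSpace 3 domainG :=
  mem_bergmanSpace_ofFun.2 ⟨coneHol_synth c,
    (coneHol_synth c).memLp_repr_iff.1 (memLp_repr_synth c)⟩

theorem ConeHol.sub {f g : (Fin 4 → ℂ) → ℂ} (hf : ConeHol f) (hg : ConeHol g) :
    ConeHol fun w => f w - g w := fun a => (hf a).sub (hg a)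

theorem exists_eq_synth {φ : HolForm 3 domainG} (hφ : φ ∈ bergmanSpace 3 domainG) :
    ∃ c : Coeffs, φ = ofFun (synth c) := by
  classical
  obtain ⟨f, rfl⟩ := exists_eq_ofFun φ
  obtain ⟨hf, hfi⟩ := mem_bergmanSpace_ofFun.1 hφ
  change ConeHol f at hf
  have hL := hf.memLp_repr_iff.2 hfi
  -- The adjoint of the isometry extracts the coefficients with respect to the monomials, so f −
  -- synth c is orthogonal to all of them and vanishes by `ConeHol.eq_zero`.
  let c : Coeffs := ContinuousLinearMap.adjoint synthL2.toContinuousLinearMap (hL.toLp _)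
  refine ⟨c, ofFun_eq_iff.2 fun w hw => ?_⟩
  have hd : repr (fun w => f w - synth c w) = repr f - repr (synth c) := by
    funext p; simp [repr]; ring
  have hdL : MemLp (repr fun w => f w - synth c w) 2 (volume.restrict baseDomain) := by
    rw [hd]; exact hL.sub (memLp_repr_synth c)
  have hdt : hdL.toLp _ = hL.toLp _ - synthL2 c := by
    rw [← toLp_repr_synth, ← MemLp.toLp_sub]
    exact MemLp.toLp_congr _ _ (by rw [hd])
  obtain ⟨hw1, hw0⟩ := mem_regularPart.1 hw
  refine sub_eq_zero.1 ((hf.sub (coneHol_synth c)).eq_zero hdL (fun i => ?_) hw1 hw0)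
  rw [← inner_toLp hdL (memLp_repr_basisFun i), hdt]
  change inner ℂ (basisVec i) _ = _
  rw [← synthL2_single, inner_sub_right, LinearIsometry.inner_map_map]
  have h := ContinuousLinearMap.adjoint_inner_right synthL2.toContinuousLinearMap
    (lp.single 2 i 1) (hL.toLp _)
  exact sub_eq_zero.2 h.symm

/-- `synth` preserves inner products, so a sequence whose form vanishes has norm zero. -/
theorem ofFun_synth_eq_zero_iff {c : Coeffs} : ofFun (synth c) = 0 ↔ c = 0 := by
  have h0 : ofFun (synth 0) = 0 := by
    funext p
    simp [ofFun, synth]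
  refine ⟨fun h => ?_, fun h => by rw [h, h0]⟩
  have h1 := innerForm_synth c 0
  have h2 := innerForm_synth c c
  rw [h0, inner_zero_left] at h1
  rw [h] at h1 h2
  rw [h1] at h2
  exact inner_self_eq_zero.1 h2.symm

open Classical in
theorem isOrthonormalBasis_monomials :
    IsOrthonormalBasis (range fun i : Idx => ofFun (synth (lp.single 2 i 1))) where
  subset := by
    rintro _ ⟨i, rfl⟩
    exact mem_bergmanSpace_synth _
  norm_one := by
    rintro _ ⟨i, rfl⟩
    simp [innerForm_synth]
  orthogonal := by
    rintro _ ⟨i, rfl⟩ _ ⟨j, rfl⟩ h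
    have hij : j ≠ i := fun e => h (by rw [e])
    simp [innerForm_synth, lp.inner_single_left, hij]
  total := by
    intro φ hφ h
    obtain ⟨c, rfl⟩ := exists_eq_synth hφ
    refine ofFun_synth_eq_zero_iff.2 (lp.ext (funext fun i => ?_))
    have := h _ ⟨i, rfl⟩
    simpa [innerForm_synth, lp.inner_single_left] using this

/-- The vector that represents the evaluation at `w`. -/
noncomputable def evalVec (w : Fin 4 → ℂ) (hw : w ∈ domainG) : Coeffs :=
  ⟨fun i => starRingEnd ℂ (basisFun i w), by
    refine memℓp_gen ?_
    simpa using (hasSum_norm_basisFun hw).summable⟩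

theorem inner_evalVec (w : Fin 4 → ℂ) (hw : w ∈ domainG) (c : Coeffs) :
    inner ℂ (evalVec w hw) c = synth c w := by
  rw [lp.inner_eq_tsum, synth]
  refine tsum_congr fun i => ?_
  simp [evalVec, RCLike.inner_apply]

theorem inner_evalVec_self (w : Fin 4 → ℂ) (hw : w ∈ domainG) :
    inner ℂ (evalVec w hw) (evalVec w hw) = (kernelFun (normSq4 w) : ℂ) := by
  refine (lp.hasSum_inner (𝕜 := ℂ) (evalVec w hw) (evalVec w hw)).unique ?_
  refine (Complex.hasSum_ofReal.2 (hasSum_norm_basisFun hw)).congr_fun fun i => ?_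
  simp only [evalVec, RCLike.inner_apply, Complex.conj_conj]
  rw [mul_comm, Complex.mul_conj, Complex.normSq_eq_norm_sq]

/-- The sum of the Bergman kernel form. -/
theorem hasSum_hermWedge {S : Set (HolForm 3 domainG)} (hS : IsOrthonormalBasis S)
    (p : regularPart 3 domainG) (v : Fin (3 + 3) → tangentSpace 3 domainG p) :
    HasSum (fun φ : S => hermWedge (φ.1 p) (φ.1 p) v)
      ((kernelFun (normSq4 p) : ℂ) * hermWedge (omega p) (omega p) v) := by
  classical
  choose c hc using fun φ : S => exists_eq_synth (hS.subset φ.2)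
  have ho : Orthonormal ℂ c := by
    rw [orthonormal_iff_ite]
    intro φ ψ
    rw [← innerForm_synth, ← hc, ← hc]
    split_ifs with h
    · rw [h]; exact hS.norm_one _ ψ.2
    · exact hS.orthogonal _ ψ.2 _ φ.2 fun e => h (Subtype.ext e.symm)
  -- Totality of S among forms is completeness of the coefficient vectors in ℓ², since every
  -- sequence gives an element of the Bergman space.
  have hbot : (Submodule.span ℂ (range c))ᗮ = ⊥ := by
    rw [Submodule.eq_bot_iff]
    intro x hx
    refine ofFun_synth_eq_zero_iff.1 (hS.total _ (mem_bergmanSpace_synth x) fun ψ hψ => ?_)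
    have h1 := Submodule.inner_right_of_mem_orthogonal (𝕜 := ℂ)
      (Submodule.subset_span (mem_range_self (⟨ψ, hψ⟩ : S))) hx
    have h2 : ψ = ofFun (synth (c ⟨ψ, hψ⟩)) := hc ⟨ψ, hψ⟩
    rw [h2, innerForm_synth]
    exact h1
  have hp := (mem_regularPart.1 p.2).1
  -- Parseval's identity for the evaluation vector: the sum of |φ(p)|² is its squared norm, whatever
  -- the basis.
  have h := (HilbertBasis.mkOfOrthogonalEqBot ho hbot).hasSum_inner_mul_inner (evalVec p hp)
    (evalVec p hp)
  rw [inner_evalVec_self, HilbertBasis.coe_mkOfOrthogonalEqBot] at h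
  refine (h.mul_right (hermWedge (omega p) (omega p) v)).congr_fun fun φ => ?_
  have h3 : φ.1 p = synth (c φ) p • omega p := congrFun (hc φ) p
  rw [h3, hermWedge_smul_smul, ← inner_conj_symm (c φ), inner_evalVec]

theorem isBergmanKernelForm :
    IsBergmanKernelForm (X := domainG) fun p =>
      (kernelFun (normSq4 p) : ℂ) • hermWedge (omega p) (omega p) where
  nontrivial := by
    classical
    refine ⟨_, mem_bergmanSpace_synth (lp.single 2 ⟨0, 0, 0⟩ 1), fun h => ?_⟩
    have h1 := congrArg (fun c : Coeffs => c ⟨0, 0, 0⟩) (ofFun_synth_eq_zero_iff.1 h)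
    simp at h1
  exists_basis := by
    classical exact ⟨_, isOrthonormalBasis_monomials⟩
  hasSum S hS p v := hasSum_hermWedge hS p v

/-! ### Algebraicity -/

section Algebraic

variable {N : ℕ}

/-- Complex-valued functions whose real and imaginary parts are real polynomials in the real
coordinates. -/
def IsPolyFun (f : (Fin N → ℂ) → ℂ) : Prop :=
  ∃ A B : MvPolynomial (Fin N ⊕ Fin N) ℝ, ∀ z,
    f z = (A.eval (realCoord z) : ℂ) + (B.eval (realCoord z) : ℂ) * Complex.I

namespace IsPolyFun

theorem const (c : ℂ) : IsPolyFun fun _ : Fin N → ℂ => c :=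
  ⟨MvPolynomial.C c.re, MvPolynomial.C c.im, fun z => by simp⟩

theorem coord (j : Fin N) : IsPolyFun fun z : Fin N → ℂ => z j :=
  ⟨MvPolynomial.X (Sum.inl j), MvPolynomial.X (Sum.inr j), fun z => by simp [realCoord]⟩

theorem conj {f : (Fin N → ℂ) → ℂ} (hf : IsPolyFun f) : IsPolyFun fun z => starRingEnd ℂ (f z) := by
  obtain ⟨A, B, h⟩ := hf
  refine ⟨A, -B, fun z => ?_⟩
  simp only [h]
  simp

theorem add {f g : (Fin N → ℂ) → ℂ} (hf : IsPolyFun f) (hg : IsPolyFun g) :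
    IsPolyFun fun z => f z + g z := by
  obtain ⟨A, B, h⟩ := hf
  obtain ⟨A', B', h'⟩ := hg
  refine ⟨A + A', B + B', fun z => ?_⟩
  simp only [h, h', map_add, Complex.ofReal_add]
  ring

theorem mul {f g : (Fin N → ℂ) → ℂ} (hf : IsPolyFun f) (hg : IsPolyFun g) :
    IsPolyFun fun z => f z * g z := by
  obtain ⟨A, B, h⟩ := hf
  obtain ⟨A', B', h'⟩ := hg
  refine ⟨A * A' - B * B', A * B' + B * A', fun z => ?_⟩
  simp only [h, h', map_add, map_sub, map_mul, Complex.ofReal_add, Complex.ofReal_sub,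
    Complex.ofReal_mul]
  linear_combination ((B.eval (realCoord z) : ℂ) * (B'.eval (realCoord z) : ℂ)) * Complex.I_sq

theorem neg {f : (Fin N → ℂ) → ℂ} (hf : IsPolyFun f) : IsPolyFun fun z => -f z := by
  simpa using (const (-1)).mul hf

theorem sum {ι : Type*} (s : Finset ι) {f : ι → (Fin N → ℂ) → ℂ} (hf : ∀ i, IsPolyFun (f i)) :
    IsPolyFun fun z => ∑ i ∈ s, f i z := by
  classical
  induction s using Finset.induction_on with
  | empty => simpa using const 0
  | insert i s hi ih => simpa only [Finset.sum_insert hi] using (hf i).add ih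

end IsPolyFun

theorem analyticAt_eval_realCoord (A : MvPolynomial (Fin N ⊕ Fin N) ℝ) (z : Fin N → ℂ) :
    AnalyticAt ℝ (fun z => A.eval (realCoord z)) z := by
  have h : ∀ i, AnalyticAt ℝ (fun z : Fin N → ℂ => realCoord z i) z := by
    rintro (j | j)
    · exact (Complex.reCLM.comp (ContinuousLinearMap.proj (R := ℝ) (φ := fun _ : Fin N => ℂ) j)).analyticAt z
    · exact (Complex.imCLM.comp (ContinuousLinearMap.proj (R := ℝ) (φ := fun _ : Fin N => ℂ) j)).analyticAt z
  have := AnalyticAt.aeval_mvPolynomial h A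
  simpa only [MvPolynomial.aeval_eq_eval] using this

/-- Rational functions are real-algebraic where the denominator does not vanish. -/
theorem isRealAlgebraicOn_of_eq_div {U : Set (Fin N → ℂ)} (hU : IsOpen U) (hne : U.Nonempty)
    {f : (Fin N → ℂ) → ℝ} (A B : MvPolynomial (Fin N ⊕ Fin N) ℝ)
    (hB : ∀ z ∈ U, B.eval (realCoord z) ≠ 0)
    (hf : ∀ z ∈ U, f z = A.eval (realCoord z) / B.eval (realCoord z)) : IsRealAlgebraicOn U f := by
  refine ⟨fun z hz => ?_, MvPolynomial.rename some B * MvPolynomial.X none -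
    MvPolynomial.rename some A, fun h0 => ?_, fun z hz => ?_⟩
  · refine ((analyticAt_eval_realCoord A z).div (analyticAt_eval_realCoord B z) (hB z hz)).congr ?_
    filter_upwards [hU.mem_nhds hz] with w hw
    exact (hf w hw).symm
  -- The polynomial B·y − A is not zero: at a point of U, with y = f(z) + 1, its value is B(z) ≠ 0.
  · obtain ⟨z, hz⟩ := hne
    have h1 := congrArg
      (MvPolynomial.eval fun o : Option (Fin N ⊕ Fin N) => o.elim (f z + 1) (realCoord z)) h0
    simp only [map_sub, map_mul, MvPolynomial.eval_rename, MvPolynomial.eval_X, map_zero,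
      Function.comp_def, Option.elim_some, Option.elim_none] at h1
    have h2 := hf z hz
    rw [eq_div_iff (hB z hz)] at h2
    exact hB z hz (by linear_combination h1 - h2)
  · simp only [map_sub, map_mul, MvPolynomial.eval_rename, MvPolynomial.eval_X,
      Function.comp_def, Option.elim_some, Option.elim_none]
    rw [hf z hz, mul_div_cancel₀ _ (hB z hz), sub_self]

end Algebraic

/-- The coefficient (k+2)(k+1)² equals 6 C(k+3,3) − 4 C(k+2,2), so the series is a combination of
(1−t)⁻⁴ and (1−t)⁻³. -/
theorem kernelFun_eq {t : ℝ} (h0 : 0 ≤ t) (h1 : t < 1) :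
    kernelFun t = (2 + 4 * t) / (8 * Real.pi ^ 3 * (1 - t) ^ 4) := by
  have ht : ‖t‖ < 1 := by rwa [Real.norm_of_nonneg h0]
  have h3 := (hasSum_choose_mul_geometric_of_norm_lt_one 3 ht).mul_left 6
  have h2 := (hasSum_choose_mul_geometric_of_norm_lt_one 2 ht).mul_left 4
  have hs := (h3.sub h2).mul_left (8 * Real.pi ^ 3)⁻¹
  have h4 : (1 : ℝ) - t ≠ 0 := by linarith
  have hpi := Real.pi_pos
  have e : (8 * Real.pi ^ 3)⁻¹ * (6 * (1 / (1 - t) ^ (3 + 1)) - 4 * (1 / (1 - t) ^ (2 + 1))) =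
      (2 + 4 * t) / (8 * Real.pi ^ 3 * (1 - t) ^ 4) := by
    field_simp
    ring
  rw [e] at hs
  rw [kernelFun]
  refine HasSum.tsum_eq (hs.congr_fun fun k => ?_)
  have c3 : ((k + 3).choose 3 : ℝ) = (k + 3) * (k + 2) * (k + 1) / 6 := by
    rw [Nat.cast_choose_eq_ascPochhammer_div]
    simp [ascPochhammer_succ_right, Nat.factorial]
    ring
  have c2 : ((k + 2).choose 2 : ℝ) = (k + 2) * (k + 1) / 2 := by
    rw [Nat.cast_choose_eq_ascPochhammer_div]
    simp [ascPochhammer_succ_right, Nat.factorial]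
    ring
  rw [c3, c2]
  field_simp
  ring

/-- The rational factor of the Bergman kernel form as a function of `|z|²`. -/
noncomputable def kernelFactor (t : ℝ) : ℝ := (2 + 4 * t) / (8 * Real.pi ^ 3 * (1 - t) ^ 4 * t ^ 2)

/-- An extension of the Bergman kernel form to the punctured ball. -/
noncomputable def kernelExt (z : Fin 4 → ℂ) : (Fin 4 → ℂ) [⋀^Fin (3 + 3)]→ₗ[ℝ] ℂ :=
  (kernelFactor (normSq4 z) : ℂ) • hermWedge (contr (conjGrad z)) (contr (conjGrad z))

/-- The vector `normal` is the conjugate gradient divided by |w|². It enters once in `omega` and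
once in its conjugate, which explains the factor t² in the denominator of `kernelFactor`. -/
theorem kernelExt_restrict (q : regularPart 3 domainG) (v : Fin (3 + 3) → tangentSpace 3 domainG q) :
    kernelExt q (fun j => (v j : Fin 4 → ℂ)) =
      (kernelFun (normSq4 q) : ℂ) * hermWedge (omega q) (omega q) v := by
  obtain ⟨hq, hq0⟩ := mem_regularPart.1 q.2
  have ht := normSq4_pos hq0
  have ht1 : normSq4 q < 1 := hq.1
  have hc : contr (normal q) = ((normSq4 q : ℂ))⁻¹ • contr (conjGrad q) := by
    rw [normal, contr, contr, map_smul]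
  have h1 : hermWedge (omega q) (omega q) v =
      hermWedge (contr (normal q)) (contr (normal q)) fun j => (v j : Fin 4 → ℂ) := by
    have ho : omega q = (contr (normal q)).compLinearMap (tangentSpace 3 domainG q).subtype := rfl
    rw [ho, ← hermWedge_comp]
    simp only [Submodule.subtype_apply]
  rw [h1, hc, hermWedge_smul_smul, kernelFun_eq ht.le ht1, kernelExt]
  rw [AlternatingMap.smul_apply, smul_eq_mul, ← mul_assoc]
  congr 1
  rw [map_inv₀, Complex.conj_ofReal]
  norm_cast
  rw [kernelFactor]
  have : 1 - normSq4 q ≠ 0 := by linarith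
  have := Real.pi_pos
  field_simp

/-- Expanding the contraction in the standard basis leaves products of the entries of `conjGrad z`
and their conjugates, with coefficients independent of z. -/
theorem isPolyFun_hermWedge (v : Fin (3 + 3) → Fin 4 → ℂ) :
    IsPolyFun fun z : Fin 4 → ℂ => hermWedge (contr (conjGrad z)) (contr (conjGrad z)) v := by
  have hg : ∀ j, IsPolyFun fun z : Fin 4 → ℂ => conjGrad z j := by
    intro j
    fin_cases j
    · exact (IsPolyFun.coord 3).conj
    · exact (IsPolyFun.coord 2).conj.neg
    · exact (IsPolyFun.coord 1).conj.neg
    · exact (IsPolyFun.coord 0).conj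
  have h : ∀ z : Fin 4 → ℂ, hermWedge (contr (conjGrad z)) (contr (conjGrad z)) v =
      ∑ j, ∑ k, conjGrad z j * starRingEnd ℂ (conjGrad z k) *
        hermWedge (contr (Pi.single j 1)) (contr (Pi.single k 1)) v := by
    intro z
    have hz : contr (conjGrad z) = ∑ j, conjGrad z j • contr (Pi.single j 1) := by
      have h1 : conjGrad z = ∑ j, conjGrad z j • (Pi.single j 1 : Fin 4 → ℂ) := by
        ext i; simp [Finset.sum_apply, Pi.single_apply]
      conv_lhs => rw [h1]
      simp only [contr, map_sum, map_smul]
    rw [hz, hermWedge_sum_sum]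
    simp only [hermWedge_smul_smul]
  simp only [h]
  exact IsPolyFun.sum _ fun j => IsPolyFun.sum _ fun k =>
    ((hg j).mul (hg k).conj).mul (IsPolyFun.const _)

theorem exists_eval_eq_normSq4 :
    ∃ T : MvPolynomial (Fin 4 ⊕ Fin 4) ℝ, ∀ z, T.eval (realCoord z) = normSq4 z := by
  refine ⟨∑ j, (MvPolynomial.X (Sum.inl j) ^ 2 + MvPolynomial.X (Sum.inr j) ^ 2), fun z => ?_⟩
  simp only [map_sum, map_add, map_pow, MvPolynomial.eval_X, normSq4, realCoord, Sum.elim_inl,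
    Sum.elim_inr, ← Complex.normSq_eq_norm_sq, Complex.normSq_apply]
  exact Finset.sum_congr rfl fun j _ => by ring

theorem isRealAlgebraicFormOn_kernelExt {U : Set (Fin 4 → ℂ)} (hU : IsOpen U) (hne : U.Nonempty)
    (hpos : ∀ z ∈ U, 0 < normSq4 z ∧ normSq4 z < 1) : IsRealAlgebraicFormOn U kernelExt := by
  intro c
  obtain ⟨T, hT⟩ := exists_eval_eq_normSq4
  obtain ⟨A, B, hAB⟩ := isPolyFun_hermWedge fun j => realBasis (c j)
  have hpi := Real.pi_pos
  have hD : ∀ z ∈ U, (MvPolynomial.C (8 * Real.pi ^ 3) * (1 - T) ^ 4 * T ^ 2).eval (realCoord z) ≠ 0 := by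
    intro z hz
    obtain ⟨h0, h1⟩ := hpos z hz
    have h2 : 1 - normSq4 z ≠ 0 := by linarith
    simp only [map_mul, map_pow, map_sub, map_one, MvPolynomial.eval_C, hT]
    positivity
  have hval : ∀ z, kernelExt z (fun j => realBasis (c j)) = (kernelFactor (normSq4 z) : ℂ) *
      ((A.eval (realCoord z) : ℂ) + (B.eval (realCoord z) : ℂ) * Complex.I) := fun z => by
    rw [← hAB]; rfl
  constructor
  · refine isRealAlgebraicOn_of_eq_div hU hne ((MvPolynomial.C 2 + MvPolynomial.C 4 * T) * A) _ hD
      fun z hz => ?_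
    rw [hval, Complex.re_ofReal_mul]
    simp [hT, kernelFactor]
    ring
  · refine isRealAlgebraicOn_of_eq_div hU hne ((MvPolynomial.C 2 + MvPolynomial.C 4 * T) * B) _ hD
      fun z hz => ?_
    rw [hval, Complex.im_ofReal_mul]
    simp [hT, kernelFactor]
    ring

/-- A kernel form is determined by the sum over any one orthonormal basis, so every K satisfying the
definition is the explicit one. -/
theorem IsBergmanKernelForm.apply_eq {K : RealForm 3 (3 + 3) domainG} (hK : IsBergmanKernelForm K)
    (p : regularPart 3 domainG) (v : Fin (3 + 3) → tangentSpace 3 domainG p) :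
    K p v = (kernelFun (normSq4 p) : ℂ) * hermWedge (omega p) (omega p) v := by
  obtain ⟨S, hS⟩ := hK.exists_basis
  exact (hK.hasSum S hS p v).unique (hasSum_hermWedge hS p v)

theorem IsBergmanKernelForm.isRealAlgebraicForm {K : RealForm 3 (3 + 3) domainG}
    (hK : IsBergmanKernelForm K) : IsRealAlgebraicForm K := by
  intro p
  obtain ⟨hp, hp0⟩ := mem_regularPart.1 p.2
  have hopen : IsOpen {z : Fin 4 → ℂ | 0 < normSq4 z ∧ normSq4 z < 1} :=
    (isOpen_lt continuous_const continuous_normSq4).inter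
      (isOpen_lt continuous_normSq4 continuous_const)
  -- On a ball inside the punctured unit ball the denominator t²(1−t)⁴ of the extension has no
  -- zeros.
  obtain ⟨ε, hε, hb⟩ := Metric.isOpen_iff.1 hopen p.1 ⟨normSq4_pos hp0, hp.1⟩
  have hne : (Metric.ball p.1 ε).Nonempty := ⟨_, Metric.mem_ball_self hε⟩
  refine ⟨Metric.ball p.1 ε, Metric.mem_ball_self hε, Metric.isOpen_ball,
    ⟨hne, (convex_ball p.1 ε).isPreconnected⟩, kernelExt,
    isRealAlgebraicFormOn_kernelExt Metric.isOpen_ball hne fun z hz => hb hz, fun q _ v => ?_⟩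
  rw [kernelExt_restrict, hK.apply_eq]

end Bergman

theorem mainTheorem6 :
    (∃ K : Bergman.RealForm 3 (3 + 3) Bergman.domainG, Bergman.IsBergmanKernelForm K) ∧
      ∀ K : Bergman.RealForm 3 (3 + 3) Bergman.domainG,
        Bergman.IsBergmanKernelForm K → Bergman.IsRealAlgebraicForm K :=
  ⟨⟨_, Bergman.isBergmanKernelForm⟩, fun _ hK => hK.isRealAlgebraicForm⟩
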